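/- Let $p\ge 1$. Write the coordinates of $\mathbb{R}^{4p}$ as $\underline X=(x_1,y_1,\dots,x_{2p},y_{2p})$ and let $\mathbb{C}_{4p}$ be the complex Clifford algebra with generators $e_1,\dots,e_{4p}$, $e_\alpha e_\beta+e_\beta e_\alpha=-2\delta_{\alpha\beta}$. Put $\mathfrak f_k=-\tfrac12(e_{2k-1}-ie_{2k})$, $\mathfrak f_k^\dagger=\tfrac12(e_{2k-1}+ie_{2k})$, $z_k=x_k+iy_k$, $z_k^c=x_k-iy_k$ for $k=1,\dots,2p$. *Monogenicity.* Let $\mathbb I,\mathbb J$ be the linear maps with $\mathbb I[e_{2k-1}]=e_{2k}$, $\mathbb I[e_{2k}]=-e_{2k-1}$ for $1\le k\le 2p$, and $\mathbb J[e_{4j-3}]=e_{4j-1}$, $\mathbb J[e_{4j-2}]=-e_{4j}$, $\mathbb J[e_{4j-1}]=-e_{4j-3}$, $\mathbb J[e_{4j}]=e_{4j-2}$ for $1\le j\le p$, and let $\mathbb K=\mathbb J\circ\mathbb I$. A differentiable function $F$ on an open set $\Omega\subset\mathbb{R}^{4p}$ with values in $\mathbb{C}_{4p}$ (for instance in the spinor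 space $\mathbb{C}_{4p}I$, $I=\prod_{k=1}^{2p}\mathfrak f_k\mathfrak f_k^\dagger$) is called quaternionic monogenic in $\Omega$ if $\sum_{\alpha} A[e_\alpha]\,\partial_{X_\alpha}F=0$ in $\Omega$ for each $A\in\{\mathbf 1,\mathbb I,\mathbb J,\mathbb K\}$. *Kernels.* For a point $\underline X$ put $$\underline z=\sum_{k=1}^{2p} z_k\mathfrak f_k,\quad \underline z^\dagger=\sum_{k=1}^{2p} z_k^c\mathfrak f_k^\dagger,\quad \underline z^J=\sum_{j=1}^p\big(z_{2j}\mathfrak f_{2j-1}^\dagger-z_{2j-1}\mathfrak f_{2j}^\dagger\big),\quad \underline z^{\dagger J}=\sum_{j=1}^p\big(z_{2j}^c\mathfrak f_{2j-1}-z_{2j-1}^c\mathfrak f_{2j}\big),$$ $|\underline z|=|\underline X|$, and, with $a_{4p}$ the area of the unit sphere $S^{4p-1}$, $$E=\frac{2}{a_{4p}}\frac{\underline z}{|\underline z|^{4p}},\quad E^\dagger=\frac{2}{a_{4p}}\frac{\underline z^\dagger}{|\underline z|^{4p}},\quad E^J=\frac{2}{a_{4p}}\frac{\underline z^J}{|\underline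 z|^{4p}},\quad E^{\dagger J}=\frac{2}{a_{4p}}\frac{\underline z^{\dagger J}}{|\underline z|^{4p}},$$ all regarded as functions of $\underline z$. *Forms.* Let $\widehat{dz_k}$ (respectively $\widehat{dz_k^c}$) be the $(4p-1)$-form obtained from $dz_1\wedge dz_1^c\wedge\dots\wedge dz_{2p}\wedge dz_{2p}^c$ by omitting the factor $dz_k$ (respectively $dz_k^c$), and put $$d\sigma_{\underline z}=\sum_{k=1}^{2p}\mathfrak f_k^\dagger\,\widehat{dz_k},\qquad d\sigma_{\underline z^\dagger}=-\sum_{k=1}^{2p}\mathfrak f_k\,\widehat{dz_k^c},$$ $$d\sigma_{\underline z^J}=\sum_{j=1}^p\big(\mathfrak f_{2j-1}\widehat{dz_{2j}}-\mathfrak f_{2j}\widehat{dz_{2j-1}}\big),\qquad d\sigma_{\underline z^{\dagger J}}=-\sum_{j=1}^p\big(\mathfrak f_{2j-1}^\dagger\widehat{dz_{2j}^c}-\mathfrak f_{2j}^\dagger\widehat{dz_{2j-1}^c}\big).$$ **Statement.** Let $D\subset\mathbb{R}^{4p}$ be a bounded domain with smooth boundary $\partial D$, oriented as the boundary of $D$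 (outward normal first), and let $g$ be quaternionic monogenic in an open neighbourhood of $\overline D$. Let $\underline X$ be a point of the interior of $D$, with corresponding variable $\underline z$, and let $\underline v$ be the variable corresponding to $\underline Y\in\partial D$. Then $$g(\underline X)=\frac1{(-4)^p}\int_{\partial D}\big[E(\underline v-\underline z)\,d\sigma_{\underline v}+E^\dagger(\underline v-\underline z)\,d\sigma_{\underline v^\dagger}\big]\,g(\underline Y),$$ $$g(\underline X)=\frac1{(-4)^p}\int_{\partial D}\big[E^J(\underline v-\underline z)\,d\sigma_{\underline v^J}+E^{\dagger J}(\underline v-\underline z)\,d\sigma_{\underline v^{\dagger J}}\big]\,g(\underline Y),$$ $$\int_{\partial D}\big[E(\underline v-\underline z)\,d\sigma_{\underline v^\dagger}+E^\dagger(\underline v-\underline z)\,d\sigma_{\underline v}\big]\,g(\underline Y)=0,$$ $$\int_{\partial D}\big[E^J(\underline v-\underline z)\,d\sigma_{\underline v^{\dagger J}}+E^{\dagger J}(\underline v-\underline z)\,d\sigma_{\underline v^J}\big]\,g(\underline Y)=0,$$ all four integrands being integrable over $\partial D$. -/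

import Mathlib

noncomputable section

namespace QuatClifford

open MeasureTheory
open scoped ContDiff

/-- The space `ℝ^{4p}` with its Euclidean structure. The coordinates are ordered as
`(X_1, …, X_{4p}) = (x_1, y_1, x_2, y_2, …, x_{2p}, y_{2p})`, numbered from `0` here. -/
abbrev V (p : ℕ) : Type := EuclideanSpace ℝ (Fin (4 * p))

/-! ### The complex Clifford algebra -/

/-- The quadratic form `-(w_1² + ⋯ + w_{4p}²)` on `ℂ^{4p}`. -/
def negForm (p : ℕ) : QuadraticForm ℂ (Fin (4 * p) → ℂ) :=
  QuadraticMap.weightedSumSquares ℂ (fun _ => (-1 : ℂ))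

/-- The complex Clifford algebra `ℂ_{4p} = ℂ ⊗ ℝ_{0,4p}`: generators with `e_α² = -1`,
`e_α e_β + e_β e_α = 0` for `α ≠ β`. -/
abbrev Cl (p : ℕ) : Type := CliffordAlgebra (negForm p)

/-- The generator `e_α`. -/
def e {p : ℕ} (α : Fin (4 * p)) : Cl p := CliffordAlgebra.ι (negForm p) (Pi.single α 1)

/-- The coordinates of an element of `ℂ_{4p}` with respect to the basis indexed by the subsets
`A ⊆ {1, …, 4p}` (which corresponds to `e_{α_1} ∧ ⋯ ∧ e_{α_h}` in the exterior algebra). -/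
def coords (p : ℕ) : Cl p ≃ₗ[ℂ] EuclideanSpace ℂ (Finset (Fin (4 * p))) :=
  ((CliffordAlgebra.equivExterior (negForm p)).trans
    (Pi.basisFun ℂ (Fin (4 * p))).ExteriorAlgebra.equivFun).trans
      (WithLp.linearEquiv 2 ℂ (Finset (Fin (4 * p)) → ℂ)).symm

/-- The Euclidean norm `|a|² = ∑_A |a_A|²` on the finite-dimensional space `ℂ_{4p}`; it serves
only to speak of derivatives and integrals of functions with values in `ℂ_{4p}`. -/
instance instNormedAddCommGroupCl (p : ℕ) : NormedAddCommGroup (Cl p) :=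
  NormedAddCommGroup.induced (Cl p) (EuclideanSpace ℂ (Finset (Fin (4 * p))))
    (coords p).toLinearMap (coords p).injective

instance instNormedSpaceCl (p : ℕ) : NormedSpace ℂ (Cl p) :=
  NormedSpace.induced ℂ (Cl p) (EuclideanSpace ℂ (Finset (Fin (4 * p)))) (coords p).toLinearMap

/-! ### Indices -/

/-- The position of the real coordinate `x_k`. -/
def xi {p : ℕ} (k : Fin (2 * p)) : Fin (4 * p) := ⟨2 * k.1, by omega⟩

/-- The position of the real coordinate `y_k`. -/
def yi {p : ℕ} (k : Fin (2 * p)) : Fin (4 * p) := ⟨2 * k.1 + 1, by omega⟩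

/-- The first complex index (`2j-1` when counting from one) of the `j`-th pair. -/
def fst {p : ℕ} (j : Fin p) : Fin (2 * p) := ⟨2 * j.1, by omega⟩

/-- The second complex index (`2j` when counting from one) of the `j`-th pair. -/
def snd {p : ℕ} (j : Fin p) : Fin (2 * p) := ⟨2 * j.1 + 1, by omega⟩

/-! ### Quaternionic monogenic functions -/

/-- The partial derivative `∂_{X_α} F`. -/
def pd {p : ℕ} (α : Fin (4 * p)) (F : V p → Cl p) (X : V p) : Cl p :=
  fderiv ℝ F X (EuclideanSpace.single α 1)

/-- The Dirac operator `∂`. -/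
def dirac {p : ℕ} (F : V p → Cl p) (X : V p) : Cl p :=
  ∑ k : Fin (2 * p), (e (xi k) * pd (xi k) F X + e (yi k) * pd (yi k) F X)

/-- The rotated Dirac operator `∂_𝕀 = 𝕀[∂]`. -/
def diracI {p : ℕ} (F : V p → Cl p) (X : V p) : Cl p :=
  ∑ k : Fin (2 * p), (-(e (xi k) * pd (yi k) F X) + e (yi k) * pd (xi k) F X)

/-- The rotated Dirac operator `∂_𝕁 = 𝕁[∂]`. -/
def diracJ {p : ℕ} (F : V p → Cl p) (X : V p) : Cl p :=
  ∑ j : Fin p,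
    (-(e (xi (fst j)) * pd (xi (snd j)) F X) + e (yi (fst j)) * pd (yi (snd j)) F X
      + e (xi (snd j)) * pd (xi (fst j)) F X - e (yi (snd j)) * pd (yi (fst j)) F X)

/-- The rotated Dirac operator `∂_𝕂 = 𝕂[∂]`. -/
def diracK {p : ℕ} (F : V p → Cl p) (X : V p) : Cl p :=
  ∑ j : Fin p,
    (e (xi (fst j)) * pd (yi (snd j)) F X + e (yi (fst j)) * pd (xi (snd j)) F X
      - e (xi (snd j)) * pd (yi (fst j)) F X - e (yi (snd j)) * pd (xi (fst j)) F X)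

/-- `F` is quaternionic monogenic in the open set `Ω`: it is differentiable there and is
annihilated by the four Dirac operators. The values are allowed in the whole of `ℂ_{4p}`;
functions with values in spinor space, the left ideal `ℂ_{4p} I`, are included. -/
structure QuaternionicMonogenicOn {p : ℕ} (F : V p → Cl p) (Ω : Set (V p)) : Prop where
  differentiableOn : DifferentiableOn ℝ F Ω
  dirac_eq_zero : ∀ X ∈ Ω, dirac F X = 0
  diracI_eq_zero : ∀ X ∈ Ω, diracI F X = 0
  diracJ_eq_zero : ∀ X ∈ Ω, diracJ F X = 0
  diracK_eq_zero : ∀ X ∈ Ω, diracK F X = 0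

/-! ### Witt basis, hermitian vector variables, kernels -/

/-- The Witt basis vector `𝔣_k = -½ (e_{2k-1} - i e_{2k})`. -/
def f {p : ℕ} (k : Fin (2 * p)) : Cl p :=
  (-(1 / 2) : ℂ) • (e (xi k) - Complex.I • e (yi k))

/-- The Witt basis vector `𝔣_k† = ½ (e_{2k-1} + i e_{2k})`. -/
def fd {p : ℕ} (k : Fin (2 * p)) : Cl p :=
  (1 / 2 : ℂ) • (e (xi k) + Complex.I • e (yi k))

/-- The complex coordinate `z_k = x_k + i y_k`, which is also the 1-form `dz_k`. -/
def zc {p : ℕ} (k : Fin (2 * p)) : V p →ₗ[ℝ] ℂ where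
  toFun X := (X (xi k) : ℂ) + Complex.I * (X (yi k) : ℂ)
  map_add' X Y := by simp; ring
  map_smul' c X := by simp; ring

/-- The conjugate coordinate `z_k^c = x_k - i y_k`, which is also the 1-form `dz_k^c`. -/
def zcc {p : ℕ} (k : Fin (2 * p)) : V p →ₗ[ℝ] ℂ where
  toFun X := (X (xi k) : ℂ) - Complex.I * (X (yi k) : ℂ)
  map_add' X Y := by simp; ring
  map_smul' c X := by simp; ring

/-- `z = ∑ z_k 𝔣_k`, as a function of the point `X`. -/
def hz {p : ℕ} (X : V p) : Cl p := ∑ k : Fin (2 * p), zc k X • f k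

/-- `z† = ∑ z_k^c 𝔣_k†`. -/
def hzd {p : ℕ} (X : V p) : Cl p := ∑ k : Fin (2 * p), zcc k X • fd k

/-- `z^J = 𝕁[z] = ∑ (z_{2j} 𝔣_{2j-1}† - z_{2j-1} 𝔣_{2j}†)`. -/
def hzJ {p : ℕ} (X : V p) : Cl p :=
  ∑ j : Fin p, (zc (snd j) X • fd (fst j) - zc (fst j) X • fd (snd j))

/-- `z^{†J} = 𝕁[z†] = ∑ (z_{2j}^c 𝔣_{2j-1} - z_{2j-1}^c 𝔣_{2j})`. -/
def hzdJ {p : ℕ} (X : V p) : Cl p :=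
  ∑ j : Fin p, (zcc (snd j) X • f (fst j) - zcc (fst j) X • f (snd j))

/-- The area `a_{4p}` of the unit sphere in `ℝ^{4p}`. -/
def area (p : ℕ) : ℝ := (μHE[4 * p - 1] (Metric.sphere (0 : V p) 1)).toReal

/-- The scalar factor `(2 / a_{4p}) |z|^{-4p}`, where `|z|² = ∑ |z_k|² = |X|²`. -/
def kerFactor {p : ℕ} (X : V p) : ℂ := ((2 / area p / ‖X‖ ^ (4 * p) : ℝ) : ℂ)

/-- The kernel `E(z)`. -/
def kerE {p : ℕ} (X : V p) : Cl p := kerFactor X • hz X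

/-- The kernel `E†(z)`. -/
def kerEd {p : ℕ} (X : V p) : Cl p := kerFactor X • hzd X

/-- The kernel `E^J(z)`. -/
def kerEJ {p : ℕ} (X : V p) : Cl p := kerFactor X • hzJ X

/-- The kernel `E^{†J}(z)`. -/
def kerEdJ {p : ℕ} (X : V p) : Cl p := kerFactor X • hzdJ X

/-! ### Differential forms of degree `4p - 1` -/

/-- Constant-coefficient forms of degree `4p - 1` on `ℝ^{4p}` with values in `W`, i.e. the values
of such differential forms at a point. -/
abbrev TopForm (p : ℕ) (W : Type) [AddCommGroup W] [Module ℝ W] : Type :=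
  V p [⋀^Fin (4 * p - 1)]→ₗ[ℝ] W

/-- The wedge product `θ_1 ∧ ⋯ ∧ θ_k` of complex-valued 1-forms, with the convention
`(θ_1 ∧ ⋯ ∧ θ_k)(v_1, …, v_k) = det (θ_a(v_b))`. -/
def wedge {U : Type} [AddCommGroup U] [Module ℝ U] {k : ℕ} (θ : Fin k → U →ₗ[ℝ] ℂ) :
    U [⋀^Fin k]→ₗ[ℝ] ℂ where
  toFun v := Matrix.det (Matrix.of fun a b => θ a (v b))
  map_update_add' := by
    intro inst v b x y
    obtain rfl : inst = instDecidableEqFin k := Subsingleton.elim _ _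
    have h : ∀ u : U, (Matrix.of fun a b' => θ a (Function.update v b u b')) =
        Matrix.updateCol (Matrix.of fun a b' => θ a (v b')) b (fun a => θ a u) := by
      intro u
      ext a b'
      by_cases hb : b' = b
      · subst hb; simp
      · simp [hb]
    rw [h, h, h, ← Matrix.det_updateCol_add]
    congr 2
    ext a
    simp
  map_update_smul' := by
    intro inst v b c x
    obtain rfl : inst = instDecidableEqFin k := Subsingleton.elim _ _
    have h : ∀ u : U, (Matrix.of fun a b' => θ a (Function.update v b u b')) =
        Matrix.updateCol (Matrix.of fun a b' => θ a (v b')) b (fun a => θ a u) := by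
      intro u
      ext a b'
      by_cases hb : b' = b
      · subst hb; simp
      · simp [hb]
    rw [h, h, Complex.real_smul, ← Matrix.det_updateCol_smul]
    congr 2
    ext a
    simp
  map_eq_zero_of_eq' := by
    intro v i j hv hij
    exact Matrix.det_zero_of_column_eq hij (fun a => by simp [hv])

/-- The increasing enumeration of `{0, …, m-1} ∖ {j}`. -/
def skip {m : ℕ} (j : Fin m) (i : Fin (m - 1)) : Fin m :=
  if i.1 < j.1 then ⟨i.1, by omega⟩ else ⟨i.1 + 1, by omega⟩

/-- The sequence of 1-forms `dz_1, dz_1^c, dz_2, dz_2^c, …, dz_{2p}, dz_{2p}^c`. -/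
def dzSeq {p : ℕ} (a : Fin (4 * p)) : V p →ₗ[ℝ] ℂ :=
  if a.1 % 2 = 0 then zc ⟨a.1 / 2, by omega⟩ else zcc ⟨a.1 / 2, by omega⟩

/-- The form `\widehat{dz_k}`: the wedge product of the sequence `dz_1, dz_1^c, …, dz_{2p}^c`
with `dz_k` omitted. -/
def hatdz {p : ℕ} (k : Fin (2 * p)) : TopForm p ℂ := wedge fun i => dzSeq (skip (xi k) i)

/-- The form `\widehat{dz_k^c}`: the wedge product of the sequence `dz_1, dz_1^c, …, dz_{2p}^c`
with `dz_k^c` omitted. -/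
def hatdzc {p : ℕ} (k : Fin (2 * p)) : TopForm p ℂ := wedge fun i => dzSeq (skip (yi k) i)

/-- The Clifford-valued form `a η` for `a ∈ ℂ_{4p}` and a complex-valued form `η`. -/
def tens {p : ℕ} (a : Cl p) (η : TopForm p ℂ) : TopForm p (Cl p) :=
  ((LinearMap.toSpanSingleton ℂ (Cl p) a).restrictScalars ℝ).compAlternatingMap η

/-- `dσ_z = ∑ 𝔣_k† \widehat{dz_k}`. -/
def dσ (p : ℕ) : TopForm p (Cl p) := ∑ k : Fin (2 * p), tens (fd k) (hatdz k)

/-- `dσ_{z†} = -∑ 𝔣_k \widehat{dz_k^c}`. -/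
def dσd (p : ℕ) : TopForm p (Cl p) := -∑ k : Fin (2 * p), tens (f k) (hatdzc k)

/-- `dσ_{z^J} = ∑ (𝔣_{2j-1} \widehat{dz_{2j}} - 𝔣_{2j} \widehat{dz_{2j-1}})`. -/
def dσJ (p : ℕ) : TopForm p (Cl p) :=
  ∑ j : Fin p, (tens (f (fst j)) (hatdz (snd j)) - tens (f (snd j)) (hatdz (fst j)))

/-- `dσ_{z^{†J}} = -∑ (𝔣_{2j-1}† \widehat{dz_{2j}^c} - 𝔣_{2j}† \widehat{dz_{2j-1}^c})`. -/
def dσdJ (p : ℕ) : TopForm p (Cl p) :=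
  -∑ j : Fin p, (tens (fd (fst j)) (hatdzc (snd j)) - tens (fd (snd j)) (hatdzc (fst j)))

/-- The product `a η b` of a Clifford-valued form with Clifford numbers on both sides. -/
def sandwich {p : ℕ} (a : Cl p) (η : TopForm p (Cl p)) (b : Cl p) : TopForm p (Cl p) :=
  ((LinearMap.mulLeftRight ℂ (a, b)).restrictScalars ℝ).compAlternatingMap η

/-! ### Smooth domains and integration over the boundary -/

/-- `ρ` is a smooth defining function of `D` on the open neighbourhood `U` of `x`. -/
structure IsLocalDefiningFunction {p : ℕ} (D : Set (V p)) (x : V p) (U : Set (V p))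
    (ρ : V p → ℝ) : Prop where
  isOpen : IsOpen U
  mem : x ∈ U
  contDiffOn : ContDiffOn ℝ ∞ ρ U
  gradient_ne_zero : ∀ y ∈ U, gradient ρ y ≠ 0
  mem_iff : ∀ y ∈ U, y ∈ D ↔ ρ y < 0

/-- `D` has a smooth boundary: near each boundary point it is `{ρ < 0}` for a smooth `ρ` with
nowhere vanishing gradient. -/
def HasSmoothBoundary {p : ℕ} (D : Set (V p)) : Prop :=
  ∀ x ∈ frontier D, ∃ U ρ, IsLocalDefiningFunction D x U ρ

/-- `ν` is the outward unit normal `∇ρ / |∇ρ|` of `D` at `x`. -/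
def IsOutwardUnitNormal {p : ℕ} (D : Set (V p)) (x ν : V p) : Prop :=
  ∃ U ρ, IsLocalDefiningFunction D x U ρ ∧ ν = ‖gradient ρ x‖⁻¹ • gradient ρ x

open Classical in
/-- The outward unit normal of `D` at the boundary point `x` (it does not depend on the local
defining function). -/
def outwardNormal {p : ℕ} (D : Set (V p)) (x : V p) : V p :=
  if h : ∃ ν, IsOutwardUnitNormal D x ν then h.choose else 0

/-- The value of the form `η` on the oriented hyperplane with unit normal `ν`, that is
`η(t_1, …, t_{4p-1})` for any orthonormal `t_i` such that `(ν, t_1, …, t_{4p-1})` is a positively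
oriented orthonormal basis. It is computed as `(ν^♭ ∧ η)(ε_1, …, ε_{4p})` on the standard basis
`ε_α` of `ℝ^{4p}`. -/
def density {p : ℕ} (η : TopForm p (Cl p)) (ν : V p) : Cl p :=
  ∑ α : Fin (4 * p),
    ((-1 : ℂ) ^ (α : ℕ) * (ν α : ℂ)) • η (fun i => EuclideanSpace.single (skip α i) (1 : ℝ))

/-- Integrability of the form `η` over `∂D` with respect to the surface measure. -/
def BoundaryIntegrable {p : ℕ} (D : Set (V p)) (η : V p → TopForm p (Cl p)) : Prop :=
  IntegrableOn (fun Y => density (η Y) (outwardNormal D Y)) (frontier D) μHE[4 * p - 1]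

/-- The integral `∫_{∂D} η` of a form of degree `4p - 1` over `∂D`, oriented as the boundary
of `D` (outward normal first). -/
def boundaryIntegral {p : ℕ} (D : Set (V p)) (η : V p → TopForm p (Cl p)) : Cl p :=
  ∫ Y in frontier D, density (η Y) (outwardNormal D Y) ∂μHE[4 * p - 1]

/-- `[E(v-z) dσ_v + E†(v-z) dσ_{v†}] g(Y)`. -/
def reproForm {p : ℕ} (g : V p → Cl p) (X Y : V p) : TopForm p (Cl p) :=
  sandwich (kerE (Y - X)) (dσ p) (g Y) + sandwich (kerEd (Y - X)) (dσd p) (g Y)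

/-- `[E^J(v-z) dσ_{v^J} + E^{†J}(v-z) dσ_{v^{†J}}] g(Y)`. -/
def reproFormJ {p : ℕ} (g : V p → Cl p) (X Y : V p) : TopForm p (Cl p) :=
  sandwich (kerEJ (Y - X)) (dσJ p) (g Y) + sandwich (kerEdJ (Y - X)) (dσdJ p) (g Y)

/-- `[E(v-z) dσ_{v†} + E†(v-z) dσ_v] g(Y)`. -/
def crossForm {p : ℕ} (g : V p → Cl p) (X Y : V p) : TopForm p (Cl p) :=
  sandwich (kerE (Y - X)) (dσd p) (g Y) + sandwich (kerEd (Y - X)) (dσ p) (g Y)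

/-- `[E^J(v-z) dσ_{v^{†J}} + E^{†J}(v-z) dσ_{v^J}] g(Y)`. -/
def crossFormJ {p : ℕ} (g : V p → Cl p) (X Y : V p) : TopForm p (Cl p) :=
  sandwich (kerEJ (Y - X)) (dσdJ p) (g Y) + sandwich (kerEdJ (Y - X)) (dσJ p) (g Y)

end QuatClifford

end

/-!
The hermitian Dirac operators, with the coefficients of `z`, `z†`, `z^J`, `z^{†J}` as symbols, are
linear combinations of the four Dirac operators, so they annihilate a quaternionic monogenic `g`.
The matrix `M` of `dz_1, dz_1^c, …` satisfies `M Mᴴ = 2` and `det M = (-4)^p`, so its minors are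
entries of `((-4)^p / 2) Mᴴ`. Hence the density of `dσ_z` on a hyperplane with normal `ν` is
`(-4)^p / 2` times the hermitian variable `z†` at `ν`, and similarly for the other three
forms. With `v = Y - X`, each of the four integrals is therefore `(-4)^p / a_{4p}` times the flux
through `∂D` of the field with components `|v|^{-4p} (A₁(v) B₁(ε_α) + A₂(v) B₂(ε_α)) g(Y)`, where
`A_i` and `B_i` are hermitian variables. By monogenicity the derivatives of `g` do not contribute to
its divergence. The Witt relations give `A₁(v) B₁(v) + A₂(v) B₂(v) = c |v|²`, with `c = 1` when `z`
is paired with `z†` and `c = 0` when each variable is paired with itself. The field is thus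
divergence free away from `X`, and truncating its singularity turns the divergence into
`c a_{4p} g` times an approximate identity at `X`.

The divergence theorem is needed for fields that are merely differentiable with continuous
divergence. Near a boundary point a chart that is close to an isometry flattens the boundary;
integrating the divergence against cutoffs that decrease from `1` to `0` in a thin slab along the
boundary compares volume integral and flux up to a relative error `η`. A partition of unity
globalizes the estimate, and `η` tends to `0`.
-/

noncomputable section

namespace QuatClifford

open MeasureTheory Filter Topology Set
open scoped ContDiff NNReal Manifold

/-! ### Divergence of vector fields with compact support -/

section Divergence

variable {n : ℕ} {W : Type*} [NormedAddCommGroup W] [NormedSpace ℝ W]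

/-- The divergence `∑ ∂F_i/∂x_i` of a vector field with coefficients in `W`. -/
def divergence (F : EuclideanSpace ℝ (Fin n) → Fin n → W) (x : EuclideanSpace ℝ (Fin n)) : W :=
  ∑ i, fderiv ℝ F x (EuclideanSpace.single i 1) i

theorem divergence_of_notMem_tsupport {F : EuclideanSpace ℝ (Fin n) → Fin n → W}
    {x : EuclideanSpace ℝ (Fin n)} (hx : x ∉ tsupport F) : divergence F x = 0 := by
  simp [divergence, fderiv_of_notMem_tsupport (𝕜 := ℝ) hx]

/-- The contraction `∑ ν_i w_i` of a vector of `ℝⁿ` with a vector with coefficients in `W`. -/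
def contract (ν : EuclideanSpace ℝ (Fin n)) (w : Fin n → W) : W := ∑ i, ν i • w i

@[fun_prop]
theorem continuous_contract :
    Continuous fun z : EuclideanSpace ℝ (Fin n) × (Fin n → W) => contract z.1 z.2 := by
  unfold contract
  fun_prop

theorem contract_neg_left (ν : EuclideanSpace ℝ (Fin n)) (w : Fin n → W) :
    contract (-ν) w = -contract ν w := by
  simp [contract]

theorem contract_smul_left (c : ℝ) (ν : EuclideanSpace ℝ (Fin n)) (w : Fin n → W) :
    contract (c • ν) w = c • contract ν w := by
  simp [contract, Finset.smul_sum, smul_smul]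

theorem divergence_smul {θ : EuclideanSpace ℝ (Fin n) → ℝ}
    {F : EuclideanSpace ℝ (Fin n) → Fin n → W} {x : EuclideanSpace ℝ (Fin n)}
    (hθ : DifferentiableAt ℝ θ x) (hF : DifferentiableAt ℝ F x) :
    divergence (fun y => θ y • F y) x = θ x • divergence F x + contract (gradient θ x) (F x) := by
  have hgrad (i : Fin n) : fderiv ℝ θ x (EuclideanSpace.single i 1) = gradient θ x i := by
    rw [← inner_gradient_left, EuclideanSpace.inner_single_right]
    simp
  simp [divergence, contract, fderiv_fun_smul hθ hF, hgrad, Finset.sum_add_distrib,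
    Finset.smul_sum]

theorem integral_divergence_toLp_Icc [CompleteSpace W]
    {F : EuclideanSpace ℝ (Fin (n + 1)) → Fin (n + 1) → W} (hF : Differentiable ℝ F)
    {a b : Fin (n + 1) → ℝ} (hab : a ≤ b)
    (hi : IntegrableOn (fun x => divergence F (WithLp.toLp 2 x)) (Icc a b)) :
    ∫ x in Icc a b, divergence F (WithLp.toLp 2 x) =
      ∑ i, ((∫ x in Icc (a ∘ i.succAbove) (b ∘ i.succAbove),
          F (WithLp.toLp 2 (i.insertNth (b i) x)) i) -
        ∫ x in Icc (a ∘ i.succAbove) (b ∘ i.succAbove),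
          F (WithLp.toLp 2 (i.insertNth (a i) x)) i) := by
  let eL := (EuclideanSpace.equiv (Fin (n + 1)) ℝ).symm
  exact integral_divergence_of_hasFDerivAt_off_countable' a b hab (fun i x => F (eL x) i)
    (fun i x => (ContinuousLinearMap.proj i ∘L fderiv ℝ F (eL x)) ∘L (eL : _ →L[ℝ] _))
    ∅ countable_empty
    (fun i => Continuous.continuousOn (by have := hF.continuous; fun_prop))
    (fun x _ i => ((hasFDerivAt_pi'.1 (hF (eL x)).hasFDerivAt) i).comp x eL.hasFDerivAt) hi

theorem integral_divergence_eq_zero [CompleteSpace W]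
    {F : EuclideanSpace ℝ (Fin n) → Fin n → W} (hF : Differentiable ℝ F)
    (hc : HasCompactSupport F) (hi : Integrable (divergence F)) :
    ∫ x, divergence F x = 0 := by
  rcases n with _ | n
  · simp [divergence]
  obtain ⟨r, hr, hsupp⟩ : ∃ r > 0, tsupport F ⊆ Metric.ball 0 r :=
    hc.isCompact.isBounded.subset_ball_lt 0 0
  have hzero {x : Fin (n + 1) → ℝ} {i : Fin (n + 1)} (hx : r ≤ |x i|) :
      WithLp.toLp 2 x ∉ tsupport F := fun h => by
    have := mem_ball_zero_iff.1 (hsupp h)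
    exact (hx.trans (PiLp.norm_apply_le (WithLp.toLp 2 x) i)).not_gt this
  have hfaces (i : Fin (n + 1)) (x : Fin n → ℝ) {t : ℝ} (ht : |t| = r) :
      F (WithLp.toLp 2 (i.insertNth t x)) i = 0 := by
    have hnot := hzero (x := i.insertNth t x) (i := i) (by simp [ht])
    exact congrFun (image_eq_zero_of_notMem_tsupport (f := F) hnot) i
  have hmp := PiLp.volume_preserving_toLp (Fin (n + 1))
  have hme : MeasurableEmbedding (WithLp.toLp 2 : (Fin (n + 1) → ℝ) → _) :=
    (MeasurableEquiv.toLp 2 (Fin (n + 1) → ℝ)).measurableEmbedding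
  have hbox := integral_divergence_toLp_Icc hF (a := fun _ => -r) (b := fun _ => r)
    (fun _ => by linarith) ((hmp.integrable_comp_emb hme).2 hi).integrableOn
  simp only [hfaces _ _ (abs_of_pos hr), hfaces _ _ ((abs_neg r).trans (abs_of_pos hr)),
    integral_zero, sub_zero, Finset.sum_const_zero] at hbox
  rw [← hmp.integral_comp hme, ← hbox]
  refine (setIntegral_eq_integral_of_forall_compl_eq_zero fun x hx => ?_).symm
  obtain ⟨i, hxi⟩ : ∃ i, r ≤ |x i| := by
    by_contra! h
    exact hx ⟨fun i => (abs_lt.1 (h i)).1.le, fun i => (abs_lt.1 (h i)).2.le⟩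
  exact divergence_of_notMem_tsupport (hzero hxi)

end Divergence

/-! ### Comparison of measures -/

section Hausdorff

variable {X Y : Type*} [EMetricSpace X] [EMetricSpace Y] [MeasurableSpace X] [BorelSpace X]
  [MeasurableSpace Y] [BorelSpace Y]

theorem euclideanHausdorffMeasure_image_le {K : ℝ≥0} {φ : X → Y} {s : Set X}
    (h : LipschitzOnWith K φ s) (d : ℕ) : μHE[d] (φ '' s) ≤ (K : ENNReal) ^ d * μHE[d] s := by
  have hle := h.hausdorffMeasure_image_le d.cast_nonneg
  rw [ENNReal.rpow_natCast] at hle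
  simp only [Measure.euclideanHausdorffMeasure_def, Measure.smul_apply]
  rw [mul_smul_comm]
  gcongr

variable {L : ℝ≥0} (Φ : OpenPartialHomeomorph X Y) (d : ℕ) (H : Set Y)

theorem aemeasurable_symm_restrict :
    AEMeasurable Φ.symm (μHE[d].restrict (Φ.target ∩ H)) :=
  (Φ.continuousOn_symm.aemeasurable Φ.open_target.measurableSet).mono_measure
    (Measure.restrict_mono inter_subset_left le_rfl)

theorem euclideanHausdorffMeasure_map_symm_le (hH : MeasurableSet H)
    (hΦ : LipschitzOnWith L Φ Φ.source) :
    (μHE[d].restrict (Φ.target ∩ H)).map Φ.symm ≤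
      L ^ d • μHE[d].restrict (Φ.source ∩ Φ ⁻¹' H) := by
  refine Measure.le_iff.2 fun A hA => ?_
  have hsubset : Φ.symm ⁻¹' A ∩ (Φ.target ∩ H) ⊆ Φ '' (A ∩ (Φ.source ∩ Φ ⁻¹' H)) :=
    fun y ⟨hyA, hy, hyH⟩ => ⟨Φ.symm y,
      ⟨hyA, Φ.map_target hy, by simpa only [mem_preimage, Φ.right_inv hy] using hyH⟩,
      Φ.right_inv hy⟩
  rw [Measure.map_apply_of_aemeasurable (aemeasurable_symm_restrict Φ d H) hA, Measure.smul_apply,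
    Measure.restrict_apply hA, Measure.restrict_apply' (Φ.open_target.measurableSet.inter hH)]
  exact (measure_mono hsubset).trans (by
    simpa using! euclideanHausdorffMeasure_image_le
      (hΦ.mono (inter_subset_right.trans inter_subset_left)) d)

theorem euclideanHausdorffMeasure_le_map_symm (hΦ : LipschitzOnWith L Φ.symm Φ.target) :
    μHE[d].restrict (Φ.source ∩ Φ ⁻¹' H) ≤
      L ^ d • (μHE[d].restrict (Φ.target ∩ H)).map Φ.symm := by
  refine Measure.le_iff.2 fun A hA => ?_
  have hsubset : A ∩ (Φ.source ∩ Φ ⁻¹' H) ⊆ Φ.symm '' (Φ.symm ⁻¹' A ∩ (Φ.target ∩ H)) :=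
    fun x ⟨hxA, hx, hxH⟩ => ⟨Φ x,
      ⟨by simpa only [mem_preimage, Φ.left_inv hx] using hxA, Φ.map_source hx, hxH⟩, Φ.left_inv hx⟩
  rw [Measure.smul_apply, Measure.restrict_apply hA,
    Measure.map_apply_of_aemeasurable (aemeasurable_symm_restrict Φ d H) hA]
  refine ((measure_mono hsubset).trans (euclideanHausdorffMeasure_image_le
    (hΦ.mono (inter_subset_right.trans inter_subset_left)) d)).trans ?_
  rw [ENNReal.smul_def, smul_eq_mul, ENNReal.coe_pow]
  exact mul_le_mul' le_rfl (Measure.le_restrict_apply _ _)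

end Hausdorff

section Comparison

variable {α W : Type*} [MeasurableSpace α] [NormedAddCommGroup W] [NormedSpace ℝ W]

theorem norm_integral_sub_integral_le_of_le {m μ : Measure α} [IsFiniteMeasure m] (h : m ≤ μ)
    {φ : α → W} (hφ : Integrable φ μ) :
    ‖∫ x, φ x ∂μ - ∫ x, φ x ∂m‖ ≤ ∫ x, ‖φ x‖ ∂μ - ∫ x, ‖φ x‖ ∂m := by
  have hsub : Integrable φ (μ - m) := hφ.mono_measure Measure.sub_le
  have hm : Integrable φ m := hφ.mono_measure h
  rw [← Measure.sub_add_cancel_of_le h, integral_add_measure hsub hm,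
    integral_add_measure hsub.norm hm.norm, add_sub_cancel_right, add_sub_cancel_right]
  exact norm_integral_le_integral_norm φ

theorem norm_integral_sub_integral_le_of_le_smul {m μ : Measure α} [IsFiniteMeasure m] {c : ℝ≥0}
    (hc : 1 ≤ c) (hm : m ≤ c • μ) (hμ : μ ≤ c • m) {φ : α → W} (hφ : Integrable φ μ) :
    ‖∫ x, φ x ∂m - ∫ x, φ x ∂μ‖ ≤ 3 * (c - 1) * ∫ x, ‖φ x‖ ∂μ := by
  have hφc : Integrable φ (c • μ) := hφ.smul_measure_nnreal
  have hc0 : 0 ≤ (c : ℝ) - 1 := sub_nonneg.2 (mod_cast hc)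
  have hdefect := norm_integral_sub_integral_le_of_le hm hφc
  have hlower : ∫ x, ‖φ x‖ ∂μ ≤ c * ∫ x, ‖φ x‖ ∂m := by
    simpa only [integral_smul_nnreal_measure, NNReal.smul_def, smul_eq_mul] using
      integral_mono_measure hμ (Eventually.of_forall fun x => norm_nonneg (φ x))
        (hφc.mono_measure hm).norm.smul_measure_nnreal
  simp only [integral_smul_nnreal_measure, NNReal.smul_def, smul_eq_mul] at hdefect
  set A := ∫ x, ‖φ x‖ ∂μ
  set B := ∫ x, ‖φ x‖ ∂m
  have hA : 0 ≤ A := integral_nonneg fun _ => norm_nonneg _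
  calc ‖∫ x, φ x ∂m - ∫ x, φ x ∂μ‖
      = ‖((c : ℝ) - 1) • ∫ x, φ x ∂μ - ((c : ℝ) • ∫ x, φ x ∂μ - ∫ x, φ x ∂m)‖ := by
        congr 1
        module
    _ ≤ (c - 1) * A + (c * A - B) := by
        refine (norm_sub_le _ _).trans (add_le_add ?_ hdefect)
        rw [norm_smul, Real.norm_of_nonneg hc0]
        exact mul_le_mul_of_nonneg_left (norm_integral_le_integral_norm φ) hc0
    _ ≤ 3 * (c - 1) * A := by
        have hB : (2 - c) * A ≤ B := by
          refine le_of_mul_le_mul_left ?_ (show (0 : ℝ) < c by linarith)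
          nlinarith [mul_nonneg hA (sq_nonneg ((c : ℝ) - 1))]
        linarith

theorem norm_integral_smul_sub_integral_le {m μ : Measure α} [IsFiniteMeasure m] {c : ℝ≥0}
    (hc : 1 ≤ c) (hm : m ≤ c • μ) (hμ : μ ≤ c • m) {φ : α → W} (hφ : Integrable φ μ) {a : α → ℝ}
    (ha : AEStronglyMeasurable a m) {ε : ℝ} (hε : 0 ≤ ε) (ha1 : ∀ᵐ x ∂m, |a x - 1| ≤ ε) :
    ‖∫ x, a x • φ x ∂m - ∫ x, φ x ∂μ‖ ≤ (ε * c + 3 * (c - 1)) * ∫ x, ‖φ x‖ ∂μ := by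
  have hφm : Integrable φ m := hφ.smul_measure_nnreal.mono_measure hm
  have hsub : Integrable (fun x => (a x - 1) • φ x) m :=
    hφm.bdd_smul ε (ha.sub aestronglyMeasurable_const) ha1
  have hmass : ∫ x, ‖φ x‖ ∂m ≤ c * ∫ x, ‖φ x‖ ∂μ := by
    simpa only [integral_smul_nnreal_measure, NNReal.smul_def, smul_eq_mul] using
      integral_mono_measure hm (Eventually.of_forall fun x => norm_nonneg (φ x))
        hφ.norm.smul_measure_nnreal
  have hdensity : ‖∫ x, (a x - 1) • φ x ∂m‖ ≤ ε * c * ∫ x, ‖φ x‖ ∂μ := by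
    refine (norm_integral_le_of_norm_le (hφm.norm.const_mul ε) (ha1.mono fun x hx => ?_)).trans ?_
    · exact (norm_smul_le _ _).trans (mul_le_mul_of_nonneg_right hx (norm_nonneg _))
    · rw [integral_const_mul, mul_assoc]
      exact mul_le_mul_of_nonneg_left hmass hε
  calc ‖∫ x, a x • φ x ∂m - ∫ x, φ x ∂μ‖
      = ‖∫ x, (a x - 1) • φ x ∂m + (∫ x, φ x ∂m - ∫ x, φ x ∂μ)‖ := by
        rw [← add_sub_assoc, ← integral_add hsub hφm]
        simp only [sub_smul, one_smul, sub_add_cancel]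
    _ ≤ ε * c * ∫ x, ‖φ x‖ ∂μ + 3 * (c - 1) * ∫ x, ‖φ x‖ ∂μ :=
        (norm_add_le _ _).trans
          (add_le_add hdensity (norm_integral_sub_integral_le_of_le_smul hc hm hμ hφ))
    _ = (ε * c + 3 * (c - 1)) * ∫ x, ‖φ x‖ ∂μ := by ring

end Comparison

/-! ### Integrals over thin slabs -/

section Slab

variable {E W : Type*} [NormedAddCommGroup E] [InnerProductSpace ℝ E] [MeasurableSpace E]
  [BorelSpace E] [FiniteDimensional ℝ E] [NormedAddCommGroup W] [NormedSpace ℝ W] {ν : E}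

theorem measurePreserving_smul_add_coe (hν : ‖ν‖ = 1) :
    MeasurePreserving (fun z : ℝ × (ℝ ∙ ν)ᗮ => z.1 • ν + (z.2 : E)) volume volume := by
  have hline : MeasurePreserving (LinearIsometryEquiv.toSpanUnitSingleton ν hν) volume volume :=
    (LinearIsometryEquiv.toSpanUnitSingleton ν hν).measurePreserving
  have hsum := ((ℝ ∙ ν).measurePreserving_measurableEquivProd (0 : E)).symm.comp
    (hline.prod (MeasurePreserving.id (volume : Measure (ℝ ∙ ν)ᗮ)))
  rw [InnerProductSpace.euclideanHausdorffMeasure_eq_volume] at hsum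
  refine (congrArg (MeasurePreserving · volume volume) (funext fun z => ?_)).mp hsum
  simp

theorem measurableEmbedding_smul_add_coe (hν : ‖ν‖ = 1) :
    MeasurableEmbedding fun z : ℝ × (ℝ ∙ ν)ᗮ => z.1 • ν + (z.2 : E) := by
  have hline : MeasurableEmbedding (LinearIsometryEquiv.toSpanUnitSingleton (𝕜 := ℝ) ν hν) :=
    (LinearIsometryEquiv.toSpanUnitSingleton ν hν).toHomeomorph.measurableEmbedding
  have hsum := ((ℝ ∙ ν).measurableEquivProd (0 : E)).symm.measurableEmbedding.comp
    (hline.prodMap (MeasurableEmbedding.id (α := (ℝ ∙ ν)ᗮ)))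
  convert hsum using 1
  ext z
  simp

theorem map_coe_orthogonal_span_singleton (hν : ‖ν‖ = 1) :
    (volume : Measure (ℝ ∙ ν)ᗮ).map (↑) =
      μHE[Module.finrank ℝ E - 1].restrict {y : E | inner ℝ ν y = 0} := by
  have hrank : Module.finrank ℝ (ℝ ∙ ν)ᗮ = Module.finrank ℝ E - 1 := by
    have hsum := (ℝ ∙ ν).finrank_add_finrank_orthogonal
    rw [finrank_span_singleton (norm_ne_zero_iff.1 (hν ▸ one_ne_zero))] at hsum
    omega
  rw [← InnerProductSpace.euclideanHausdorffMeasure_eq_volume, hrank,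
    isometry_subtype_coe.map_euclideanHausdorffMeasure]
  congr 1
  ext y
  simp [Submodule.mem_orthogonal_singleton_iff_inner_right]

theorem euclideanHausdorffMeasure_hyperplane_inter_lt_top (hν : ‖ν‖ = 1) {s : Set E}
    (hs : Bornology.IsBounded s) :
    μHE[Module.finrank ℝ E - 1] (s ∩ {y | inner ℝ ν y = 0}) < ⊤ := by
  rw [← Measure.restrict_apply' ((isClosed_eq (by fun_prop) (by fun_prop)).measurableSet),
    ← map_coe_orthogonal_span_singleton hν]
  refine (measure_mono subset_closure).trans_lt ?_
  rw [Measure.map_apply measurable_subtype_coe isClosed_closure.measurableSet]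
  exact (isometry_subtype_coe.antilipschitz.isBounded_preimage hs.closure).measure_lt_top

variable {q : E → W}

theorem continuous_integral_smul_add_coe (hq : Continuous q)
    (hqs : HasCompactSupport q) :
    Continuous fun t : ℝ => ∫ x : (ℝ ∙ ν)ᗮ, q (t • ν + x) := by
  obtain ⟨R, hR⟩ := hqs.isCompact.isBounded.exists_norm_le
  have hnorm (t : ℝ) (x : (ℝ ∙ ν)ᗮ) : ‖x‖ ≤ ‖t • ν + x‖ := by
    have horth : inner ℝ (t • ν) (x : E) = 0 := by
      rw [inner_smul_left, Submodule.mem_orthogonal_singleton_iff_inner_right.1 x.2, mul_zero]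
    have hpyth := norm_add_sq_eq_norm_sq_add_norm_sq_of_inner_eq_zero _ _ horth
    exact nonneg_le_nonneg_of_sq_le_sq (norm_nonneg _)
      (by simpa [hpyth] using mul_self_nonneg ‖t • ν‖)
  have hzero (t : ℝ) (x : (ℝ ∙ ν)ᗮ) (hx : x ∉ Metric.closedBall 0 R) : q (t • ν + x) = 0 :=
    image_eq_zero_of_notMem_tsupport fun h => hx (by simpa using (hnorm t x).trans (hR _ h))
  have hcont := continuous_parametric_integral_of_continuous (μ := volume)
    (f := fun (t : ℝ) (x : (ℝ ∙ ν)ᗮ) => q (t • ν + x)) (by fun_prop) (isCompact_closedBall 0 R)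
  simpa only [setIntegral_eq_integral_of_forall_compl_eq_zero (hzero _)] using hcont

theorem integral_slab_eq {k : ℝ → ℝ} (hν : ‖ν‖ = 1) (hk : Continuous k) (hq : Continuous q)
    (hqs : HasCompactSupport q) {δ : ℝ} (hδ : 0 < δ) :
    ∫ y, (δ⁻¹ * k (δ⁻¹ * inner ℝ ν y)) • q y =
      ∫ s, k s • ∫ x : (ℝ ∙ ν)ᗮ, q ((δ * s) • ν + x) := by
  have hint : Integrable fun y => (δ⁻¹ * k (δ⁻¹ * inner ℝ ν y)) • q y :=
    Continuous.integrable_of_hasCompactSupport (by fun_prop) hqs.smul_left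
  have hmp := measurePreserving_smul_add_coe hν
  have hemb := measurableEmbedding_smul_add_coe hν
  have hinner (t : ℝ) (x : (ℝ ∙ ν)ᗮ) : inner ℝ ν (t • ν + (x : E)) = t := by
    rw [inner_add_right, inner_smul_right, real_inner_self_eq_norm_sq, hν,
      Submodule.mem_orthogonal_singleton_iff_inner_right.1 x.2]
    ring
  have hint' : Integrable (fun z : ℝ × (ℝ ∙ ν)ᗮ =>
      (δ⁻¹ * k (δ⁻¹ * z.1)) • q (z.1 • ν + z.2)) (volume.prod volume) := by
    simpa only [Function.comp_def, hinner, Measure.volume_eq_prod] using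
      (hmp.integrable_comp_emb hemb).2 hint
  have hscale := Measure.integral_comp_mul_left
    (fun t => (δ⁻¹ * k (δ⁻¹ * t)) • ∫ x : (ℝ ∙ ν)ᗮ, q (t • ν + x)) δ
  simp only [inv_mul_cancel_left₀ hδ.ne', abs_of_pos (inv_pos.2 hδ), mul_smul,
    integral_smul] at hscale
  rw [← hmp.integral_comp hemb]
  simp only [hinner]
  rw [Measure.volume_eq_prod, integral_prod _ hint']
  simp only [mul_smul, integral_smul]
  exact (smul_right_injective W (inv_pos.2 hδ).ne' hscale).symm

theorem tendsto_integral_slab [CompleteSpace W] {k : ℝ → ℝ} (hν : ‖ν‖ = 1) (hk : Continuous k)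
    (hks : HasCompactSupport k) (hk1 : ∫ t, k t = 1) (hq : Continuous q)
    (hqs : HasCompactSupport q) :
    Tendsto (fun δ : ℝ => ∫ y, (δ⁻¹ * k (δ⁻¹ * inner ℝ ν y)) • q y) (𝓝[>] 0)
      (𝓝 (∫ y in {y | inner ℝ ν y = 0}, q y ∂μHE[Module.finrank ℝ E - 1])) := by
  have hslice := continuous_integral_smul_add_coe (ν := ν) hq hqs
  have hcont : Continuous fun δ : ℝ => ∫ s, k s • ∫ x : (ℝ ∙ ν)ᗮ, q ((δ * s) • ν + x) := by
    have hzero (δ s : ℝ) (hs : s ∉ tsupport k) :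
        (k s • ∫ x : (ℝ ∙ ν)ᗮ, q ((δ * s) • ν + x)) = 0 := by
      rw [image_eq_zero_of_notMem_tsupport hs, zero_smul]
    have hcont := continuous_parametric_integral_of_continuous (μ := volume)
      (f := fun δ s => k s • ∫ x : (ℝ ∙ ν)ᗮ, q ((δ * s) • ν + x))
      ((hk.comp continuous_snd).smul (hslice.comp (continuous_fst.mul continuous_snd))) hks
    simpa only [setIntegral_eq_integral_of_forall_compl_eq_zero (hzero _)] using hcont
  have hlim : (∫ s, k s • ∫ x : (ℝ ∙ ν)ᗮ, q ((0 * s) • ν + x)) =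
      ∫ y in {y | inner ℝ ν y = 0}, q y ∂μHE[Module.finrank ℝ E - 1] := by
    rw [← map_coe_orthogonal_span_singleton hν,
      integral_map measurable_subtype_coe.aemeasurable hq.aestronglyMeasurable]
    simp [integral_smul_const, hk1]
  rw [← hlim]
  refine ((hcont.tendsto 0).mono_left nhdsWithin_le_nhds).congr' ?_
  filter_upwards [self_mem_nhdsWithin] with δ hδ using (integral_slab_eq hν hk hq hqs hδ).symm

end Slab

/-! ### Domains with a normal field -/

section Normal

variable {E : Type*} [NormedAddCommGroup E] [InnerProductSpace ℝ E]

theorem inv_norm_smul_eq_of_inner_neg_imp {u v : E} (hu : u ≠ 0) (hv : v ≠ 0)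
    (h : ∀ w, inner ℝ u w < 0 → inner ℝ v w ≤ 0) : ‖u‖⁻¹ • u = ‖v‖⁻¹ • v := by
  set a := ‖u‖⁻¹ • u
  set b := ‖v‖⁻¹ • v
  have ha : ‖a‖ = 1 := by
    rw [norm_smul, norm_inv, norm_norm, inv_mul_cancel₀ (norm_ne_zero_iff.2 hu)]
  have hb : ‖b‖ = 1 := by
    rw [norm_smul, norm_inv, norm_norm, inv_mul_cancel₀ (norm_ne_zero_iff.2 hv)]
  by_contra hne
  have hab : inner ℝ a b < 1 := (inner_lt_one_iff_real_of_norm_eq_one ha hb).2 hne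
  have huw : inner ℝ u (b - a) < 0 := by
    rw [← smul_inv_smul₀ (norm_ne_zero_iff.2 hu) u, real_inner_smul_left]
    refine mul_neg_of_pos_of_neg (norm_pos_iff.2 hu) ?_
    rw [inner_sub_right, real_inner_self_eq_norm_sq, ha]
    linarith
  have hvw : 0 < inner ℝ v (b - a) := by
    rw [← smul_inv_smul₀ (norm_ne_zero_iff.2 hv) v, real_inner_smul_left]
    refine mul_pos (norm_pos_iff.2 hv) ?_
    rw [inner_sub_right, real_inner_self_eq_norm_sq, hb, real_inner_comm]
    linarith
  exact (h _ huw).not_gt hvw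

theorem eventually_neg_of_fderiv_neg {ρ : E → ℝ} {x w : E} (h : DifferentiableAt ℝ ρ x)
    (h0 : ρ x = 0) (hw : fderiv ℝ ρ x w < 0) : ∀ᶠ t : ℝ in 𝓝[>] 0, ρ (x + t • w) < 0 := by
  have hline : HasDerivAt (fun t : ℝ => ρ (x + t • w)) (fderiv ℝ ρ x w) 0 :=
    h.hasFDerivAt.hasLineDerivAt w
  have hsign := eventually_nhdsWithin_sign_eq_of_deriv_neg (hline.deriv.symm ▸ hw) (by simp [h0])
  filter_upwards [hsign.filter_mono nhdsWithin_le_nhds, self_mem_nhdsWithin] with t ht (ht0 : 0 < t)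
  rwa [zero_sub, Left.sign_neg, sign_pos ht0, sign_eq_neg_one_iff] at ht

theorem tendsto_add_smul_nhdsGT_zero (x w : E) :
    Tendsto (fun t : ℝ => x + t • w) (𝓝[>] 0) (𝓝 x) := by
  have hcont : Continuous fun t : ℝ => x + t • w := by fun_prop
  simpa using (hcont.tendsto 0).mono_left nhdsWithin_le_nhds

variable [CompleteSpace E]

/-- `ρ` is a `C¹` defining function of `D` on the open set `U`. -/
structure IsC1DefiningFunction (D U : Set E) (ρ : E → ℝ) : Prop where
  isOpen : IsOpen U
  contDiffOn : ContDiffOn ℝ 1 ρ U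
  gradient_ne_zero : ∀ y ∈ U, gradient ρ y ≠ 0
  mem_iff : ∀ y ∈ U, y ∈ D ↔ ρ y < 0

/-- `ν` restricts to the outward unit normal of `D` on the boundary of `D`, which is locally
given by `C¹` defining functions. -/
def IsOutwardNormalField (D : Set E) (ν : E → E) : Prop :=
  ∀ x ∈ frontier D, ∃ U ρ, x ∈ U ∧ IsC1DefiningFunction D U ρ ∧
    ∀ y ∈ frontier D ∩ U, ν y = ‖gradient ρ y‖⁻¹ • gradient ρ y

theorem continuousOn_gradient {ρ : E → ℝ} {U : Set E} (hU : IsOpen U) (h : ContDiffOn ℝ 1 ρ U) :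
    ContinuousOn (gradient ρ) U :=
  (InnerProductSpace.toDual ℝ E).symm.continuous.comp_continuousOn
    (h.continuousOn_fderiv_of_isOpen hU le_rfl)

namespace IsC1DefiningFunction

variable {D U : Set E} {ρ : E → ℝ} {x : E}

theorem differentiableAt (h : IsC1DefiningFunction D U ρ) (hx : x ∈ U) :
    DifferentiableAt ℝ ρ x :=
  (h.contDiffOn.contDiffAt (h.isOpen.mem_nhds hx)).differentiableAt one_ne_zero

theorem eq_zero_of_mem_frontier (h : IsC1DefiningFunction D U ρ) (hD : IsOpen D) (hxU : x ∈ U)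
    (hx : x ∈ frontier D) : ρ x = 0 := by
  rw [hD.frontier_eq] at hx
  refine le_antisymm ?_ (not_lt.1 fun hneg => hx.2 ((h.mem_iff x hxU).2 hneg))
  by_contra! hpos
  obtain ⟨z, ⟨hz, hzU⟩, hzD⟩ := mem_closure_iff_nhds.1 hx.1 _
    (((h.differentiableAt hxU).continuousAt.eventually (lt_mem_nhds hpos)).and
      (h.isOpen.mem_nhds hxU))
  exact ((h.mem_iff z hzU).1 hzD).not_gt hz

theorem fderiv_nonpos_of_fderiv_neg {U' : Set E} {ρ' : E → ℝ} (h : IsC1DefiningFunction D U ρ)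
    (h' : IsC1DefiningFunction D U' ρ') (hD : IsOpen D) (hx : x ∈ frontier D) (hxU : x ∈ U)
    (hxU' : x ∈ U') {w : E} (hw : fderiv ℝ ρ x w < 0) : fderiv ℝ ρ' x w ≤ 0 := by
  by_contra! hpos
  have hneg := eventually_neg_of_fderiv_neg (h.differentiableAt hxU)
    (h.eq_zero_of_mem_frontier hD hxU hx) hw
  have hneg' := eventually_neg_of_fderiv_neg (ρ := -ρ') (h'.differentiableAt hxU').neg
    (by simp [h'.eq_zero_of_mem_frontier hD hxU' hx]) (w := w) (by simpa [fderiv_neg] using hpos)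
  have hnear := tendsto_add_smul_nhdsGT_zero x w
  obtain ⟨t, ht, ht', htU, htU'⟩ := (hneg.and (hneg'.and
    ((hnear.eventually (h.isOpen.mem_nhds hxU)).and
      (hnear.eventually (h'.isOpen.mem_nhds hxU'))))).exists
  exact (neg_neg_iff_pos.1 ht').not_gt ((h'.mem_iff _ htU').1 ((h.mem_iff _ htU).2 ht))

theorem inv_norm_smul_gradient_unique {U' : Set E} {ρ' : E → ℝ} (h : IsC1DefiningFunction D U ρ)
    (h' : IsC1DefiningFunction D U' ρ') (hD : IsOpen D) (hx : x ∈ frontier D) (hxU : x ∈ U)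
    (hxU' : x ∈ U') :
    ‖gradient ρ x‖⁻¹ • gradient ρ x = ‖gradient ρ' x‖⁻¹ • gradient ρ' x := by
  refine inv_norm_smul_eq_of_inner_neg_imp (h.gradient_ne_zero x hxU)
    (h'.gradient_ne_zero x hxU') fun w hw => ?_
  rw [inner_gradient_left] at hw ⊢
  exact h.fderiv_nonpos_of_fderiv_neg h' hD hx hxU hxU' hw

theorem mem_frontier_of_eq_zero (h : IsC1DefiningFunction D U ρ) (hD : IsOpen D) (hxU : x ∈ U)
    (hx : ρ x = 0) : x ∈ frontier D := by
  rw [hD.frontier_eq]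
  refine ⟨?_, fun hxD => ((h.mem_iff x hxU).1 hxD).ne hx⟩
  have hdescent : fderiv ℝ ρ x (-gradient ρ x) < 0 := by
    rw [← inner_gradient_left, inner_neg_right, neg_lt_zero, real_inner_self_eq_norm_sq]
    exact pow_pos (norm_pos_iff.2 (h.gradient_ne_zero x hxU)) 2
  have hnear := tendsto_add_smul_nhdsGT_zero x (-gradient ρ x)
  refine mem_closure_of_tendsto hnear ?_
  filter_upwards [eventually_neg_of_fderiv_neg (h.differentiableAt hxU) hx hdescent,
    hnear.eventually (h.isOpen.mem_nhds hxU)] with t ht htU using (h.mem_iff _ htU).2 ht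

theorem frontier_inter_eq (h : IsC1DefiningFunction D U ρ) (hD : IsOpen D) {s : Set E}
    (hs : s ⊆ U) : frontier D ∩ s = s ∩ {x | ρ x = 0} := by
  ext x
  exact ⟨fun hx => ⟨hx.2, h.eq_zero_of_mem_frontier hD (hs hx.2) hx.1⟩,
    fun hx => ⟨h.mem_frontier_of_eq_zero hD (hs hx.1) hx.2, hx.1⟩⟩

theorem gradient_const_smul (h : IsC1DefiningFunction D U ρ) (hx : x ∈ U) (c : ℝ) :
    gradient (c • ρ) x = c • gradient ρ x := by
  simp [gradient, fderiv_const_smul (h.differentiableAt hx)]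

theorem const_smul (h : IsC1DefiningFunction D U ρ) {c : ℝ} (hc : 0 < c) :
    IsC1DefiningFunction D U (c • ρ) where
  isOpen := h.isOpen
  contDiffOn := h.contDiffOn.const_smul c
  gradient_ne_zero y hy := by
    rw [h.gradient_const_smul hy]
    exact smul_ne_zero hc.ne' (h.gradient_ne_zero y hy)
  mem_iff y hy := by
    rw [h.mem_iff y hy, Pi.smul_apply, smul_neg_iff_of_pos_left hc]

end IsC1DefiningFunction

namespace IsOutwardNormalField

variable {D : Set E} {ν : E → E}

theorem continuousOn (h : IsOutwardNormalField D ν) : ContinuousOn ν (frontier D) := by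
  intro x hx
  obtain ⟨U, ρ, hxU, hρ, hν⟩ := h x hx
  have hU := hρ.isOpen.mem_nhds hxU
  have hgrad : ContinuousAt (gradient ρ) x :=
    (continuousOn_gradient hρ.isOpen hρ.contDiffOn).continuousAt hU
  have hunit : ContinuousAt (fun y => ‖gradient ρ y‖⁻¹ • gradient ρ y) x :=
    (hgrad.norm.inv₀ (norm_ne_zero_iff.2 (hρ.gradient_ne_zero x hxU))).smul hgrad
  refine hunit.continuousWithinAt.congr_of_eventuallyEq ?_ (hν x ⟨hx, hxU⟩)
  filter_upwards [self_mem_nhdsWithin, mem_nhdsWithin_of_mem_nhds hU] with y hy hyU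
  exact hν y ⟨hy, hyU⟩

theorem exists_normalized (h : IsOutwardNormalField D ν) {x : E} (hx : x ∈ frontier D) :
    ∃ U ρ, x ∈ U ∧ IsC1DefiningFunction D U ρ ∧ ‖gradient ρ x‖ = 1 ∧
      ∀ y ∈ frontier D ∩ U, gradient ρ y = ‖gradient ρ y‖ • ν y := by
  obtain ⟨U, ρ, hxU, hρ, hν⟩ := h x hx
  have hpos {y : E} (hy : y ∈ U) : 0 < ‖gradient ρ y‖ := norm_pos_iff.2 (hρ.gradient_ne_zero y hy)
  refine ⟨U, ‖gradient ρ x‖⁻¹ • ρ, hxU, hρ.const_smul (inv_pos.2 (hpos hxU)), ?_,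
    fun y hy => ?_⟩
  · rw [hρ.gradient_const_smul hxU, norm_smul, norm_inv, norm_norm, inv_mul_cancel₀ (hpos hxU).ne']
  · rw [hρ.gradient_const_smul hy.2, hν y hy, norm_smul, norm_inv, norm_norm, smul_smul,
      mul_assoc, mul_inv_cancel₀ (hpos hy.2).ne', mul_one]

end IsOutwardNormalField

end Normal

section SmoothBoundary

variable {p : ℕ} {D : Set (V p)}

theorem IsLocalDefiningFunction.isC1DefiningFunction {x : V p} {U : Set (V p)} {ρ : V p → ℝ}
    (h : IsLocalDefiningFunction D x U ρ) : IsC1DefiningFunction D U ρ :=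
  ⟨h.isOpen, h.contDiffOn.of_le (by simp), h.gradient_ne_zero, h.mem_iff⟩

theorem HasSmoothBoundary.isOutwardNormalField (h : HasSmoothBoundary D) (hD : IsOpen D) :
    IsOutwardNormalField D (outwardNormal D) := by
  intro x hx
  obtain ⟨U, ρ, hρ⟩ := h x hx
  refine ⟨U, ρ, hρ.mem, hρ.isC1DefiningFunction, fun y hy => ?_⟩
  have hex : ∃ ν, IsOutwardUnitNormal D y ν :=
    ⟨_, U, ρ, ⟨hρ.isOpen, hy.2, hρ.contDiffOn, hρ.gradient_ne_zero, hρ.mem_iff⟩, rfl⟩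
  obtain ⟨U', ρ', hρ', hchoice⟩ := hex.choose_spec
  rw [outwardNormal, dif_pos hex, hchoice]
  exact hρ'.isC1DefiningFunction.inv_norm_smul_gradient_unique hρ.isC1DefiningFunction hD hy.1
    hρ'.mem hy.2

end SmoothBoundary

/-! ### Flattening a hypersurface -/

section Flatten

variable {E : Type*} [NormedAddCommGroup E] [InnerProductSpace ℝ E]

/-- The map that replaces the component of `x - x₀` along `ν` by `ρ x`. -/
def flatten (ν : E) (ρ : E → ℝ) (x₀ x : E) : E :=
  (x - x₀) + (ρ x - inner ℝ ν (x - x₀)) • ν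

/-- The derivative of `flatten ν ρ x₀` at a point where the derivative of `ρ` is `ℓ`. -/
def flattenDeriv (ν : E) (ℓ : E →L[ℝ] ℝ) : E →L[ℝ] E :=
  ContinuousLinearMap.id ℝ E + (ℓ - innerSL ℝ ν).smulRight ν

variable {ν x₀ x : E} {ρ : E → ℝ} {ℓ : E →L[ℝ] ℝ}

theorem inner_flatten (hν : ‖ν‖ = 1) : inner ℝ ν (flatten ν ρ x₀ x) = ρ x := by
  rw [flatten, inner_add_right, inner_smul_right, real_inner_self_eq_norm_sq, hν]
  ring

theorem hasStrictFDerivAt_flatten (h : HasStrictFDerivAt ρ ℓ x) :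
    HasStrictFDerivAt (flatten ν ρ x₀) (flattenDeriv ν ℓ) x := by
  have hsub : HasStrictFDerivAt (fun x => x - x₀) (ContinuousLinearMap.id ℝ E) x :=
    (hasStrictFDerivAt_id x).sub_const x₀
  have hinner : HasStrictFDerivAt (fun x => inner ℝ ν (x - x₀)) (innerSL ℝ ν) x := by
    simpa using (innerSL ℝ ν).hasStrictFDerivAt.comp x hsub
  exact hsub.add ((h.sub hinner).smul_const ν)

theorem flattenDeriv_innerSL : flattenDeriv ν (innerSL ℝ ν) = ContinuousLinearMap.id ℝ E := by
  simp [flattenDeriv]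

theorem det_flattenDeriv [FiniteDimensional ℝ E] (hν : ‖ν‖ = 1) :
    (flattenDeriv ν ℓ).det = ℓ ν := by
  have htransvection : (flattenDeriv ν ℓ : E →ₗ[ℝ] E) =
      LinearMap.transvection (ℓ - innerSL ℝ ν : E →L[ℝ] ℝ).toLinearMap ν := by
    ext w
    simp [flattenDeriv, LinearMap.transvection.apply]
  rw [ContinuousLinearMap.det, htransvection, LinearMap.transvection.det]
  simp [hν]

/-- `Φ` is a chart of the form `flatten ν ρ x₀`, which straightens `{ρ = 0}` to the hyperplane
orthogonal to the unit vector `ν`, and `ε` bounds both its distance from a translation and the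
relative error in replacing the norm of the gradient of `ρ` by the Jacobian determinant of `Φ`. -/
structure IsFlatteningChart [CompleteSpace E] (ε : ℝ≥0) (ρ : E → ℝ) (ν x₀ : E)
    (Φ : OpenPartialHomeomorph E E) : Prop where
  norm_eq_one : ‖ν‖ = 1
  isBounded_source : Bornology.IsBounded Φ.source
  contDiffOn : ContDiffOn ℝ 1 ρ Φ.source
  apply_eq : ∀ x, Φ x = flatten ν ρ x₀ x
  approximatesLinearOn : ApproximatesLinearOn Φ (ContinuousLinearMap.id ℝ E) Φ.source ε
  fderiv_pos : ∀ x ∈ Φ.source, 0 < fderiv ℝ ρ x ν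
  abs_sub_one_le : ∀ x ∈ Φ.source, |‖gradient ρ x‖ / fderiv ℝ ρ x ν - 1| ≤ ε

theorem exists_openPartialHomeomorph_of_approximatesLinearOn_id [CompleteSpace E] {φ : E → E}
    {s : Set E} {ε : ℝ≥0} (h : ApproximatesLinearOn φ (ContinuousLinearMap.id ℝ E) s ε)
    (hs : IsOpen s) (hε : ε < 1) :
    ∃ Φ : OpenPartialHomeomorph E E, Φ.source = s ∧ ∀ x, Φ x = φ x := by
  have hc : Subsingleton E ∨
      ε < ‖((ContinuousLinearEquiv.refl ℝ E).symm : E →L[ℝ] E)‖₊⁻¹ := by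
    rcases subsingleton_or_nontrivial E with hE | hE
    · exact Or.inl hE
    · right
      have hnorm : ‖((ContinuousLinearEquiv.refl ℝ E).symm : E →L[ℝ] E)‖₊ = 1 :=
        NNReal.eq (ContinuousLinearMap.norm_id (𝕜 := ℝ) (E := E))
      rwa [hnorm, inv_one]
  exact ⟨ApproximatesLinearOn.toOpenPartialHomeomorph (f' := ContinuousLinearEquiv.refl ℝ E)
    φ s h hc hs, rfl, fun _ => rfl⟩

theorem exists_isFlatteningChart [CompleteSpace E] {U : Set E} (hU : IsOpen U) (hx₀ : x₀ ∈ U)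
    (hρ : ContDiffOn ℝ 1 ρ U) (hν : ‖gradient ρ x₀‖ = 1) {ε : ℝ≥0} (hε : 0 < ε) (hε1 : ε < 1) :
    ∃ Φ : OpenPartialHomeomorph E E, x₀ ∈ Φ.source ∧ Φ.source ⊆ U ∧
      IsFlatteningChart ε ρ (gradient ρ x₀) x₀ Φ := by
  set ν := gradient ρ x₀
  have hUx := hU.mem_nhds hx₀
  have hderiv : fderiv ℝ ρ x₀ = innerSL ℝ ν := by
    ext w
    exact inner_gradient_left.symm
  have hderiv_ν : fderiv ℝ ρ x₀ ν = 1 := by simp [hderiv, hν]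
  have hstrict := hasStrictFDerivAt_flatten (ν := ν) (x₀ := x₀)
    ((hρ.contDiffAt hUx).hasStrictFDerivAt one_ne_zero)
  rw [hderiv, flattenDeriv_innerSL] at hstrict
  obtain ⟨s, hs, happrox⟩ := hstrict.approximates_deriv_on_nhds (Or.inr hε)
  have hjac : ContinuousAt (fun x => fderiv ℝ ρ x ν) x₀ :=
    ((hρ.continuousOn_fderiv_of_isOpen hU le_rfl).continuousAt hUx).clm_apply continuousAt_const
  have hratio : ContinuousAt (fun x => |‖gradient ρ x‖ / fderiv ℝ ρ x ν - 1|) x₀ :=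
    ((((continuousOn_gradient hU hρ).continuousAt hUx).norm.div hjac
      (hderiv_ν ▸ one_ne_zero)).sub continuousAt_const).abs
  have hgood : ∀ᶠ x in 𝓝 x₀, x ∈ U ∧ x ∈ s ∧ 0 < fderiv ℝ ρ x ν ∧
      |‖gradient ρ x‖ / fderiv ℝ ρ x ν - 1| < ε :=
    Eventually.and hUx <| Eventually.and hs <|
      (hjac.eventually (lt_mem_nhds (by simp [hderiv_ν]))).and <|
      hratio.eventually (gt_mem_nhds (by simpa [hderiv_ν, ν, hν] using hε))
  obtain ⟨r, hr, hball⟩ := Metric.eventually_nhds_iff_ball.1 hgood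
  have hball_approx := happrox.mono_set fun x hx => (hball x hx).2.1
  obtain ⟨Φ, hsource, hΦ⟩ := exists_openPartialHomeomorph_of_approximatesLinearOn_id hball_approx
    Metric.isOpen_ball hε1
  refine ⟨Φ, hsource ▸ Metric.mem_ball_self hr, hsource ▸ fun x hx => (hball x hx).1, hν, ?_, ?_,
    hΦ, ?_, ?_, ?_⟩ <;> rw [hsource]
  · exact Metric.isBounded_ball
  · exact hρ.mono fun x hx => (hball x hx).1
  · rwa [funext hΦ]
  · exact fun x hx => (hball x hx).2.2.1
  · exact fun x hx => (hball x hx).2.2.2.le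

namespace IsFlatteningChart

variable [CompleteSpace E] {ε : ℝ≥0} {Φ : OpenPartialHomeomorph E E}

theorem inner_apply (h : IsFlatteningChart ε ρ ν x₀ Φ) (x : E) : inner ℝ ν (Φ x) = ρ x := by
  rw [h.apply_eq, inner_flatten h.norm_eq_one]

theorem source_inter_preimage (h : IsFlatteningChart ε ρ ν x₀ Φ) :
    Φ.source ∩ Φ ⁻¹' {y | inner ℝ ν y = 0} = Φ.source ∩ {x | ρ x = 0} := by
  ext x
  simp [h.inner_apply]

theorem hasFDerivAt (h : IsFlatteningChart ε ρ ν x₀ Φ) (hx : x ∈ Φ.source) :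
    HasFDerivAt Φ (flattenDeriv ν (fderiv ℝ ρ x)) x := by
  rw [funext h.apply_eq]
  exact (hasStrictFDerivAt_flatten ((h.contDiffOn.contDiffAt
    (Φ.open_source.mem_nhds hx)).hasStrictFDerivAt one_ne_zero)).hasFDerivAt

theorem continuousOn_fderiv_apply (h : IsFlatteningChart ε ρ ν x₀ Φ) :
    ContinuousOn (fun x => fderiv ℝ ρ x ν) Φ.source :=
  (h.contDiffOn.continuousOn_fderiv_of_isOpen Φ.open_source le_rfl).clm_apply continuousOn_const

theorem lipschitzOnWith (h : IsFlatteningChart ε ρ ν x₀ Φ) :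
    LipschitzOnWith (1 + ε) Φ Φ.source := by
  refine LipschitzOnWith.of_dist_le_mul fun x hx y hy => ?_
  rw [dist_eq_norm, dist_eq_norm]
  calc ‖Φ x - Φ y‖ = ‖(x - y) + (Φ x - Φ y - (x - y))‖ := by rw [add_sub_cancel]
    _ ≤ ‖x - y‖ + ε * ‖x - y‖ :=
        (norm_add_le _ _).trans (add_le_add_right (h.approximatesLinearOn x hx y hy) _)
    _ = ((1 + ε : ℝ≥0) : ℝ) * ‖x - y‖ := by push_cast; ring

theorem lipschitzOnWith_symm (h : IsFlatteningChart ε ρ ν x₀ Φ) (hε : ε < 1) :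
    LipschitzOnWith (1 - ε)⁻¹ Φ.symm Φ.target := by
  refine LipschitzOnWith.of_dist_le_mul fun y hy z hz => ?_
  have happrox := h.approximatesLinearOn _ (Φ.map_target hy) _ (Φ.map_target hz)
  rw [Φ.right_inv hy, Φ.right_inv hz] at happrox
  rw [dist_eq_norm, dist_eq_norm, NNReal.coe_inv, NNReal.coe_sub hε.le, NNReal.coe_one,
    le_inv_mul_iff₀ (sub_pos.2 (NNReal.coe_lt_one.2 hε))]
  set u := Φ.symm y - Φ.symm z
  have hu : ‖u‖ ≤ ‖y - z‖ + ε * ‖u‖ :=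
    calc ‖u‖ = ‖(y - z) - (y - z - u)‖ := by rw [sub_sub_cancel]
      _ ≤ ‖y - z‖ + ‖y - z - u‖ := norm_sub_le _ _
      _ ≤ ‖y - z‖ + ε * ‖u‖ := add_le_add_right happrox _
  linarith

theorem isBounded_target (h : IsFlatteningChart ε ρ ν x₀ Φ) : Bornology.IsBounded Φ.target := by
  obtain ⟨C, hC⟩ := Metric.isBounded_iff.1 h.isBounded_source
  rw [← Φ.image_source_eq_target, Metric.isBounded_image_iff]
  exact ⟨(1 + ε : ℝ≥0) * C, fun x hx y hy => (h.lipschitzOnWith.dist_le_mul x hx y hy).trans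
    (mul_le_mul_of_nonneg_left (hC hx hy) NNReal.zero_le_coe)⟩

end IsFlatteningChart

end Flatten
/-! ### The divergence theorem near a boundary point -/

/-- A smooth cutoff, equal to `1` on `(-∞, -1]` and to `0` on `[0, ∞)`. -/
def slabCutoff (t : ℝ) : ℝ := 1 - Real.smoothTransition (t + 1)

/-- The bump `-slabCutoff'`, which has integral `1` and is supported in `[-1, 0]`. -/
def slabKernel (t : ℝ) : ℝ := deriv Real.smoothTransition (t + 1)

theorem slabCutoff_of_le_neg_one {t : ℝ} (ht : t ≤ -1) : slabCutoff t = 1 := by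
  rw [slabCutoff, Real.smoothTransition.zero_of_nonpos (by linarith), sub_zero]

theorem slabCutoff_of_nonneg {t : ℝ} (ht : 0 ≤ t) : slabCutoff t = 0 := by
  rw [slabCutoff, Real.smoothTransition.one_of_one_le (by linarith), sub_self]

theorem norm_slabCutoff_le_one (t : ℝ) : ‖slabCutoff t‖ ≤ 1 := by
  have hnonneg := Real.smoothTransition.nonneg (t + 1)
  have hle := Real.smoothTransition.le_one (t + 1)
  rw [Real.norm_eq_abs, abs_le, slabCutoff]
  constructor <;> linarith

theorem contDiff_slabCutoff : ContDiff ℝ 1 slabCutoff :=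
  contDiff_const.sub (Real.smoothTransition.contDiff.comp (contDiff_id.add contDiff_const))

theorem hasDerivAt_slabCutoff (t : ℝ) : HasDerivAt slabCutoff (-slabKernel t) t := by
  have hdiff : DifferentiableAt ℝ Real.smoothTransition (t + 1) :=
    (Real.smoothTransition.contDiff (n := 1)).differentiable one_ne_zero _
  exact (hdiff.hasDerivAt.comp_add_const t 1).const_sub 1

theorem continuous_slabKernel : Continuous slabKernel :=
  ((Real.smoothTransition.contDiff (n := 1)).continuous_deriv le_rfl).comp
    (continuous_add_const 1)

theorem slabKernel_of_notMem_Icc {t : ℝ} (ht : t ∉ Icc (-1 : ℝ) 0) : slabKernel t = 0 := by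
  have hconst {c : ℝ} (hc : slabCutoff =ᶠ[𝓝 t] fun _ => c) : slabKernel t = 0 :=
    neg_eq_zero.1 (((hasDerivAt_slabCutoff t).congr_of_eventuallyEq hc.symm).unique
      (hasDerivAt_const t c))
  rcases lt_or_ge t (-1) with hlt | hge
  · exact hconst ((gt_mem_nhds hlt).mono fun s hs => slabCutoff_of_le_neg_one (le_of_lt hs))
  · have hpos : 0 < t := not_le.1 fun hle => ht ⟨hge, hle⟩
    exact hconst ((lt_mem_nhds hpos).mono fun s hs => slabCutoff_of_nonneg (le_of_lt hs))

theorem hasCompactSupport_slabKernel : HasCompactSupport slabKernel :=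
  HasCompactSupport.intro isCompact_Icc fun _ => slabKernel_of_notMem_Icc

theorem integral_slabKernel : ∫ t, slabKernel t = 1 := by
  have hderiv (t : ℝ) : HasDerivAt (-slabCutoff) (slabKernel t) t := by
    simpa using (hasDerivAt_slabCutoff t).neg
  rw [← setIntegral_eq_integral_of_forall_compl_eq_zero fun t => slabKernel_of_notMem_Icc (t := t),
    integral_Icc_eq_integral_Ioc, ← intervalIntegral.integral_of_le (by norm_num),
    intervalIntegral.integral_eq_sub_of_hasDerivAt (fun t _ => hderiv t)
      (continuous_slabKernel.intervalIntegrable _ _)]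
  simp [slabCutoff_of_le_neg_one, slabCutoff_of_nonneg]

theorem tendsto_integral_slabCutoff_smul {α W : Type*} [MeasurableSpace α] {μ : Measure α}
    [NormedAddCommGroup W] [NormedSpace ℝ W] {ρ : α → ℝ} (hρ : AEMeasurable ρ μ) {φ : α → W}
    (hφ : Integrable φ μ) :
    Tendsto (fun δ : ℝ => ∫ x, slabCutoff (δ⁻¹ * ρ x) • φ x ∂μ) (𝓝[>] 0)
      (𝓝 (∫ x in {x | ρ x < 0}, φ x ∂μ)) := by
  rw [← integral_indicator₀ (nullMeasurableSet_lt hρ aemeasurable_const)]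
  refine tendsto_integral_filter_of_dominated_convergence (fun x => ‖φ x‖)
    (Eventually.of_forall fun δ => ?_) (Eventually.of_forall fun δ => ae_of_all μ fun x => ?_)
    hφ.norm (ae_of_all μ fun x => ?_)
  · exact (contDiff_slabCutoff.continuous.measurable.comp_aemeasurable
      (hρ.const_mul δ⁻¹)).aestronglyMeasurable.smul hφ.aestronglyMeasurable
  · exact (norm_smul_le _ _).trans
      (mul_le_of_le_one_left (norm_nonneg _) (norm_slabCutoff_le_one _))
  · rcases lt_or_ge (ρ x) 0 with hneg | hnonneg
    · rw [indicator_of_mem (s := {x | ρ x < 0}) hneg]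
      refine tendsto_const_nhds.congr' ?_
      filter_upwards [Ioo_mem_nhdsGT (neg_pos.2 hneg)] with δ hδ
      have hle : δ⁻¹ * ρ x ≤ -1 := (inv_mul_le_iff₀ hδ.1).2 (by linarith [hδ.2])
      rw [slabCutoff_of_le_neg_one hle, one_smul]
    · rw [indicator_of_notMem (s := {x | ρ x < 0}) hnonneg.not_gt]
      refine tendsto_const_nhds.congr' ?_
      filter_upwards [self_mem_nhdsWithin] with δ (hδ : 0 < δ)
      rw [slabCutoff_of_nonneg (by positivity), zero_smul]

theorem integrable_of_continuousOn_of_tsupport_subset {α W : Type*} [TopologicalSpace α]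
    [MeasurableSpace α] [OpensMeasurableSpace α] {μ : Measure α} [IsFiniteMeasureOnCompacts μ]
    [NormedAddCommGroup W] {φ : α → W} {B K : Set α} (hB : IsOpen B) (hφ : ContinuousOn φ B)
    (hK : IsCompact K) (hKB : K ⊆ B) (hφK : tsupport φ ⊆ K) : Integrable φ μ :=
  (hφ.continuous_of_tsupport_subset hB (hφK.trans hKB)).integrable_of_hasCompactSupport
    (hK.of_isClosed_subset (isClosed_tsupport φ) hφK)

section Layer

variable {n : ℕ} {W : Type*} [NormedAddCommGroup W] [NormedSpace ℝ W]
  {F : EuclideanSpace ℝ (Fin n) → Fin n → W} {B : Set (EuclideanSpace ℝ (Fin n))}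
  {ρ : EuclideanSpace ℝ (Fin n) → ℝ}

theorem tsupport_contract_subset (N : EuclideanSpace ℝ (Fin n) → EuclideanSpace ℝ (Fin n)) :
    tsupport (fun x => contract (N x) (F x)) ⊆ tsupport F :=
  closure_mono fun x hx hF => hx (by simp [contract, hF])

theorem tsupport_divergence_subset : tsupport (divergence F) ⊆ tsupport F :=
  closure_minimal (fun _ hx => not_not.1 fun hF => hx (divergence_of_notMem_tsupport hF))
    (isClosed_tsupport F)

theorem continuousOn_contract {N : EuclideanSpace ℝ (Fin n) → EuclideanSpace ℝ (Fin n)}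
    (hN : ContinuousOn N B) (hF : ContinuousOn F B) :
    ContinuousOn (fun x => contract (N x) (F x)) B :=
  continuous_contract.comp_continuousOn (hN.prodMk hF)

theorem integral_smul_divergence [CompleteSpace W] {θ : EuclideanSpace ℝ (Fin n) → ℝ}
    (hB : IsOpen B) (hθ : ContDiffOn ℝ 1 θ B) (hF : Differentiable ℝ F) (hc : HasCompactSupport F)
    (hFB : tsupport F ⊆ B) (hdiv : Continuous (divergence F)) :
    ∫ x, θ x • divergence F x = -∫ x, contract (gradient θ x) (F x) := by
  have hθF : Differentiable ℝ fun x => θ x • F x := fun x => by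
    by_cases hx : x ∈ tsupport F
    · exact ((hθ.contDiffAt (hB.mem_nhds (hFB hx))).differentiableAt one_ne_zero).smul (hF x)
    · refine (differentiableAt_const 0).congr_of_eventuallyEq ?_
      filter_upwards [notMem_tsupport_iff_eventuallyEq.1 hx] with y hy
      rw [hy, Pi.zero_apply, smul_zero]
  have hproduct : divergence (fun x => θ x • F x) =
      fun x => θ x • divergence F x + contract (gradient θ x) (F x) := by
    ext x
    by_cases hx : x ∈ tsupport F
    · exact divergence_smul ((hθ.contDiffAt (hB.mem_nhds (hFB hx))).differentiableAt one_ne_zero)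
        (hF x)
    · rw [divergence_of_notMem_tsupport fun h => hx (tsupport_smul_subset_right θ F h),
        divergence_of_notMem_tsupport hx, image_eq_zero_of_notMem_tsupport hx]
      simp [contract]
  have hsmul : Integrable fun x => θ x • divergence F x :=
    integrable_of_continuousOn_of_tsupport_subset hB (hθ.continuousOn.smul hdiv.continuousOn) hc
      hFB ((tsupport_smul_subset_right _ _).trans tsupport_divergence_subset)
  have hcontract : Integrable fun x => contract (gradient θ x) (F x) :=
    integrable_of_continuousOn_of_tsupport_subset hB
      (continuousOn_contract (continuousOn_gradient hB hθ) hF.continuous.continuousOn) hc hFB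
      (tsupport_contract_subset _)
  have hcθ : HasCompactSupport fun x => θ x • F x :=
    hc.of_isClosed_subset (isClosed_tsupport _) (tsupport_smul_subset_right θ F)
  have hzero := integral_divergence_eq_zero hθF hcθ (by rw [hproduct]; exact hsmul.add hcontract)
  rw [hproduct, integral_add hsmul hcontract] at hzero
  exact eq_neg_of_add_eq_zero_left hzero

end Layer
section Layer

variable {n : ℕ} {W : Type*} [NormedAddCommGroup W] [NormedSpace ℝ W] [CompleteSpace W]
  {F : EuclideanSpace ℝ (Fin n) → Fin n → W} {B : Set (EuclideanSpace ℝ (Fin n))}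
  {ρ : EuclideanSpace ℝ (Fin n) → ℝ}

theorem gradient_slabCutoff_mul {x : EuclideanSpace ℝ (Fin n)} (hρ : DifferentiableAt ℝ ρ x)
    (c : ℝ) : gradient (fun y => slabCutoff (c * ρ y)) x =
      -((c * slabKernel (c * ρ x)) • gradient ρ x) := by
  have hderiv : HasFDerivAt (fun y => slabCutoff (c * ρ y))
      (-slabKernel (c * ρ x) • c • fderiv ℝ ρ x) x :=
    HasDerivAt.comp_hasFDerivAt (h₂ := slabCutoff) x (hasDerivAt_slabCutoff (c * ρ x))
      (hρ.hasFDerivAt.const_mul c)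
  rw [gradient, hderiv.fderiv, gradient, map_smul, map_smul, smul_smul, ← neg_smul, neg_mul,
    mul_comm]

theorem tendsto_integral_layer (hB : IsOpen B) (hρ : ContDiffOn ℝ 1 ρ B) (hF : Differentiable ℝ F)
    (hc : HasCompactSupport F) (hFB : tsupport F ⊆ B) (hdiv : Continuous (divergence F)) :
    Tendsto (fun δ : ℝ =>
        ∫ x, (δ⁻¹ * slabKernel (δ⁻¹ * ρ x)) • contract (gradient ρ x) (F x)) (𝓝[>] 0)
      (𝓝 (∫ x in B ∩ {x | ρ x < 0}, divergence F x)) := by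
  have hdivB (x) (hx : x ∉ B) : divergence F x = 0 :=
    divergence_of_notMem_tsupport fun h => hx (hFB h)
  have hρm : AEMeasurable ρ (volume.restrict B) :=
    hρ.continuousOn.aemeasurable hB.measurableSet
  have hlim := tendsto_integral_slabCutoff_smul hρm
    (hdiv.integrable_of_hasCompactSupport
      (hc.of_isClosed_subset (isClosed_tsupport _) tsupport_divergence_subset)).restrict
  rw [Measure.restrict_restrict₀ (nullMeasurableSet_lt hρm aemeasurable_const), inter_comm] at hlim
  refine hlim.congr fun δ => ?_
  rw [setIntegral_eq_integral_of_forall_compl_eq_zero fun x hx => by rw [hdivB x hx, smul_zero],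
    integral_smul_divergence (θ := fun y => slabCutoff (δ⁻¹ * ρ y)) hB
      (contDiff_slabCutoff.comp_contDiffOn (contDiffOn_const.mul hρ)) hF hc hFB hdiv,
    ← integral_neg]
  congr 1
  ext x
  by_cases hx : x ∈ B
  · rw [gradient_slabCutoff_mul ((hρ.contDiffAt (hB.mem_nhds hx)).differentiableAt one_ne_zero),
      contract_neg_left, neg_neg, contract_smul_left]
  · simp [contract, image_eq_zero_of_notMem_tsupport fun h => hx (hFB h)]

end Layer

theorem one_add_le_inv_one_sub {ε : ℝ≥0} (hε : ε < 1) : 1 + ε ≤ (1 - ε)⁻¹ := by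
  rw [NNReal.le_inv_iff_mul_le (tsub_pos_of_lt hε).ne', ← NNReal.coe_le_coe]
  push_cast [NNReal.coe_sub hε.le]
  nlinarith [sq_nonneg (ε : ℝ)]

theorem continuous_and_hasCompactSupport_indicator_comp_symm {X Y W : Type*} [TopologicalSpace X]
    [TopologicalSpace Y] [T2Space Y] [TopologicalSpace W] [Zero W] {Φ : OpenPartialHomeomorph X Y}
    {ψ : X → W} (hψ : Continuous ψ) (hc : HasCompactSupport ψ) (hψΦ : tsupport ψ ⊆ Φ.source) :
    Continuous (Φ.target.indicator (ψ ∘ Φ.symm)) ∧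
      HasCompactSupport (Φ.target.indicator (ψ ∘ Φ.symm)) := by
  have hK : IsCompact (Φ '' tsupport ψ) :=
    hc.isCompact.image_of_continuousOn (Φ.continuousOn.mono hψΦ)
  have hsupp : tsupport (Φ.target.indicator (ψ ∘ Φ.symm)) ⊆ Φ '' tsupport ψ :=
    closure_minimal (fun y hy => have hy' := indicator_apply_ne_zero.1 hy
      ⟨Φ.symm y, subset_tsupport ψ hy'.2, Φ.right_inv hy'.1⟩) hK.isClosed
  have hcont : ContinuousOn (Φ.target.indicator (ψ ∘ Φ.symm)) Φ.target :=
    (hψ.comp_continuousOn Φ.continuousOn_symm).congr fun y hy => indicator_of_mem hy _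
  exact ⟨hcont.continuous_of_tsupport_subset Φ.open_target
    (hsupp.trans (image_subset_iff.2 fun x hx => Φ.map_source (hψΦ hx))),
    hK.of_isClosed_subset (isClosed_tsupport _) hsupp⟩

section FlattenedMeasure

variable {E W : Type*} [NormedAddCommGroup E] [InnerProductSpace ℝ E] [FiniteDimensional ℝ E]
  [MeasurableSpace E] [BorelSpace E] [NormedAddCommGroup W] [NormedSpace ℝ W]
  {ε : ℝ≥0} {ρ : E → ℝ} {ν x₀ : E} {Φ : OpenPartialHomeomorph E E}

/-- The area measure of the hyperplane orthogonal to `ν`, transported by the chart `Φ`. For a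
flattening chart it is close to the area measure of the hypersurface straightened by `Φ`. -/
def flattenedMeasure (ν : E) (Φ : OpenPartialHomeomorph E E) : Measure E :=
  ((μHE[Module.finrank ℝ E - 1] : Measure E).restrict
    (Φ.target ∩ {y | inner ℝ ν y = 0})).map Φ.symm

namespace IsFlatteningChart

theorem isFiniteMeasure (h : IsFlatteningChart ε ρ ν x₀ Φ) :
    IsFiniteMeasure (flattenedMeasure ν Φ) := by
  have : IsFiniteMeasure ((μHE[Module.finrank ℝ E - 1] : Measure E).restrict
      (Φ.target ∩ {y | inner ℝ ν y = 0})) :=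
    isFiniteMeasure_restrict.2
      (euclideanHausdorffMeasure_hyperplane_inter_lt_top h.norm_eq_one h.isBounded_target).ne
  exact Measure.isFiniteMeasure_map _ _

theorem flattenedMeasure_le (h : IsFlatteningChart ε ρ ν x₀ Φ) (hε : ε < 1) :
    flattenedMeasure ν Φ ≤ ((1 - ε)⁻¹ ^ (Module.finrank ℝ E - 1) : ℝ≥0) •
      (μHE[Module.finrank ℝ E - 1] : Measure E).restrict (Φ.source ∩ {x | ρ x = 0}) := by
  rw [← h.source_inter_preimage]
  exact euclideanHausdorffMeasure_map_symm_le Φ _ _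
    (isClosed_eq (by fun_prop) continuous_const).measurableSet
    (h.lipschitzOnWith.weaken (one_add_le_inv_one_sub hε))

theorem le_flattenedMeasure (h : IsFlatteningChart ε ρ ν x₀ Φ) (hε : ε < 1) :
    (μHE[Module.finrank ℝ E - 1] : Measure E).restrict (Φ.source ∩ {x | ρ x = 0}) ≤
      ((1 - ε)⁻¹ ^ (Module.finrank ℝ E - 1) : ℝ≥0) • flattenedMeasure ν Φ := by
  rw [← h.source_inter_preimage]
  exact euclideanHausdorffMeasure_le_map_symm Φ _ _ (h.lipschitzOnWith_symm hε)

theorem setIntegral_target (h : IsFlatteningChart ε ρ ν x₀ Φ) (u : E → W) :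
    ∫ y in Φ.target, u y = ∫ x in Φ.source, fderiv ℝ ρ x ν • u (Φ x) := by
  rw [← Φ.image_source_eq_target, integral_image_eq_integral_abs_det_fderiv_smul volume
    Φ.open_source.measurableSet (fun x hx => (h.hasFDerivAt hx).hasFDerivWithinAt) Φ.injOn]
  refine setIntegral_congr_fun Φ.open_source.measurableSet fun x hx => ?_
  rw [det_flattenDeriv h.norm_eq_one, abs_of_pos (h.fderiv_pos x hx)]

theorem integral_flattenedMeasure {ψ : E → W} (hψ : Continuous ψ) :
    ∫ x, ψ x ∂flattenedMeasure ν Φ =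
      ∫ y in {y | inner ℝ ν y = 0}, Φ.target.indicator (ψ ∘ Φ.symm) y
        ∂μHE[Module.finrank ℝ E - 1] := by
  rw [setIntegral_indicator Φ.open_target.measurableSet, inter_comm, flattenedMeasure,
    integral_map (aemeasurable_symm_restrict Φ _ _) hψ.aestronglyMeasurable]
  rfl

theorem tendsto_integral [CompleteSpace W] (h : IsFlatteningChart ε ρ ν x₀ Φ) {φ : E → W}
    (hφ : ContinuousOn φ Φ.source) (hc : HasCompactSupport φ) (hφΦ : tsupport φ ⊆ Φ.source) :
    Tendsto (fun δ : ℝ => ∫ x, (δ⁻¹ * slabKernel (δ⁻¹ * ρ x)) • φ x) (𝓝[>] 0)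
      (𝓝 (∫ x, (fderiv ℝ ρ x ν)⁻¹ • φ x ∂flattenedMeasure ν Φ)) := by
  set ψ : E → W := fun x => (fderiv ℝ ρ x ν)⁻¹ • φ x
  have hψ : ContinuousOn ψ Φ.source :=
    (h.continuousOn_fderiv_apply.inv₀ fun x hx => (h.fderiv_pos x hx).ne').smul hφ
  have hψc : Continuous ψ := hψ.continuous_of_tsupport_subset Φ.open_source
    ((tsupport_smul_subset_right _ _).trans hφΦ)
  have hψs : tsupport ψ ⊆ tsupport φ := tsupport_smul_subset_right _ φ
  obtain ⟨hq, hqs⟩ := continuous_and_hasCompactSupport_indicator_comp_symm hψc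
    (hc.of_isClosed_subset (isClosed_tsupport ψ) hψs) (hψs.trans hφΦ)
  have hlim := tendsto_integral_slab h.norm_eq_one continuous_slabKernel
    hasCompactSupport_slabKernel integral_slabKernel hq hqs
  rw [integral_flattenedMeasure hψc]
  refine hlim.congr fun δ => ?_
  rw [← setIntegral_eq_integral_of_forall_compl_eq_zero (s := Φ.target) fun y hy => by
      rw [indicator_of_notMem hy, smul_zero], h.setIntegral_target,
    ← setIntegral_eq_integral_of_forall_compl_eq_zero (s := Φ.source) (f := fun x => _ • φ x)
      fun x hx => by
        rw [image_eq_zero_of_notMem_tsupport fun hmem => hx (hφΦ hmem), smul_zero]]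
  refine setIntegral_congr_fun Φ.open_source.measurableSet fun x hx => ?_
  simp only [ψ, indicator_of_mem (Φ.map_source hx), Function.comp_apply, Φ.left_inv hx,
    h.inner_apply]
  rw [smul_comm, smul_inv_smul₀ (h.fderiv_pos x hx).ne']

end IsFlatteningChart

end FlattenedMeasure
theorem setIntegral_eq_setIntegral_inter {α Y : Type*} [MeasurableSpace α] {μ : Measure α}
    [NormedAddCommGroup Y] [NormedSpace ℝ Y] {A B : Set α} (hA : MeasurableSet A) {u : α → Y}
    (hu : ∀ x ∉ B, u x = 0) : ∫ x in A, u x ∂μ = ∫ x in A ∩ B, u x ∂μ :=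
  setIntegral_eq_of_subset_of_forall_sdiff_eq_zero hA inter_subset_left fun x hx =>
    hu x fun hB => hx.2 ⟨hx.1, hB⟩

section BoundaryChart

variable {n : ℕ} {W : Type*} [NormedAddCommGroup W] [NormedSpace ℝ W]
  {F : EuclideanSpace ℝ (Fin n) → Fin n → W} {D U : Set (EuclideanSpace ℝ (Fin n))}
  {N : EuclideanSpace ℝ (Fin n) → EuclideanSpace ℝ (Fin n)} {ε : ℝ≥0}
  {ρ : EuclideanSpace ℝ (Fin n) → ℝ} {ν x₀ : EuclideanSpace ℝ (Fin n)}
  {Φ : OpenPartialHomeomorph (EuclideanSpace ℝ (Fin n)) (EuclideanSpace ℝ (Fin n))}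

theorem integrableOn_frontier_contract (hN : ContinuousOn N (frontier D)) (hF : Continuous F)
    (hc : HasCompactSupport F) (hfin : μHE[n - 1] (frontier D ∩ tsupport F) < ⊤) :
    IntegrableOn (fun x => contract (N x) (F x)) (frontier D) μHE[n - 1] := by
  have hKm : MeasurableSet (frontier D ∩ tsupport F) :=
    (isClosed_frontier.inter (isClosed_tsupport F)).measurableSet
  have hK : IsCompact (frontier D ∩ tsupport F) := hc.isCompact.inter_left isClosed_frontier
  obtain ⟨C, hC⟩ := hK.exists_bound_of_continuousOn
    ((continuousOn_contract hN hF.continuousOn).mono inter_subset_left)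
  have hint : IntegrableOn (fun x => contract (N x) (F x)) (frontier D ∩ tsupport F)
      μHE[n - 1] :=
    .of_bound hfin
      (((continuousOn_contract hN hF.continuousOn).mono inter_subset_left).aestronglyMeasurable
        hKm) C (ae_restrict_of_forall_mem hKm hC)
  exact hint.of_forall_sdiff_eq_zero isClosed_frontier.measurableSet fun x hx => by
    simp [contract, image_eq_zero_of_notMem_tsupport fun h => hx.2 ⟨hx.1, h⟩]

variable [CompleteSpace W]

namespace IsFlatteningChart

theorem setIntegral_divergence (h : IsFlatteningChart ε ρ ν x₀ Φ) (hF : Differentiable ℝ F)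
    (hc : HasCompactSupport F) (hFΦ : tsupport F ⊆ Φ.source) (hdiv : Continuous (divergence F)) :
    ∫ x in Φ.source ∩ {x | ρ x < 0}, divergence F x =
      ∫ x, (fderiv ℝ ρ x ν)⁻¹ • contract (gradient ρ x) (F x) ∂flattenedMeasure ν Φ :=
  have hsupp := tsupport_contract_subset (F := F) (gradient ρ)
  tendsto_nhds_unique (tendsto_integral_layer Φ.open_source h.contDiffOn hF hc hFΦ hdiv)
    (h.tendsto_integral
      (continuousOn_contract (continuousOn_gradient Φ.open_source h.contDiffOn)
        hF.continuous.continuousOn)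
      (hc.of_isClosed_subset (isClosed_tsupport _) hsupp) (hsupp.trans hFΦ))

theorem euclideanHausdorffMeasure_lt_top (h : IsFlatteningChart ε ρ ν x₀ Φ) (hε : ε < 1) :
    μHE[n - 1] (Φ.source ∩ {x | ρ x = 0}) < ⊤ := by
  have hfin := h.isFiniteMeasure
  have hle := h.le_flattenedMeasure hε univ
  rw [finrank_euclideanSpace_fin, Measure.restrict_apply_univ] at hle
  exact hle.trans_lt (measure_lt_top _ _)

theorem ae_mem_frontier_inter (h : IsFlatteningChart ε ρ ν x₀ Φ) (hε : ε < 1) (hD : IsOpen D)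
    (hρ : IsC1DefiningFunction D U ρ) (hU : Φ.source ⊆ U) :
    ∀ᵐ x ∂flattenedMeasure ν Φ, x ∈ frontier D ∩ Φ.source := by
  have hm := h.flattenedMeasure_le hε
  rw [← hρ.frontier_inter_eq hD hU] at hm
  exact ((Measure.absolutelyContinuous_of_le hm).trans Measure.smul_absolutelyContinuous).ae_le
    (ae_restrict_mem (isClosed_frontier.measurableSet.inter Φ.open_source.measurableSet))

theorem setIntegral_divergence_eq_integral_contract (h : IsFlatteningChart ε ρ ν x₀ Φ)
    (hε : ε < 1) (hD : IsOpen D) (hρ : IsC1DefiningFunction D U ρ) (hU : Φ.source ⊆ U)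
    (hNρ : ∀ x ∈ frontier D ∩ U, gradient ρ x = ‖gradient ρ x‖ • N x)
    (hF : Differentiable ℝ F) (hc : HasCompactSupport F) (hFΦ : tsupport F ⊆ Φ.source)
    (hdiv : Continuous (divergence F)) :
    ∫ x in D, divergence F x =
      ∫ x, (‖gradient ρ x‖ / fderiv ℝ ρ x ν) • contract (N x) (F x) ∂flattenedMeasure ν Φ := by
  have hDΦ : D ∩ Φ.source = Φ.source ∩ {x | ρ x < 0} := by
    ext x
    exact ⟨fun hx => ⟨hx.2, (hρ.mem_iff x (hU hx.2)).1 hx.1⟩,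
      fun hx => ⟨(hρ.mem_iff x (hU hx.1)).2 hx.2, hx.1⟩⟩
  rw [setIntegral_eq_setIntegral_inter hD.measurableSet fun x hx =>
      divergence_of_notMem_tsupport fun hxF => hx (hFΦ hxF), hDΦ,
    h.setIntegral_divergence hF hc hFΦ hdiv]
  refine integral_congr_ae ((h.ae_mem_frontier_inter hε hD hρ hU).mono fun x hx => ?_)
  beta_reduce
  rw [hNρ x ⟨hx.1, hU hx.2⟩, contract_smul_left, smul_smul, ← div_eq_inv_mul,
    ← hNρ x ⟨hx.1, hU hx.2⟩]

theorem aestronglyMeasurable_norm_gradient_div (h : IsFlatteningChart ε ρ ν x₀ Φ)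
    {m : Measure (EuclideanSpace ℝ (Fin n))} (hm : ∀ᵐ x ∂m, x ∈ Φ.source) :
    AEStronglyMeasurable (fun x => ‖gradient ρ x‖ / fderiv ℝ ρ x ν) m := by
  rw [← Measure.restrict_eq_self_of_ae_mem hm]
  exact ((continuousOn_gradient Φ.open_source h.contDiffOn).norm.div h.continuousOn_fderiv_apply
    fun x hx => (h.fderiv_pos x hx).ne').aestronglyMeasurable Φ.open_source.measurableSet

theorem norm_integral_divergence_sub_le (h : IsFlatteningChart ε ρ ν x₀ Φ) (hε : ε < 1)
    (hD : IsOpen D) (hρ : IsC1DefiningFunction D U ρ) (hU : Φ.source ⊆ U)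
    (hN : ContinuousOn N (frontier D))
    (hNρ : ∀ x ∈ frontier D ∩ U, gradient ρ x = ‖gradient ρ x‖ • N x)
    (hF : Differentiable ℝ F) (hc : HasCompactSupport F) (hFΦ : tsupport F ⊆ Φ.source)
    (hdiv : Continuous (divergence F)) :
    ‖(∫ x in D, divergence F x) - ∫ x in frontier D, contract (N x) (F x) ∂μHE[n - 1]‖ ≤
      (ε * (1 - ε : ℝ)⁻¹ ^ (n - 1) + 3 * ((1 - ε : ℝ)⁻¹ ^ (n - 1) - 1)) *
        ∫ x in frontier D, ‖contract (N x) (F x)‖ ∂μHE[n - 1] := by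
  have hfin := h.isFiniteMeasure
  have hm := h.flattenedMeasure_le hε
  have hμ := h.le_flattenedMeasure hε
  rw [finrank_euclideanSpace_fin, ← hρ.frontier_inter_eq hD hU] at hm hμ
  have hae := h.ae_mem_frontier_inter hε hD hρ hU
  set φ : EuclideanSpace ℝ (Fin n) → W := fun x => contract (N x) (F x)
  have hφ : IntegrableOn φ (frontier D) μHE[n - 1] :=
    integrableOn_frontier_contract hN hF.continuous hc
      ((measure_mono (inter_subset_inter_right _ hFΦ)).trans_lt
        (hρ.frontier_inter_eq hD hU ▸ h.euclideanHausdorffMeasure_lt_top hε))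
  have hφ0 (x) (hx : x ∉ Φ.source) : φ x = 0 := by
    simp [φ, contract, image_eq_zero_of_notMem_tsupport fun hxF => hx (hFΦ hxF)]
  have hc1 : (1 : ℝ≥0) ≤ (1 - ε)⁻¹ ^ (n - 1) :=
    one_le_pow₀ (le_self_add.trans (one_add_le_inv_one_sub hε))
  rw [h.setIntegral_divergence_eq_integral_contract hε hD hρ hU hNρ hF hc hFΦ hdiv,
    setIntegral_eq_setIntegral_inter isClosed_frontier.measurableSet hφ0,
    setIntegral_eq_setIntegral_inter isClosed_frontier.measurableSet
      (u := fun x => ‖φ x‖) fun x hx => by rw [hφ0 x hx, norm_zero]]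
  simpa [NNReal.coe_sub hε.le] using norm_integral_smul_sub_integral_le hc1 hm hμ
    (hφ.mono_set inter_subset_left)
    (h.aestronglyMeasurable_norm_gradient_div (hae.mono fun x hx => hx.2)) ε.2
    (hae.mono fun x hx => h.abs_sub_one_le x hx.2)

end IsFlatteningChart

theorem exists_flattening_error_le (m : ℕ) {η : ℝ} (hη : 0 < η) :
    ∃ ε : ℝ≥0, 0 < ε ∧ ε < 1 ∧ ε * (1 - ε : ℝ)⁻¹ ^ m + 3 * ((1 - ε : ℝ)⁻¹ ^ m - 1) ≤ η := by
  have hinv : ContinuousAt (fun ε : ℝ => (1 - ε)⁻¹) 0 :=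
    (continuousAt_const.sub continuousAt_id).inv₀ (by simp)
  have hcont : ContinuousAt
      (fun ε : ℝ => ε * (1 - ε)⁻¹ ^ m + 3 * ((1 - ε)⁻¹ ^ m - 1)) 0 := by fun_prop
  have hsmall : ∀ᶠ ε : ℝ in 𝓝[>] 0, ε * (1 - ε)⁻¹ ^ m + 3 * ((1 - ε)⁻¹ ^ m - 1) < η :=
    (hcont.eventually (gt_mem_nhds (by simpa using hη))).filter_mono nhdsWithin_le_nhds
  obtain ⟨ε, hε, hε01⟩ := (hsmall.and (Ioo_mem_nhdsGT one_pos)).exists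
  exact ⟨⟨ε, hε01.1.le⟩, hε01.1, hε01.2, hε.le⟩

variable (W) in
theorem exists_isOpen_norm_integral_divergence_sub_le (hD : IsOpen D)
    (hN : IsOutwardNormalField D N) (hx₀ : x₀ ∈ frontier D) {η : ℝ} (hη : 0 < η) :
    ∃ B, IsOpen B ∧ x₀ ∈ B ∧ μHE[n - 1] (frontier D ∩ B) < ⊤ ∧
      ∀ F : EuclideanSpace ℝ (Fin n) → Fin n → W, Differentiable ℝ F → HasCompactSupport F →
        tsupport F ⊆ B → Continuous (divergence F) →
        ‖(∫ x in D, divergence F x) - ∫ x in frontier D, contract (N x) (F x) ∂μHE[n - 1]‖ ≤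
          η * ∫ x in frontier D, ‖contract (N x) (F x)‖ ∂μHE[n - 1] := by
  obtain ⟨U, ρ, hx₀U, hρ, hgrad, hNρ⟩ := hN.exists_normalized hx₀
  obtain ⟨ε, hε, hε1, hεη⟩ := exists_flattening_error_le (n - 1) hη
  obtain ⟨Φ, hx₀Φ, hΦU, hΦ⟩ := exists_isFlatteningChart hρ.isOpen hx₀U hρ.contDiffOn hgrad hε hε1
  refine ⟨Φ.source, Φ.open_source, hx₀Φ, ?_, fun F hF hc hFΦ hdiv => ?_⟩
  · rw [hρ.frontier_inter_eq hD hΦU]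
    exact hΦ.euclideanHausdorffMeasure_lt_top hε1
  · exact (hΦ.norm_integral_divergence_sub_le hε1 hD hρ hΦU hN.continuousOn hNρ hF hc hFΦ
      hdiv).trans (mul_le_mul_of_nonneg_right hεη (integral_nonneg fun _ => norm_nonneg _))

end BoundaryChart
/-! ### The divergence theorem on a bounded domain -/

theorem exists_finite_partitionOfUnity {E : Type*} [NormedAddCommGroup E] [NormedSpace ℝ E]
    [FiniteDimensional ℝ E] {K : Set E} (hK : IsCompact K) {B : E → Set E}
    (hB : ∀ x ∈ K, IsOpen (B x)) (hxB : ∀ x ∈ K, x ∈ B x) :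
    ∃ (t : Finset E) (χ : t → E → ℝ), ↑t ⊆ K ∧ (∀ i, ContDiff ℝ ∞ (χ i)) ∧ (∀ i x, 0 ≤ χ i x) ∧
      (∀ i, HasCompactSupport (χ i)) ∧ (∀ i, tsupport (χ i) ⊆ B i) ∧
      ∀ x ∈ K, ∑ i, χ i x = 1 := by
  have hnhds (x) (hx : x ∈ K) : B x ∩ Metric.ball x 1 ∈ 𝓝 x :=
    inter_mem ((hB x hx).mem_nhds (hxB x hx)) (Metric.ball_mem_nhds x one_pos)
  obtain ⟨t, htK, ht⟩ := hK.elim_nhds_subcover _ hnhds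
  obtain ⟨f, hf⟩ := SmoothPartitionOfUnity.exists_isSubordinate 𝓘(ℝ, E) hK.isClosed
    (fun i : t => B i ∩ Metric.ball (i : E) 1)
    (fun i => (hB i (htK i i.2)).inter Metric.isOpen_ball)
    (ht.trans fun x hx => by simpa only [mem_iUnion, Subtype.exists] using hx)
  refine ⟨t, fun i => f i, htK, fun i => (f i).contMDiff.contDiff, fun i => f.nonneg i,
    fun i => Metric.isCompact_of_isClosed_isBounded (isClosed_tsupport _)
      (Metric.isBounded_ball.subset ((hf i).trans inter_subset_right)),
    fun i => (hf i).trans inter_subset_left, fun x hx => ?_⟩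
  rw [← finsum_eq_sum_of_fintype]
  exact f.sum_eq_one hx

theorem setIntegral_eq_sum_setIntegral_smul {X W ι : Type*} [MeasurableSpace X]
    [NormedAddCommGroup W] [NormedSpace ℝ W] [Fintype ι] {μ : Measure X} {s : Set X}
    {χ : ι → X → ℝ} {u : X → W} (hs : MeasurableSet s) (hχ : ∀ x ∈ s, ∑ i, χ i x = 1)
    (hu : ∀ i, IntegrableOn (fun x => χ i x • u x) s μ) :
    ∫ x in s, u x ∂μ = ∑ i, ∫ x in s, χ i x • u x ∂μ := by
  rw [← integral_finsetSum _ fun i _ => hu i]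
  refine setIntegral_congr_fun hs fun x hx => ?_
  simp only [← Finset.sum_smul, hχ x hx, one_smul]

section Cutoff

variable {n : ℕ} {W : Type*} [NormedAddCommGroup W] [NormedSpace ℝ W]
  {F : EuclideanSpace ℝ (Fin n) → Fin n → W} {Ω : Set (EuclideanSpace ℝ (Fin n))}

theorem differentiable_smul_of_tsupport_subset {θ : EuclideanSpace ℝ (Fin n) → ℝ} (hΩ : IsOpen Ω)
    (hθ : Differentiable ℝ θ) (hθΩ : tsupport θ ⊆ Ω) (hF : DifferentiableOn ℝ F Ω) :
    Differentiable ℝ fun x => θ x • F x := by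
  intro x
  by_cases hx : x ∈ tsupport θ
  · exact (hθ x).fun_smul (hF.differentiableAt (hΩ.mem_nhds (hθΩ hx)))
  · refine (differentiableAt_const (0 : Fin n → W)).congr_of_eventuallyEq ?_
    filter_upwards [notMem_tsupport_iff_eventuallyEq.1 hx] with y hy
    simp only [hy, Pi.zero_apply, zero_smul]

theorem continuous_divergence_smul {θ : EuclideanSpace ℝ (Fin n) → ℝ} (hΩ : IsOpen Ω)
    (hθ : ContDiff ℝ 1 θ) (hθΩ : tsupport θ ⊆ Ω) (hF : DifferentiableOn ℝ F Ω)
    (hdiv : ContinuousOn (divergence F) Ω) :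
    Continuous (divergence fun x => θ x • F x) := by
  have hsmul : tsupport (fun x => θ x • F x) ⊆ tsupport θ := tsupport_smul_subset_left θ F
  have hsupp : tsupport (divergence fun x => θ x • F x) ⊆ Ω :=
    tsupport_divergence_subset.trans (hsmul.trans hθΩ)
  have hgrad : ContinuousOn (gradient θ) Ω := continuousOn_gradient hΩ hθ.contDiffOn
  have hcont : ContinuousOn (divergence fun x => θ x • F x) Ω :=
    ((hθ.continuous.continuousOn.smul hdiv).add (continuousOn_contract hgrad hF.continuousOn)).congr
      fun x hx => divergence_smul (hθ.differentiable (by simp) x)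
        (hF.differentiableAt (hΩ.mem_nhds hx))
  exact continuous_of_tsupport fun x hx => hcont.continuousAt (hΩ.mem_nhds (hsupp hx))

theorem contract_smul_right (c : ℝ) (ν : EuclideanSpace ℝ (Fin n)) (w : Fin n → W) :
    contract ν (c • w) = c • contract ν w := by
  simp only [contract, Pi.smul_apply, Finset.smul_sum, smul_comm c]

theorem sum_divergence_smul {ι : Type*} [Fintype ι] {χ : ι → EuclideanSpace ℝ (Fin n) → ℝ}
    {x : EuclideanSpace ℝ (Fin n)} (hχ : ∀ᶠ y in 𝓝 x, ∑ i, χ i y = 1)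
    (hF : ∀ i, DifferentiableAt ℝ (fun y => χ i y • F y) x) :
    ∑ i, divergence (fun y => χ i y • F y) x = divergence F x := by
  have hsum : (fun y => ∑ i, χ i y • F y) =ᶠ[𝓝 x] F := by
    filter_upwards [hχ] with y hy
    rw [← Finset.sum_smul, hy, one_smul]
  simp only [divergence, ← hsum.fderiv_eq, fderiv_fun_sum fun i _ => hF i]
  rw [Finset.sum_comm]
  simp

end Cutoff

section Global

variable {n : ℕ} {D Ω : Set (EuclideanSpace ℝ (Fin n))}
  {N : EuclideanSpace ℝ (Fin n) → EuclideanSpace ℝ (Fin n)} {x : EuclideanSpace ℝ (Fin n)}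
  {W : Type*} [NormedAddCommGroup W] [NormedSpace ℝ W]

theorem isCompact_frontier {X : Type*} [PseudoMetricSpace X] [ProperSpace X] {s : Set X}
    (hs : Bornology.IsBounded s) : IsCompact (frontier s) :=
  hs.isCompact_closure.of_isClosed_subset isClosed_frontier frontier_subset_closure

theorem measure_frontier_lt_top (hD : IsOpen D) (hb : Bornology.IsBounded D)
    (hN : IsOutwardNormalField D N) : μHE[n - 1] (frontier D) < ⊤ := by
  refine (isCompact_frontier hb).measure_lt_top_of_nhdsWithin fun x hx => ?_
  obtain ⟨B, hB, hxB, hfin, -⟩ := exists_isOpen_norm_integral_divergence_sub_le ℝ hD hN hx one_pos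
  exact ⟨_, inter_mem_nhdsWithin _ (hB.mem_nhds hxB), hfin⟩

theorem integrableOn_frontier {Y : Type*} [NormedAddCommGroup Y]
    {φ : EuclideanSpace ℝ (Fin n) → Y} (hD : IsOpen D) (hb : Bornology.IsBounded D)
    (hN : IsOutwardNormalField D N) (hφ : ContinuousOn φ (frontier D)) :
    IntegrableOn φ (frontier D) μHE[n - 1] := by
  obtain ⟨C, hC⟩ := (isCompact_frontier hb).exists_bound_of_continuousOn hφ
  exact IntegrableOn.of_bound (measure_frontier_lt_top hD hb hN)
    (hφ.aestronglyMeasurable isClosed_frontier.measurableSet) C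
    ((ae_restrict_iff' isClosed_frontier.measurableSet).2 (Eventually.of_forall hC))

variable [CompleteSpace W]

variable (W) in
theorem exists_isOpen_subset_norm_integral_divergence_sub_le (hD : IsOpen D)
    (hN : IsOutwardNormalField D N) (hΩ : IsOpen Ω) (hDΩ : closure D ⊆ Ω) (hx : x ∈ closure D)
    {η : ℝ} (hη : 0 < η) :
    ∃ B ⊆ Ω, IsOpen B ∧ x ∈ B ∧
      ∀ F : EuclideanSpace ℝ (Fin n) → Fin n → W, Differentiable ℝ F → HasCompactSupport F →
        tsupport F ⊆ B → Continuous (divergence F) →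
        ‖(∫ x in D, divergence F x) - ∫ x in frontier D, contract (N x) (F x) ∂μHE[n - 1]‖ ≤
          η * ∫ x in frontier D, ‖contract (N x) (F x)‖ ∂μHE[n - 1] := by
  by_cases hxD : x ∈ D
  · refine ⟨D, subset_closure.trans hDΩ, hD, hxD, fun F hF hc hFD hdiv => ?_⟩
    have hbdy (y) (hy : y ∈ frontier D) : F y = 0 :=
      image_eq_zero_of_notMem_tsupport fun h => (hD.frontier_eq ▸ hy).2 (hFD h)
    have hvol : ∫ y in D, divergence F y = 0 := by
      rw [setIntegral_eq_integral_of_forall_compl_eq_zero fun y hy =>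
        divergence_of_notMem_tsupport fun h => hy (hFD h)]
      exact integral_divergence_eq_zero hF hc (hdiv.integrable_of_hasCompactSupport
        (hc.of_isClosed_subset (isClosed_tsupport _) tsupport_divergence_subset))
    have hflux : ∫ y in frontier D, contract (N y) (F y) ∂μHE[n - 1] = 0 :=
      setIntegral_eq_zero_of_forall_eq_zero fun y hy => by simp [contract, hbdy y hy]
    rw [hvol, hflux, sub_zero, norm_zero]
    exact mul_nonneg hη.le (integral_nonneg fun _ => norm_nonneg _)
  · have hxf : x ∈ frontier D := hD.frontier_eq.symm ▸ ⟨hx, hxD⟩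
    obtain ⟨B, hB, hxB, -, hest⟩ := exists_isOpen_norm_integral_divergence_sub_le W hD hN hxf hη
    exact ⟨B ∩ Ω, inter_subset_right, hB.inter hΩ, ⟨hxB, hDΩ hx⟩, fun F hF hc hFB =>
      hest F hF hc (hFB.trans inter_subset_left)⟩

variable {F : EuclideanSpace ℝ (Fin n) → Fin n → W}

theorem norm_integral_divergence_sub_le (hD : IsOpen D) (hb : Bornology.IsBounded D)
    (hN : IsOutwardNormalField D N) (hΩ : IsOpen Ω) (hDΩ : closure D ⊆ Ω)
    (hF : DifferentiableOn ℝ F Ω) (hdiv : ContinuousOn (divergence F) Ω) {η : ℝ} (hη : 0 < η) :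
    ‖(∫ x in D, divergence F x) - ∫ x in frontier D, contract (N x) (F x) ∂μHE[n - 1]‖ ≤
      η * ∫ x in frontier D, ‖contract (N x) (F x)‖ ∂μHE[n - 1] := by
  choose! B hBΩ hBo hxB hest using fun x (hx : x ∈ closure D) =>
    exists_isOpen_subset_norm_integral_divergence_sub_le W hD hN hΩ hDΩ hx hη
  obtain ⟨t, χ, htD, hχ, hχ0, hχc, hχB, hχ1⟩ :=
    exists_finite_partitionOfUnity hb.isCompact_closure hBo hxB
  have hχΩ (i : t) : tsupport (χ i) ⊆ Ω := (hχB i).trans (hBΩ i (htD i.2))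
  have hG (i : t) : Differentiable ℝ fun x => χ i x • F x :=
    differentiable_smul_of_tsupport_subset hΩ ((hχ i).differentiable (by simp)) (hχΩ i) hF
  have hGdiv (i : t) : Continuous (divergence fun x => χ i x • F x) :=
    continuous_divergence_smul hΩ ((hχ i).of_le (by simp)) (hχΩ i) hF hdiv
  have hGsupp (i : t) : tsupport (fun x => χ i x • F x) ⊆ tsupport (χ i) :=
    tsupport_smul_subset_left (χ i) F
  have hGc (i : t) : HasCompactSupport fun x => χ i x • F x :=
    (hχc i).of_isClosed_subset (isClosed_tsupport _) (hGsupp i)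
  have hflux : ContinuousOn (fun x => contract (N x) (F x)) (frontier D) :=
    continuousOn_contract hN.continuousOn (hF.continuousOn.mono (frontier_subset_closure.trans hDΩ))
  have hfluxi (i : t) : ContinuousOn (fun x => χ i x • contract (N x) (F x)) (frontier D) :=
    (hχ i).continuous.continuousOn.smul hflux
  have hχ1' (x) (hx : x ∈ frontier D) : ∑ i, χ i x = 1 := hχ1 x (frontier_subset_closure hx)
  have hvol : ∫ x in D, divergence F x = ∑ i, ∫ x in D, divergence (fun y => χ i y • F y) x := by
    rw [← integral_finsetSum _ fun i _ => ((hGdiv i).integrable_of_hasCompactSupport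
      ((hGc i).of_isClosed_subset (isClosed_tsupport _) tsupport_divergence_subset)).integrableOn]
    refine setIntegral_congr_fun hD.measurableSet fun x hx => ?_
    refine (sum_divergence_smul ?_ fun i => hG i x).symm
    filter_upwards [hD.mem_nhds hx] with y hy using hχ1 y (subset_closure hy)
  rw [hvol, setIntegral_eq_sum_setIntegral_smul isClosed_frontier.measurableSet hχ1' fun i =>
      integrableOn_frontier hD hb hN (hfluxi i),
    setIntegral_eq_sum_setIntegral_smul isClosed_frontier.measurableSet hχ1' fun i =>
      integrableOn_frontier hD hb hN ((hχ i).continuous.continuousOn.smul hflux.norm),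
    ← Finset.sum_sub_distrib, Finset.mul_sum]
  refine norm_sum_le_of_le _ fun i _ => ?_
  simpa only [contract_smul_right, norm_smul, Real.norm_of_nonneg (hχ0 i _), smul_eq_mul] using
    hest i (htD i.2) _ (hG i) (hGc i) ((hGsupp i).trans (hχB i)) (hGdiv i)

theorem integral_divergence_eq_integral_contract (hD : IsOpen D) (hb : Bornology.IsBounded D)
    (hN : IsOutwardNormalField D N) (hΩ : IsOpen Ω) (hDΩ : closure D ⊆ Ω)
    (hF : DifferentiableOn ℝ F Ω) (hdiv : ContinuousOn (divergence F) Ω) :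
    ∫ x in D, divergence F x = ∫ x in frontier D, contract (N x) (F x) ∂μHE[n - 1] := by
  set I := ∫ x in frontier D, ‖contract (N x) (F x)‖ ∂μHE[n - 1]
  have hlim : Tendsto (fun η : ℝ => η * I) (𝓝[>] 0) (𝓝 0) := by
    simpa using ((continuous_mul_const I).tendsto 0).mono_left nhdsWithin_le_nhds
  rw [← sub_eq_zero, ← norm_le_zero_iff]
  exact ge_of_tendsto hlim (eventually_nhdsWithin_of_forall fun η hη =>
    norm_integral_divergence_sub_le hD hb hN hΩ hDΩ hF hdiv hη)

end Global
/-! ### The Cauchy kernel -/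

section Ball

variable {n : ℕ}

theorem isOutwardNormalField_ball {E : Type*} [NormedAddCommGroup E] [InnerProductSpace ℝ E]
    [CompleteSpace E] : IsOutwardNormalField (Metric.ball (0 : E) 1) id := by
  have hgrad (y : E) : gradient (fun y : E => ‖y‖ ^ 2 - 1) y = (2 : ℝ) • y := by
    refine HasGradientAt.gradient (hasGradientAt_iff_hasFDerivAt.2 ?_)
    refine ((hasFDerivAt_id y).norm_sq.sub_const (1 : ℝ)).congr_fderiv ?_
    ext w
    simp
  have hρ : IsC1DefiningFunction (Metric.ball (0 : E) 1) {0}ᶜ fun y => ‖y‖ ^ 2 - 1 := by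
    refine ⟨isOpen_compl_singleton, ((contDiff_norm_sq ℝ).sub contDiff_const).contDiffOn,
      fun y hy => ?_, fun y _ => ?_⟩
    · rw [hgrad]
      exact smul_ne_zero two_ne_zero hy
    · rw [mem_ball_zero_iff, sub_neg, sq_lt_one_iff₀ (norm_nonneg y)]
  have hnorm (x : E) (hx : x ∈ frontier (Metric.ball (0 : E) 1)) : ‖x‖ = 1 :=
    mem_sphere_zero_iff_norm.1 (Metric.frontier_ball_subset_sphere hx)
  refine fun x hx => ⟨_, _, ?_, hρ, fun y hy => ?_⟩
  · exact norm_ne_zero_iff.1 ((hnorm x hx).symm ▸ one_ne_zero)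
  · rw [hgrad, norm_smul, hnorm y hy.1, smul_smul]
    simp

theorem contract_self (v : EuclideanSpace ℝ (Fin n)) : contract v v = ‖v‖ ^ 2 := by
  simp only [contract, EuclideanSpace.real_norm_sq_eq, smul_eq_mul, ← sq]

theorem measureReal_sphere [NeZero n] :
    μHE[n - 1].real (Metric.sphere (0 : EuclideanSpace ℝ (Fin n)) 1) =
      n * volume.real (Metric.ball (0 : EuclideanSpace ℝ (Fin n)) 1) := by
  have hdiv (x : EuclideanSpace ℝ (Fin n)) :
      divergence (fun x : EuclideanSpace ℝ (Fin n) => x.ofLp) x = n := by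
    have hderiv : fderiv ℝ (fun x : EuclideanSpace ℝ (Fin n) => x.ofLp) x =
        EuclideanSpace.equiv (Fin n) ℝ := (EuclideanSpace.equiv (Fin n) ℝ).fderiv
    simp [divergence, hderiv]
  have hgauss := integral_divergence_eq_integral_contract Metric.isOpen_ball Metric.isBounded_ball
    isOutwardNormalField_ball isOpen_univ (subset_univ _)
    (F := fun x : EuclideanSpace ℝ (Fin n) => x.ofLp)
    (EuclideanSpace.equiv (Fin n) ℝ).differentiable.differentiableOn
    (continuousOn_const.congr fun x _ => hdiv x)
  have hflux (x : EuclideanSpace ℝ (Fin n)) (hx : x ∈ Metric.sphere 0 1) :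
      contract (id x) x.ofLp = 1 := by
    rw [id, contract_self, mem_sphere_zero_iff_norm.1 hx, one_pow]
  rw [frontier_ball _ one_ne_zero, setIntegral_congr_fun Metric.isClosed_sphere.measurableSet hflux]
    at hgauss
  simpa [hdiv, mul_comm] using hgauss.symm

theorem measureReal_sphere_pos [NeZero n] :
    0 < μHE[n - 1].real (Metric.sphere (0 : EuclideanSpace ℝ (Fin n)) 1) := by
  rw [measureReal_sphere]
  have hvol : 0 < volume.real (Metric.ball (0 : EuclideanSpace ℝ (Fin n)) 1) :=
    ENNReal.toReal_pos (Metric.measure_ball_pos volume 0 one_pos).ne' measure_ball_lt_top.ne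
  have := NeZero.pos n
  positivity

end Ball

theorem slabKernel_nonneg (t : ℝ) : 0 ≤ slabKernel t :=
  Real.smoothTransition.monotone.deriv_nonneg

/-- A `C¹` function of the squared radius, equal to `|v|⁻ⁿ` for `|v| ≥ 1` and vanishing near the
origin: the Cauchy kernel with its singularity cut off. -/
def cauchyProfile (n : ℕ) (s : ℝ) : ℝ := slabCutoff (1 - 2 * s) * s ^ (-(n / 2) : ℝ)

section Profile

variable (n : ℕ)

theorem cauchyProfile_of_one_le {s : ℝ} (hs : 1 ≤ s) : cauchyProfile n s = s ^ (-(n / 2) : ℝ) := by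
  rw [cauchyProfile, slabCutoff_of_le_neg_one (by linarith), one_mul]

theorem hasDerivAt_cauchyProfile {s : ℝ} (hs : s ≠ 0) :
    HasDerivAt (cauchyProfile n) (2 * slabKernel (1 - 2 * s) * s ^ (-(n / 2) : ℝ) +
      slabCutoff (1 - 2 * s) * (-(n / 2) * s ^ (-(n / 2) - 1 : ℝ))) s := by
  have hcut : HasDerivAt (fun s : ℝ => slabCutoff (1 - 2 * s)) (2 * slabKernel (1 - 2 * s)) s := by
    have hlin : HasDerivAt (fun s : ℝ => 1 - 2 * s) (-2) s := by
      simpa using ((hasDerivAt_id s).const_mul 2).const_sub 1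
    exact ((hasDerivAt_slabCutoff _).comp s hlin).congr_deriv (by ring)
  exact hcut.mul (Real.hasDerivAt_rpow_const (Or.inl hs))

theorem contDiff_cauchyProfile : ContDiff ℝ 1 (cauchyProfile n) := by
  refine contDiff_iff_contDiffAt.2 fun s => ?_
  rcases eq_or_ne s 0 with rfl | hs
  · refine (contDiffAt_const (c := (0 : ℝ))).congr_of_eventuallyEq ?_
    filter_upwards [gt_mem_nhds (show (0 : ℝ) < 1 / 2 by norm_num)] with s hs
    rw [cauchyProfile, slabCutoff_of_nonneg (by linarith), zero_mul]
  · exact (contDiff_slabCutoff.contDiffAt.comp s (by fun_prop)).mul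
      (Real.contDiffAt_rpow_const_of_ne hs)

/-- The divergence of the truncated radial field `k(|v|²) v`, where `k` is `cauchyProfile n`, as a
function of `s = |v|²`. -/
def cauchyBump (s : ℝ) : ℝ := n * cauchyProfile n s + 2 * s * deriv (cauchyProfile n) s

theorem cauchyBump_eq {s : ℝ} :
    cauchyBump n s = 4 * s * slabKernel (1 - 2 * s) * s ^ (-(n / 2) : ℝ) := by
  rcases eq_or_ne s 0 with rfl | hs
  · simp [cauchyBump, cauchyProfile, slabCutoff_of_nonneg]
  · rw [cauchyBump, (hasDerivAt_cauchyProfile n hs).deriv, cauchyProfile, Real.rpow_sub_one hs]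
    field_simp
    ring

theorem continuous_cauchyBump : Continuous (cauchyBump n) := by
  have hprofile := (contDiff_cauchyProfile n).continuous
  have hderiv := (contDiff_cauchyProfile n).continuous_deriv le_rfl
  unfold cauchyBump
  fun_prop

theorem cauchyBump_nonneg {s : ℝ} (hs : 0 ≤ s) : 0 ≤ cauchyBump n s := by
  have := slabKernel_nonneg (1 - 2 * s)
  rw [cauchyBump_eq]
  positivity

theorem cauchyBump_of_one_le {s : ℝ} (hs : 1 ≤ s) : cauchyBump n s = 0 := by
  have hclosed : IsClosed {s | cauchyBump n s = 0} :=
    isClosed_eq (continuous_cauchyBump n) continuous_const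
  have hIoi : Ioi 1 ⊆ {s | cauchyBump n s = 0} := fun s (hs : 1 < s) => by
    rw [mem_ofPred_eq, cauchyBump_eq, slabKernel_of_notMem_Icc fun h => by linarith [h.1], mul_zero,
      zero_mul]
  exact closure_minimal hIoi hclosed (closure_Ioi (1 : ℝ) ▸ hs)

end Profile
section Cauchy

variable {n : ℕ} {W : Type*} [NormedAddCommGroup W] [NormedSpace ℝ W]
  {P : Fin n → EuclideanSpace ℝ (Fin n) →L[ℝ] W →L[ℝ] W} {c : ℝ}
  {g : EuclideanSpace ℝ (Fin n) → W} {D Ω : Set (EuclideanSpace ℝ (Fin n))}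
  {X Y : EuclideanSpace ℝ (Fin n)}

/-- `∑ v_α P_α(v) = c |v|²`: the field `v ↦ (P_α(v) w)_α` has the same outward flux density in all
directions. For such `P`, the fields `|v|⁻ⁿ P_α(v)` are Cauchy kernels for the system
`∑ P_α(·) ∂_α g = 0`. -/
def HasIsotropicFlux (P : Fin n → EuclideanSpace ℝ (Fin n) →L[ℝ] W →L[ℝ] W) (c : ℝ) : Prop :=
  ∀ v w, contract v (fun α => P α v w) = (c * ‖v‖ ^ 2) • w

/-- `g` solves on `Ω` the first order system `∑ P_α(v) ∂_α g = 0` for all `v`. -/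
def IsSolutionOn (P : Fin n → EuclideanSpace ℝ (Fin n) →L[ℝ] W →L[ℝ] W)
    (g : EuclideanSpace ℝ (Fin n) → W) (Ω : Set (EuclideanSpace ℝ (Fin n))) : Prop :=
  ∀ Y ∈ Ω, ∀ v, ∑ α, P α v (fderiv ℝ g Y (EuclideanSpace.single α 1)) = 0

theorem HasIsotropicFlux.apply_single (hP : HasIsotropicFlux P c) (α : Fin n) (w : W) :
    P α (EuclideanSpace.single α 1) w = c • w := by
  have h := hP (EuclideanSpace.single α 1) w
  rw [contract, Finset.sum_eq_single α (fun β _ hβ => by simp [hβ]) (by simp)] at h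
  simpa using h

theorem differentiableAt_clm_sub_apply (hg : DifferentiableAt ℝ g Y) :
    DifferentiableAt ℝ (fun Y α => P α (Y - X) (g Y)) Y :=
  differentiableAt_pi.2 fun α => ((P α).differentiableAt.comp Y (by fun_prop)).clm_apply hg

theorem divergence_clm_sub_apply (hP : HasIsotropicFlux P c) (hg : DifferentiableAt ℝ g Y)
    (hg0 : ∀ v, ∑ α, P α v (fderiv ℝ g Y (EuclideanSpace.single α 1)) = 0) :
    divergence (fun Y α => P α (Y - X) (g Y)) Y = (n * c) • g Y := by
  have hcoord (α : Fin n) : HasFDerivAt (fun Y => P α (Y - X) (g Y))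
      ((P α (Y - X)).comp (fderiv ℝ g Y) + (P α).flip (g Y)) Y :=
    ((P α).hasFDerivAt.comp Y ((hasFDerivAt_id Y).sub_const X)).clm_apply hg.hasFDerivAt
  have hderiv : HasFDerivAt (fun Y α => P α (Y - X) (g Y)) _ Y := hasFDerivAt_pi.2 hcoord
  rw [divergence, hderiv.fderiv]
  simp [-map_sub, Finset.sum_add_distrib, hg0 (Y - X), hP.apply_single,
    ← Nat.cast_smul_eq_nsmul ℝ, smul_smul]

theorem divergence_radial_smul {h : ℝ → ℝ} (hh : DifferentiableAt ℝ h (‖Y - X‖ ^ 2))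
    (hP : HasIsotropicFlux P c) (hg : DifferentiableAt ℝ g Y)
    (hg0 : ∀ v, ∑ α, P α v (fderiv ℝ g Y (EuclideanSpace.single α 1)) = 0) :
    divergence (fun Y => h (‖Y - X‖ ^ 2) • fun α => P α (Y - X) (g Y)) Y =
      (c * (n * h (‖Y - X‖ ^ 2) + 2 * ‖Y - X‖ ^ 2 * deriv h (‖Y - X‖ ^ 2))) • g Y := by
  have hradial : HasGradientAt (fun Y => h (‖Y - X‖ ^ 2))
      ((2 * deriv h (‖Y - X‖ ^ 2)) • (Y - X)) Y := by
    refine hasGradientAt_iff_hasFDerivAt.2 ((hh.hasDerivAt.comp_hasFDerivAt Y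
      ((hasFDerivAt_id Y).sub_const X).norm_sq).congr_fderiv ?_)
    ext w
    simp
    ring
  rw [divergence_smul hradial.differentiableAt (differentiableAt_clm_sub_apply hg),
    hradial.gradient, contract_smul_left, hP, divergence_clm_sub_apply hP hg hg0]
  module

/-- The Cauchy kernel applied to `g`, with the singularity at `X` cut off in the ball of radius
`1 / t`. -/
def truncatedFlux (P : Fin n → EuclideanSpace ℝ (Fin n) →L[ℝ] W →L[ℝ] W)
    (g : EuclideanSpace ℝ (Fin n) → W) (X : EuclideanSpace ℝ (Fin n)) (t : ℝ)
    (Y : EuclideanSpace ℝ (Fin n)) : Fin n → W :=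
  (t ^ n * cauchyProfile n (t ^ 2 * ‖Y - X‖ ^ 2)) • fun α => P α (Y - X) (g Y)

theorem truncatedFlux_of_one_le {t : ℝ} (ht : 0 < t) (hY : 1 ≤ t * ‖Y - X‖) :
    truncatedFlux P g X t Y = fun α => (‖Y - X‖ ^ n)⁻¹ • P α (Y - X) (g Y) := by
  have hpow {a : ℝ} (ha : 0 ≤ a) : (a ^ 2) ^ (-(n / 2) : ℝ) = (a ^ n)⁻¹ := by
    rw [← Real.rpow_natCast a 2, ← Real.rpow_mul ha, ← Real.rpow_natCast a n, ← Real.rpow_neg ha]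
    congr 1
    push_cast
    ring
  have hscale : t ^ n * cauchyProfile n (t ^ 2 * ‖Y - X‖ ^ 2) = (‖Y - X‖ ^ n)⁻¹ := by
    rw [← mul_pow, cauchyProfile_of_one_le n (one_le_pow₀ hY), hpow (by positivity), mul_pow,
      mul_inv, mul_inv_cancel_left₀ (by positivity)]
  rw [truncatedFlux, hscale]
  rfl

theorem differentiable_scaled_cauchyProfile (n : ℕ) (t : ℝ) :
    Differentiable ℝ fun s => t ^ n * cauchyProfile n (t ^ 2 * s) := by
  have := (contDiff_cauchyProfile n).differentiable one_ne_zero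
  fun_prop

theorem differentiableOn_truncatedFlux (hΩ : IsOpen Ω) (hg : DifferentiableOn ℝ g Ω) (t : ℝ) :
    DifferentiableOn ℝ (truncatedFlux P g X t) Ω := by
  intro Y hY
  have hradial : DifferentiableAt ℝ
      (fun Y => t ^ n * cauchyProfile n (t ^ 2 * ‖Y - X‖ ^ 2)) Y :=
    (differentiable_scaled_cauchyProfile n t _).comp Y
      ((differentiableAt_id.sub_const X).norm_sq ℝ)
  exact (hradial.fun_smul (differentiableAt_clm_sub_apply
    (hg.differentiableAt (hΩ.mem_nhds hY)))).differentiableWithinAt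

theorem divergence_truncatedFlux (hP : HasIsotropicFlux P c) (hΩ : IsOpen Ω)
    (hg : DifferentiableOn ℝ g Ω) (hg0 : IsSolutionOn P g Ω) (hY : Y ∈ Ω) (t : ℝ) :
    divergence (truncatedFlux P g X t) Y =
      (c * (t ^ n * cauchyBump n (t ^ 2 * ‖Y - X‖ ^ 2))) • g Y := by
  have hderiv (s : ℝ) : deriv (fun s => t ^ n * cauchyProfile n (t ^ 2 * s)) s =
      t ^ n * (t ^ 2 * deriv (cauchyProfile n) (t ^ 2 * s)) := by
    rw [deriv_const_mul_field, deriv_comp_mul_left, smul_eq_mul]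
  have hdiv := divergence_radial_smul (X := X) (differentiable_scaled_cauchyProfile n t _) hP
    (hg.differentiableAt (hΩ.mem_nhds hY)) (hg0 Y hY)
  refine hdiv.trans ?_
  rw [hderiv, cauchyBump]
  congr 1
  ring

theorem continuousOn_cauchyKernel (hD : IsOpen D)
    {N : EuclideanSpace ℝ (Fin n) → EuclideanSpace ℝ (Fin n)} (hN : IsOutwardNormalField D N)
    (hg : ContinuousOn g (frontier D)) (hX : X ∈ D) :
    ContinuousOn (fun Y => contract (N Y) fun α => (‖Y - X‖ ^ n)⁻¹ • P α (Y - X) (g Y))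
      (frontier D) := by
  have hXY (Y) (hY : Y ∈ frontier D) : ‖Y - X‖ ^ n ≠ 0 := by
    refine pow_ne_zero n (norm_ne_zero_iff.2 (sub_ne_zero.2 ?_))
    rintro rfl
    exact (hD.frontier_eq ▸ hY).2 hX
  refine continuousOn_contract hN.continuousOn (continuousOn_pi.2 fun α => ?_)
  exact (ContinuousOn.inv₀ (by fun_prop) hXY).smul
    (((P α).continuous.comp (by fun_prop)).continuousOn.clm_apply hg)

variable [CompleteSpace W]

theorem integral_truncatedFlux (hD : IsOpen D) (hb : Bornology.IsBounded D)
    {N : EuclideanSpace ℝ (Fin n) → EuclideanSpace ℝ (Fin n)} (hN : IsOutwardNormalField D N)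
    (hΩ : IsOpen Ω) (hDΩ : closure D ⊆ Ω) (hP : HasIsotropicFlux P c)
    (hg : DifferentiableOn ℝ g Ω) (hg0 : IsSolutionOn P g Ω) (t : ℝ) :
    ∫ Y in frontier D, contract (N Y) (truncatedFlux P g X t Y) ∂μHE[n - 1] =
      c • ∫ Y in D, (t ^ n * cauchyBump n (t ^ 2 * ‖Y - X‖ ^ 2)) • g Y := by
  have hdiv (Y) (hY : Y ∈ Ω) := divergence_truncatedFlux (X := X) hP hΩ hg hg0 hY t
  have hbump := continuous_cauchyBump n
  rw [← integral_divergence_eq_integral_contract hD hb hN hΩ hDΩ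
    (differentiableOn_truncatedFlux hΩ hg t) (ContinuousOn.congr ?_ hdiv), ← integral_smul]
  · simp only [smul_smul]
    exact setIntegral_congr_fun hD.measurableSet fun Y hY => hdiv Y (hDΩ (subset_closure hY))
  · exact (Continuous.continuousOn (by fun_prop)).smul hg.continuousOn

theorem integral_cauchyBump [NeZero n] :
    ∫ v : EuclideanSpace ℝ (Fin n), cauchyBump n (‖v‖ ^ 2) =
      μHE[n - 1].real (Metric.sphere (0 : EuclideanSpace ℝ (Fin n)) 1) := by
  set B := Metric.ball (0 : EuclideanSpace ℝ (Fin n)) 1 with hB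
  let P (α : Fin n) : EuclideanSpace ℝ (Fin n) →L[ℝ] ℝ →L[ℝ] ℝ :=
    (ContinuousLinearMap.lsmul ℝ ℝ).comp (EuclideanSpace.proj α)
  have hP : HasIsotropicFlux P 1 := fun v w => by
    change ∑ α, v α • v α • w = _
    simp only [smul_smul, ← Finset.sum_smul, ← sq, EuclideanSpace.real_norm_sq_eq, one_mul]
  have hflux := integral_truncatedFlux (g := fun _ => (1 : ℝ)) (X := 0) Metric.isOpen_ball
    Metric.isBounded_ball isOutwardNormalField_ball isOpen_univ (Set.subset_univ _) hP
    (differentiableOn_const 1) (fun Y _ v => by simp) 1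
  have hbump (v) (hv : v ∉ B) : cauchyBump n (‖v‖ ^ 2) = 0 :=
    cauchyBump_of_one_le n (one_le_pow₀ (by simpa [hB] using hv))
  have hsphere (v) (hv : v ∈ Metric.sphere (0 : EuclideanSpace ℝ (Fin n)) 1) :
      contract v (truncatedFlux P (fun _ => (1 : ℝ)) 0 1 v) = 1 := by
    have hnorm : ‖v‖ = 1 := mem_sphere_zero_iff_norm.1 hv
    rw [truncatedFlux_of_one_le one_pos (by simp [hnorm])]
    simpa [hnorm] using hP v 1
  rw [← setIntegral_eq_integral_of_forall_compl_eq_zero hbump]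
  simp only [one_pow, one_mul, sub_zero, smul_eq_mul, mul_one] at hflux
  rw [← hflux, frontier_ball _ one_ne_zero]
  refine (setIntegral_congr_fun Metric.isClosed_sphere.measurableSet hsphere).trans ?_
  simp

theorem tendsto_integral_cauchyBump_smul [NeZero n] (hg : Integrable g) (hgX : ContinuousAt g X) :
    Tendsto (fun t : ℝ => ∫ Y, (t ^ n * cauchyBump n (t ^ 2 * ‖Y - X‖ ^ 2)) • g Y) atTop
      (𝓝 (μHE[n - 1].real (Metric.sphere (0 : EuclideanSpace ℝ (Fin n)) 1) • g X)) := by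
  set a := μHE[n - 1].real (Metric.sphere (0 : EuclideanSpace ℝ (Fin n)) 1) with ha
  have ha0 : 0 < a := measureReal_sphere_pos
  let φ (v : EuclideanSpace ℝ (Fin n)) : ℝ := a⁻¹ * cauchyBump n (‖v‖ ^ 2)
  have hφ0 (v) : 0 ≤ φ v := mul_nonneg (by positivity) (cauchyBump_nonneg n (by positivity))
  have hφ1 : ∫ v, φ v = 1 := by
    rw [integral_const_mul, integral_cauchyBump, ← ha, inv_mul_cancel₀ ha0.ne']
  have hφlim : Tendsto (fun v => ‖v‖ ^ Module.finrank ℝ (EuclideanSpace ℝ (Fin n)) * φ v)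
      (Bornology.cobounded _) (𝓝 0) := by
    refine tendsto_const_nhds.congr' ?_
    filter_upwards [tendsto_norm_cobounded_atTop.eventually_ge_atTop 1] with v hv
    rw [show φ v = 0 by simp [φ, cauchyBump_of_one_le n (one_le_pow₀ hv)], mul_zero]
  have hpeak := (tendsto_integral_comp_smul_smul_of_integrable' hφ0 hφ1 hφlim hg hgX).const_smul a
  refine hpeak.congr fun t => ?_
  rw [← integral_smul]
  congr 1
  ext Y
  simp only [φ, finrank_euclideanSpace_fin, norm_smul, norm_sub_rev X Y, Real.norm_eq_abs, mul_pow,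
    sq_abs, smul_smul]
  rw [mul_left_comm, mul_inv_cancel_left₀ ha0.ne']

theorem integral_contract_cauchyKernel [NeZero n] (hD : IsOpen D) (hb : Bornology.IsBounded D)
    {N : EuclideanSpace ℝ (Fin n) → EuclideanSpace ℝ (Fin n)} (hN : IsOutwardNormalField D N)
    (hΩ : IsOpen Ω) (hDΩ : closure D ⊆ Ω) (hP : HasIsotropicFlux P c)
    (hg : DifferentiableOn ℝ g Ω) (hg0 : IsSolutionOn P g Ω) (hX : X ∈ D) :
    ∫ Y in frontier D, contract (N Y) (fun α => (‖Y - X‖ ^ n)⁻¹ • P α (Y - X) (g Y)) ∂μHE[n - 1] =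
      (c * μHE[n - 1].real (Metric.sphere (0 : EuclideanSpace ℝ (Fin n)) 1)) • g X := by
  obtain ⟨r, hr, hball⟩ := Metric.isOpen_iff.1 hD X hX
  have hflux : ∀ᶠ t : ℝ in atTop,
      ∫ Y in frontier D, contract (N Y) (truncatedFlux P g X t Y) ∂μHE[n - 1] =
        ∫ Y in frontier D, contract (N Y) (fun α => (‖Y - X‖ ^ n)⁻¹ • P α (Y - X) (g Y))
          ∂μHE[n - 1] := by
    filter_upwards [eventually_ge_atTop r⁻¹] with t ht
    refine setIntegral_congr_fun isClosed_frontier.measurableSet fun Y hY => ?_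
    have hrY : r ≤ ‖Y - X‖ := not_lt.1 fun h =>
      (hD.frontier_eq ▸ hY).2 (hball (mem_ball_iff_norm.2 h))
    have ht0 : 0 < t := (inv_pos.2 hr).trans_le ht
    have htY : 1 ≤ t * ‖Y - X‖ :=
      (inv_mul_cancel₀ hr.ne').symm.trans_le (by gcongr)
    simp only [truncatedFlux_of_one_le ht0 htY]
  have hgX : ContinuousAt (D.indicator g) X :=
    (hg.continuousOn.continuousAt (hΩ.mem_nhds (hDΩ (subset_closure hX)))).congr
      (eventuallyEq_of_mem (hD.mem_nhds hX) fun Y hY => (indicator_of_mem hY g).symm)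
  have hgD : IntegrableOn g D :=
    ((hg.continuousOn.mono hDΩ).integrableOn_compact hb.isCompact_closure).mono_set subset_closure
  have hlim := (tendsto_integral_cauchyBump_smul (hgD.integrable_indicator hD.measurableSet)
    hgX).const_smul c
  simp only [← indicator_smul, integral_indicator hD.measurableSet,
    indicator_of_mem hX, smul_smul] at hlim
  refine tendsto_nhds_unique (tendsto_const_nhds.congr' ?_) hlim
  filter_upwards [hflux] with t ht
  rw [← ht, integral_truncatedFlux hD hb hN hΩ hDΩ hP hg hg0 t]

end Cauchy
/-! ### Complex coordinates and densities of forms -/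

section Coordinates

variable {p : ℕ}

/-- The position of the real coordinate `x_k` (second component `0`) or `y_k` (second
component `1`). -/
def coordEquiv (p : ℕ) : Fin (2 * p) × Fin 2 ≃ Fin (4 * p) :=
  finProdFinEquiv.trans (finCongr (by omega))

/-- The position of the first (second component `0`) or second (second component `1`) index of the
`j`-th pair of complex coordinates. -/
def pairEquiv (p : ℕ) : Fin p × Fin 2 ≃ Fin (2 * p) :=
  finProdFinEquiv.trans (finCongr (mul_comm p 2))

theorem coordEquiv_zero (k : Fin (2 * p)) : coordEquiv p (k, 0) = xi k := by
  ext
  simp [coordEquiv, xi]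

theorem coordEquiv_one (k : Fin (2 * p)) : coordEquiv p (k, 1) = yi k := by
  ext
  simp [coordEquiv, yi, add_comm]

theorem pairEquiv_zero (j : Fin p) : pairEquiv p (j, 0) = fst j := by
  ext
  simp [pairEquiv, fst]

theorem pairEquiv_one (j : Fin p) : pairEquiv p (j, 1) = snd j := by
  ext
  simp [pairEquiv, snd, add_comm]

theorem sum_coord {M : Type*} [AddCommMonoid M] (φ : Fin (4 * p) → M) :
    ∑ α, φ α = ∑ k, (φ (xi k) + φ (yi k)) := by
  simp only [← (coordEquiv p).sum_comp φ, Fintype.sum_prod_type, Fin.sum_univ_two, coordEquiv_zero,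
    coordEquiv_one]

theorem sum_pair {M : Type*} [AddCommMonoid M] (φ : Fin (2 * p) → M) :
    ∑ k, φ k = ∑ j, (φ (fst j) + φ (snd j)) := by
  simp only [← (pairEquiv p).sum_comp φ, Fintype.sum_prod_type, Fin.sum_univ_two, pairEquiv_zero,
    pairEquiv_one]

theorem xi_inj {k l : Fin (2 * p)} : (xi k : Fin (4 * p)) = xi l ↔ k = l := by
  simp [xi, Fin.ext_iff]

theorem yi_inj {k l : Fin (2 * p)} : (yi k : Fin (4 * p)) = yi l ↔ k = l := by
  simp [yi, Fin.ext_iff]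

theorem xi_ne_yi (k l : Fin (2 * p)) : (xi k : Fin (4 * p)) ≠ yi l := by
  simp only [xi, yi, ne_eq, Fin.mk.injEq]
  omega

theorem zc_apply (k : Fin (2 * p)) (v : V p) :
    zc k v = (v (xi k) : ℂ) + Complex.I * (v (yi k) : ℂ) := rfl

theorem zcc_apply (k : Fin (2 * p)) (v : V p) :
    zcc k v = (v (xi k) : ℂ) - Complex.I * (v (yi k) : ℂ) := rfl

theorem conj_zc (k : Fin (2 * p)) (v : V p) : starRingEnd ℂ (zc k v) = zcc k v := by
  simp [zc_apply, zcc_apply, sub_eq_add_neg]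

theorem conj_zcc (k : Fin (2 * p)) (v : V p) : starRingEnd ℂ (zcc k v) = zc k v := by
  rw [← conj_zc, Complex.conj_conj]

theorem zc_single_xi (k l : Fin (2 * p)) :
    zc k (EuclideanSpace.single (xi l) (1 : ℝ)) = if k = l then 1 else 0 := by
  simp [zc_apply, xi_inj, (xi_ne_yi l k).symm, apply_ite]

theorem zc_single_yi (k l : Fin (2 * p)) :
    zc k (EuclideanSpace.single (yi l) (1 : ℝ)) = if k = l then Complex.I else 0 := by
  simp only [zc_apply, PiLp.single_apply, yi_inj, xi_ne_yi k l, if_false]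
  split_ifs <;> simp

theorem zcc_single_xi (k l : Fin (2 * p)) :
    zcc k (EuclideanSpace.single (xi l) (1 : ℝ)) = if k = l then 1 else 0 := by
  simp [← conj_zc, zc_single_xi, apply_ite]

theorem zcc_single_yi (k l : Fin (2 * p)) :
    zcc k (EuclideanSpace.single (yi l) (1 : ℝ)) = if k = l then -Complex.I else 0 := by
  simp [← conj_zc, zc_single_yi, apply_ite]

theorem zc_mul_zcc (k : Fin (2 * p)) (v : V p) :
    zc k v * zcc k v = ((v (xi k) ^ 2 + v (yi k) ^ 2 : ℝ) : ℂ) := by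
  rw [← conj_zc, Complex.mul_conj, zc_apply, mul_comm Complex.I, Complex.normSq_add_mul_I]

theorem sum_zc_mul_zcc (v : V p) : ∑ k, zc k v * zcc k v = ((‖v‖ ^ 2 : ℝ) : ℂ) := by
  simp only [EuclideanSpace.real_norm_sq_eq, sum_coord, zc_mul_zcc, Complex.ofReal_sum]

theorem sum_smul_map_single {W : Type*} [AddCommGroup W] [Module ℝ W] {n : ℕ}
    (L : EuclideanSpace ℝ (Fin n) →ₗ[ℝ] W) (u : EuclideanSpace ℝ (Fin n)) :
    ∑ α, u α • L (EuclideanSpace.single α 1) = L u := by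
  conv_rhs => rw [← (EuclideanSpace.basisFun (Fin n) ℝ).sum_repr u]
  simp

end Coordinates

section Density

open scoped Kronecker Matrix

variable {p : ℕ}

theorem skip_eq_succAbove {n : ℕ} (j : Fin (n + 1)) (i : Fin n) : skip j i = j.succAbove i := by
  ext
  simp only [skip, Fin.succAbove, Fin.lt_def, Fin.val_castSucc]
  split_ifs <;> simp

theorem det_skip {R : Type*} [CommRing R] {m : ℕ} (M : Matrix (Fin m) (Fin m) R) (i j : Fin m) :
    (Matrix.of fun a b => M (skip i a) (skip j b)).det = (-1) ^ (i + j : ℕ) * M.adjugate j i := by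
  cases m with
  | zero => exact i.elim0
  | succ n =>
    have hminor : (Matrix.of fun a b : Fin n => M (skip i a) (skip j b)) =
        M.submatrix i.succAbove j.succAbove := by
      ext a b
      simp only [Matrix.of_apply, Matrix.submatrix_apply, skip_eq_succAbove]
    rw [Matrix.adjugate_fin_succ_eq_det_submatrix, ← mul_assoc, ← mul_pow, neg_one_mul, neg_neg,
      one_pow, one_mul, ← hminor]
    rfl

theorem dzSeq_xi (k : Fin (2 * p)) : dzSeq (xi k) = zc k := by
  simp [dzSeq, xi]

theorem dzSeq_yi (k : Fin (2 * p)) : dzSeq (yi k) = zcc k := by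
  have hdiv : (2 * k.1 + 1) / 2 = k := by omega
  simp [dzSeq, yi, hdiv]

/-- The matrix of the forms `dz_1, dz_1^c, …` in the standard basis. -/
def dzMatrix (p : ℕ) : Matrix (Fin (4 * p)) (Fin (4 * p)) ℂ :=
  Matrix.of fun a β => dzSeq a (EuclideanSpace.single β (1 : ℝ))

theorem dzMatrix_submatrix_coordEquiv (p : ℕ) :
    (dzMatrix p).submatrix (coordEquiv p) (coordEquiv p) =
      (1 : Matrix (Fin (2 * p)) (Fin (2 * p)) ℂ) ⊗ₖ !![1, Complex.I; 1, -Complex.I] := by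
  ext ⟨k, a⟩ ⟨l, b⟩
  rw [Matrix.submatrix_apply, Matrix.kroneckerMap_apply, Matrix.one_apply, dzMatrix,
    Matrix.of_apply]
  fin_cases a <;> fin_cases b <;>
    simp [coordEquiv_zero, coordEquiv_one, dzSeq_xi, dzSeq_yi, zc_single_xi, zc_single_yi,
      zcc_single_xi, zcc_single_yi, neg_ite]

theorem det_dzMatrix (p : ℕ) : (dzMatrix p).det = (-4) ^ p := by
  have hblock : (!![1, Complex.I; 1, -Complex.I] : Matrix (Fin 2) (Fin 2) ℂ).det ^ 2 = -4 := by
    rw [Matrix.det_fin_two_of]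
    linear_combination 4 * Complex.I_sq
  rw [← Matrix.det_submatrix_equiv_self (coordEquiv p), dzMatrix_submatrix_coordEquiv,
    Matrix.det_kronecker, Matrix.det_one, one_pow, one_mul, Fintype.card_fin, pow_mul, hblock]

theorem dzMatrix_mul_conjTranspose (p : ℕ) : dzMatrix p * (dzMatrix p)ᴴ = (2 : ℂ) • 1 := by
  have hblock : (!![1, Complex.I; 1, -Complex.I] : Matrix (Fin 2) (Fin 2) ℂ) *
      !![1, Complex.I; 1, -Complex.I]ᴴ = (2 : ℂ) • 1 := by
    ext a b
    fin_cases a <;> fin_cases b <;> simp [Matrix.mul_apply, one_add_one_eq_two]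
  have hreindex := congrArg (fun M => M * Mᴴ) (dzMatrix_submatrix_coordEquiv p)
  simp only [Matrix.conjTranspose_submatrix, Matrix.submatrix_mul_equiv,
    Matrix.conjTranspose_kronecker, ← Matrix.mul_kronecker_mul, hblock,
    Matrix.conjTranspose_one, Matrix.mul_one, Matrix.kronecker_smul, Matrix.one_kronecker_one]
    at hreindex
  refine (Matrix.reindex (coordEquiv p).symm (coordEquiv p).symm).injective ?_
  simpa only [Matrix.reindex_apply, Equiv.symm_symm, Matrix.submatrix_smul, Pi.smul_apply,
    Matrix.submatrix_one_equiv] using hreindex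

theorem adjugate_dzMatrix (p : ℕ) : (dzMatrix p).adjugate = ((-4) ^ p / 2 : ℂ) • (dzMatrix p)ᴴ := by
  have h := congrArg ((dzMatrix p).adjugate * ·) (dzMatrix_mul_conjTranspose p)
  simp only [← Matrix.mul_assoc, Matrix.adjugate_mul, det_dzMatrix, Matrix.smul_mul, Matrix.one_mul,
    Matrix.mul_smul, Matrix.mul_one] at h
  rw [div_eq_inv_mul, ← smul_smul, h, inv_smul_smul₀ two_ne_zero]

theorem vecMul_conjTranspose_dzMatrix (ν : V p) (i : Fin (4 * p)) :
    ((fun α => (ν α : ℂ)) ᵥ* (dzMatrix p)ᴴ) i = starRingEnd ℂ (dzSeq i ν) := by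
  simp [← sum_smul_map_single (dzSeq i) ν, Matrix.vecMul, dotProduct, dzMatrix]

/-- The density of a complex valued form. -/
def scalarDensity (η : TopForm p ℂ) (ν : V p) : ℂ :=
  ∑ α : Fin (4 * p),
    ((-1 : ℂ) ^ (α : ℕ) * (ν α : ℂ)) * η (fun i => EuclideanSpace.single (skip α i) (1 : ℝ))

theorem scalarDensity_wedge_skip (i : Fin (4 * p)) (ν : V p) :
    scalarDensity (wedge fun a => dzSeq (skip i a)) ν =
      (-1) ^ (i : ℕ) * ((-4) ^ p / 2 * starRingEnd ℂ (dzSeq i ν)) := by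
  have hminor (α : Fin (4 * p)) :
      wedge (fun a => dzSeq (skip i a)) (fun b => EuclideanSpace.single (skip α b) (1 : ℝ)) =
        (-1) ^ (i + α : ℕ) * (dzMatrix p).adjugate α i := det_skip (dzMatrix p) i α
  have hsign (α : Fin (4 * p)) : (-1 : ℂ) ^ (α : ℕ) * (-1) ^ (α : ℕ) = 1 := by
    rw [← mul_pow, neg_one_mul, neg_neg, one_pow]
  rw [← vecMul_conjTranspose_dzMatrix, ← smul_eq_mul (_ / _), ← Pi.smul_apply,
    ← Matrix.vecMul_smul, ← adjugate_dzMatrix, scalarDensity, Matrix.vecMul, dotProduct,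
    Finset.mul_sum]
  refine Finset.sum_congr rfl fun α _ => ?_
  rw [hminor, pow_add]
  linear_combination (ν α * (-1) ^ (i : ℕ) * (dzMatrix p).adjugate α i) * hsign α

theorem scalarDensity_hatdz (k : Fin (2 * p)) (ν : V p) :
    scalarDensity (hatdz k) ν = (-4) ^ p / 2 * zcc k ν := by
  rw [hatdz, scalarDensity_wedge_skip, dzSeq_xi, conj_zc]
  simp [xi, pow_mul]

theorem scalarDensity_hatdzc (k : Fin (2 * p)) (ν : V p) :
    scalarDensity (hatdzc k) ν = -((-4) ^ p / 2 * zc k ν) := by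
  rw [hatdzc, scalarDensity_wedge_skip, dzSeq_yi, conj_zcc]
  simp [yi, pow_succ, pow_mul]

theorem density_tens (a : Cl p) (η : TopForm p ℂ) (ν : V p) :
    density (tens a η) ν = scalarDensity η ν • a := by
  simp only [density, scalarDensity, Finset.sum_smul, mul_smul]
  rfl

theorem density_add (η θ : TopForm p (Cl p)) (ν : V p) :
    density (η + θ) ν = density η ν + density θ ν := by
  simp only [density, AlternatingMap.add_apply, smul_add, Finset.sum_add_distrib]

theorem density_neg (η : TopForm p (Cl p)) (ν : V p) : density (-η) ν = -density η ν := by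
  simp only [density, AlternatingMap.neg_apply, smul_neg, Finset.sum_neg_distrib]

theorem density_sub (η θ : TopForm p (Cl p)) (ν : V p) :
    density (η - θ) ν = density η ν - density θ ν := by
  rw [sub_eq_add_neg, density_add, density_neg, sub_eq_add_neg]

theorem density_sum {ι : Type*} (s : Finset ι) (η : ι → TopForm p (Cl p)) (ν : V p) :
    density (∑ i ∈ s, η i) ν = ∑ i ∈ s, density (η i) ν :=
  map_sum (AddMonoidHom.mk' (density · ν) (density_add · · ν)) η s

theorem density_sandwich (a b : Cl p) (η : TopForm p (Cl p)) (ν : V p) :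
    density (sandwich a η b) ν = a * density η ν * b := by
  simp only [density, Finset.mul_sum, Finset.sum_mul, mul_smul_comm, smul_mul_assoc]
  rfl

theorem density_dσ (ν : V p) : density (dσ p) ν = ((-4 : ℂ) ^ p / 2) • hzd ν := by
  simp only [dσ, density_sum, density_tens, scalarDensity_hatdz, hzd, Finset.smul_sum, mul_smul]

theorem density_dσd (ν : V p) : density (dσd p) ν = ((-4 : ℂ) ^ p / 2) • hz ν := by
  simp only [dσd, density_neg, density_sum, density_tens, scalarDensity_hatdzc, hz,
    Finset.smul_sum, mul_smul, neg_smul, Finset.sum_neg_distrib, neg_neg]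

theorem density_dσJ (ν : V p) : density (dσJ p) ν = ((-4 : ℂ) ^ p / 2) • hzdJ ν := by
  simp only [dσJ, density_sum, density_sub, density_tens, scalarDensity_hatdz, hzdJ,
    Finset.smul_sum, mul_smul, smul_sub]

theorem density_dσdJ (ν : V p) : density (dσdJ p) ν = ((-4 : ℂ) ^ p / 2) • hzJ ν := by
  simp only [dσdJ, density_sum, density_sub, density_tens, scalarDensity_hatdzc,
    hzJ, Finset.smul_sum, mul_smul, smul_sub, neg_smul, neg_sub_neg, ← Finset.sum_neg_distrib,
    neg_sub]

end Density

/-! ### The Witt basis and the hermitian vector variables -/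

section Witt

open scoped Matrix

variable {p : ℕ}

theorem negForm_apply (a : Fin (4 * p) → ℂ) : negForm p a = -(a ⬝ᵥ a) := by
  simp [negForm, QuadraticMap.weightedSumSquares_apply, dotProduct]

theorem ι_mul_ι_add_swap_eq_dotProduct (a b : Fin (4 * p) → ℂ) :
    CliffordAlgebra.ι (negForm p) a * CliffordAlgebra.ι (negForm p) b +
        CliffordAlgebra.ι (negForm p) b * CliffordAlgebra.ι (negForm p) a =
      (-2 * (a ⬝ᵥ b)) • 1 := by
  rw [CliffordAlgebra.ι_mul_ι_add_swap, Algebra.algebraMap_eq_smul_one, QuadraticMap.polar]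
  simp only [negForm_apply, dotProduct_add, add_dotProduct, dotProduct_comm b a]
  ring_nf

/-- The vector of `ℂ^{4p}` whose image in the Clifford algebra is `𝔣_k`. -/
def fVec (k : Fin (2 * p)) : Fin (4 * p) → ℂ :=
  (-(1 / 2) : ℂ) • (Pi.single (xi k) 1 - Complex.I • Pi.single (yi k) 1)

/-- The vector of `ℂ^{4p}` whose image in the Clifford algebra is `𝔣_k†`. -/
def fdVec (k : Fin (2 * p)) : Fin (4 * p) → ℂ :=
  (1 / 2 : ℂ) • (Pi.single (xi k) 1 + Complex.I • Pi.single (yi k) 1)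

theorem fVec_dotProduct (k : Fin (2 * p)) (w : Fin (4 * p) → ℂ) :
    fVec k ⬝ᵥ w = -(1 / 2) * (w (xi k) - Complex.I * w (yi k)) := by
  simp [fVec]

theorem fdVec_dotProduct (k : Fin (2 * p)) (w : Fin (4 * p) → ℂ) :
    fdVec k ⬝ᵥ w = 1 / 2 * (w (xi k) + Complex.I * w (yi k)) := by
  simp [fdVec, mul_add]

theorem fVec_xi (k l : Fin (2 * p)) : fVec k (xi l) = if l = k then -(1 / 2) else 0 := by
  simp [fVec, Pi.single_apply, xi_inj, xi_ne_yi]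

theorem fVec_yi (k l : Fin (2 * p)) : fVec k (yi l) = if l = k then Complex.I / 2 else 0 := by
  simp [fVec, Pi.single_apply, yi_inj, (xi_ne_yi _ _).symm, div_eq_inv_mul, neg_ite]

theorem fdVec_xi (k l : Fin (2 * p)) : fdVec k (xi l) = if l = k then 1 / 2 else 0 := by
  simp [fdVec, Pi.single_apply, xi_inj, xi_ne_yi]

theorem fdVec_yi (k l : Fin (2 * p)) : fdVec k (yi l) = if l = k then Complex.I / 2 else 0 := by
  simp [fdVec, Pi.single_apply, yi_inj, (xi_ne_yi _ _).symm, div_eq_inv_mul]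

theorem fVec_dotProduct_fVec (k l : Fin (2 * p)) : fVec k ⬝ᵥ fVec l = 0 := by
  rw [fVec_dotProduct, fVec_xi, fVec_yi]
  split_ifs
  · linear_combination (1 / 4 : ℂ) * Complex.I_sq
  · ring

theorem fdVec_dotProduct_fdVec (k l : Fin (2 * p)) : fdVec k ⬝ᵥ fdVec l = 0 := by
  rw [fdVec_dotProduct, fdVec_xi, fdVec_yi]
  split_ifs
  · linear_combination (1 / 4 : ℂ) * Complex.I_sq
  · ring

theorem fVec_dotProduct_fdVec (k l : Fin (2 * p)) :
    fVec k ⬝ᵥ fdVec l = if k = l then -(1 / 2) else 0 := by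
  rw [fVec_dotProduct, fdVec_xi, fdVec_yi]
  split_ifs
  · linear_combination (1 / 4 : ℂ) * Complex.I_sq
  · ring

theorem sum_smul_f (a : Fin (2 * p) → ℂ) :
    ∑ k, a k • f k = CliffordAlgebra.ι (negForm p) (∑ k, a k • fVec k) := by
  simp [f, fVec, e]

theorem sum_smul_fd (a : Fin (2 * p) → ℂ) :
    ∑ k, a k • fd k = CliffordAlgebra.ι (negForm p) (∑ k, a k • fdVec k) := by
  simp [fd, fdVec, e]

theorem sum_smul_f_mul_self (a : Fin (2 * p) → ℂ) :
    (∑ k, a k • f k) * (∑ k, a k • f k) = (0 : Cl p) := by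
  rw [sum_smul_f, CliffordAlgebra.ι_sq_scalar, negForm_apply]
  simp [sum_dotProduct, dotProduct_sum, fVec_dotProduct_fVec]

theorem sum_smul_fd_mul_self (a : Fin (2 * p) → ℂ) :
    (∑ k, a k • fd k) * (∑ k, a k • fd k) = (0 : Cl p) := by
  rw [sum_smul_fd, CliffordAlgebra.ι_sq_scalar, negForm_apply]
  simp [sum_dotProduct, dotProduct_sum, fdVec_dotProduct_fdVec]

theorem sum_smul_f_mul_sum_smul_fd_add_swap (a b : Fin (2 * p) → ℂ) :
    (∑ k, a k • f k) * (∑ k, b k • fd k) + (∑ k, b k • fd k) * (∑ k, a k • f k) =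
      (∑ k, a k * b k) • (1 : Cl p) := by
  have hdot (k : Fin (2 * p)) : fVec k ⬝ᵥ ∑ l, b l • fdVec l = -(1 / 2) * b k := by
    simp [dotProduct_sum, fVec_dotProduct_fdVec, mul_comm]
  rw [sum_smul_f, sum_smul_fd, ι_mul_ι_add_swap_eq_dotProduct, sum_dotProduct, Finset.mul_sum]
  congr! 2 with k
  rw [smul_dotProduct, hdot, smul_eq_mul]
  ring

/-- The family `(a_2, -a_1, a_4, -a_3, …)`, through which the rotation `𝕁` acts on coefficients
with respect to the Witt basis. -/
def swapPairs {M : Type*} [Neg M] (a : Fin (2 * p) → M) (k : Fin (2 * p)) : M :=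
  if ((pairEquiv p).symm k).2 = 0 then a (snd ((pairEquiv p).symm k).1)
    else -a (fst ((pairEquiv p).symm k).1)

theorem swapPairs_fst {M : Type*} [Neg M] (a : Fin (2 * p) → M) (j : Fin p) :
    swapPairs a (fst j) = a (snd j) := by
  simp [swapPairs, ← pairEquiv_zero]

theorem swapPairs_snd {M : Type*} [Neg M] (a : Fin (2 * p) → M) (j : Fin p) :
    swapPairs a (snd j) = -a (fst j) := by
  simp [swapPairs, ← pairEquiv_one]

theorem hzJ_eq_sum (v : V p) : hzJ v = ∑ k, swapPairs (fun k => zc k v) k • fd k := by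
  simp only [hzJ, sum_pair, swapPairs_fst, swapPairs_snd, neg_smul, sub_eq_add_neg]

theorem hzdJ_eq_sum (v : V p) : hzdJ v = ∑ k, swapPairs (fun k => zcc k v) k • f k := by
  simp only [hzdJ, sum_pair, swapPairs_fst, swapPairs_snd, neg_smul, sub_eq_add_neg]

theorem hzJ_eq_neg_sum (v : V p) : hzJ v = -∑ k, zc k v • swapPairs fd k := by
  simp only [hzJ, sum_pair, swapPairs_fst, swapPairs_snd, smul_neg, ← Finset.sum_neg_distrib]
  exact Finset.sum_congr rfl fun j _ => by abel

theorem hzdJ_eq_neg_sum (v : V p) : hzdJ v = -∑ k, zcc k v • swapPairs f k := by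
  simp only [hzdJ, sum_pair, swapPairs_fst, swapPairs_snd, smul_neg, ← Finset.sum_neg_distrib]
  exact Finset.sum_congr rfl fun j _ => by abel

theorem sum_swapPairs_mul_swapPairs {R : Type*} [CommRing R] (a b : Fin (2 * p) → R) :
    ∑ k, swapPairs a k * swapPairs b k = ∑ k, a k * b k := by
  simp only [sum_pair, swapPairs_fst, swapPairs_snd, neg_mul_neg, add_comm]

theorem hz_mul_hzd_add_swap (v : V p) :
    hz v * hzd v + hzd v * hz v = ((‖v‖ ^ 2 : ℝ) : ℂ) • 1 := by
  rw [hz, hzd, sum_smul_f_mul_sum_smul_fd_add_swap, sum_zc_mul_zcc]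

theorem hzJ_mul_hzdJ_add_swap (v : V p) :
    hzJ v * hzdJ v + hzdJ v * hzJ v = ((‖v‖ ^ 2 : ℝ) : ℂ) • 1 := by
  rw [hzJ_eq_sum, hzdJ_eq_sum, add_comm, sum_smul_f_mul_sum_smul_fd_add_swap,
    sum_swapPairs_mul_swapPairs, ← sum_zc_mul_zcc]
  simp only [mul_comm]

theorem hz_mul_self_add_hzd_mul_self (v : V p) : hz v * hz v + hzd v * hzd v = 0 := by
  rw [hz, hzd, sum_smul_f_mul_self, sum_smul_fd_mul_self, add_zero]

theorem hzJ_mul_self_add_hzdJ_mul_self (v : V p) : hzJ v * hzJ v + hzdJ v * hzdJ v = 0 := by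
  rw [hzJ_eq_sum, hzdJ_eq_sum, sum_smul_f_mul_self, sum_smul_fd_mul_self, add_zero]

end Witt

/-! ### The hermitian Dirac operators -/

section HermitianDirac

variable {p : ℕ}

/-- The first order operator `∑ B(ε_α) ∂_{X_α}` with constant coefficients. For `B` one of the
hermitian vector variables this is, up to sign and conjugation, a hermitian Dirac operator. -/
def hermitianDirac (B : V p → Cl p) (F : V p → Cl p) (X : V p) : Cl p :=
  ∑ α, B (EuclideanSpace.single α (1 : ℝ)) * pd α F X

theorem sum_zc_single_mul (b : Fin (2 * p) → Cl p) (q : Fin (4 * p) → Cl p) :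
    ∑ α, (∑ k, zc k (EuclideanSpace.single α (1 : ℝ)) • b k) * q α =
      ∑ k, b k * (q (xi k) + Complex.I • q (yi k)) := by
  simp [sum_coord, zc_single_xi, zc_single_yi, ite_smul, mul_add]

theorem sum_zcc_single_mul (b : Fin (2 * p) → Cl p) (q : Fin (4 * p) → Cl p) :
    ∑ α, (∑ k, zcc k (EuclideanSpace.single α (1 : ℝ)) • b k) * q α =
      ∑ k, b k * (q (xi k) - Complex.I • q (yi k)) := by
  simp [sum_coord, zcc_single_xi, zcc_single_yi, ite_smul, mul_add, sub_eq_add_neg]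

variable (F : V p → Cl p) (X : V p)

theorem hermitianDirac_hz :
    hermitianDirac hz F X = (-(1 / 2) : ℂ) • dirac F X + (Complex.I / 2) • diracI F X := by
  simp only [hermitianDirac, hz, sum_zc_single_mul, dirac, diracI, Finset.smul_sum,
    ← Finset.sum_add_distrib]
  refine Finset.sum_congr rfl fun k _ => ?_
  simp only [f, smul_mul_assoc, sub_mul, mul_add, mul_smul_comm]
  match_scalars <;> grind [Complex.I_sq]

theorem hermitianDirac_hzd :
    hermitianDirac hzd F X = (1 / 2 : ℂ) • dirac F X + (Complex.I / 2) • diracI F X := by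
  simp only [hermitianDirac, hzd, sum_zcc_single_mul, dirac, diracI, Finset.smul_sum,
    ← Finset.sum_add_distrib]
  refine Finset.sum_congr rfl fun k _ => ?_
  simp only [fd, smul_mul_assoc, add_mul, mul_sub, mul_smul_comm]
  match_scalars <;> grind [Complex.I_sq]

theorem hermitianDirac_hzJ :
    hermitianDirac hzJ F X = (-(1 / 2) : ℂ) • diracJ F X + (Complex.I / 2) • diracK F X := by
  simp only [hermitianDirac, hzJ_eq_neg_sum, neg_mul, Finset.sum_neg_distrib, sum_zc_single_mul]
  rw [sum_pair, ← Finset.sum_neg_distrib]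
  simp only [swapPairs_fst, swapPairs_snd, diracJ, diracK, Finset.smul_sum,
    ← Finset.sum_add_distrib]
  refine Finset.sum_congr rfl fun k _ => ?_
  simp only [fd, smul_mul_assoc, add_mul, mul_add, mul_smul_comm, neg_mul]
  match_scalars <;> grind [Complex.I_sq]

theorem hermitianDirac_hzdJ :
    hermitianDirac hzdJ F X = (1 / 2 : ℂ) • diracJ F X + (Complex.I / 2) • diracK F X := by
  simp only [hermitianDirac, hzdJ_eq_neg_sum, neg_mul, Finset.sum_neg_distrib, sum_zcc_single_mul]
  rw [sum_pair, ← Finset.sum_neg_distrib]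
  simp only [swapPairs_fst, swapPairs_snd, diracJ, diracK, Finset.smul_sum,
    ← Finset.sum_add_distrib]
  refine Finset.sum_congr rfl fun k _ => ?_
  simp only [f, smul_mul_assoc, sub_mul, mul_sub, mul_smul_comm, neg_mul]
  match_scalars <;> grind [Complex.I_sq]

variable {F X} {Ω : Set (V p)}

theorem QuaternionicMonogenicOn.hermitianDirac_hz_eq_zero (hF : QuaternionicMonogenicOn F Ω)
    (hX : X ∈ Ω) : hermitianDirac hz F X = 0 := by
  rw [hermitianDirac_hz, hF.dirac_eq_zero X hX, hF.diracI_eq_zero X hX, smul_zero, smul_zero,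
    add_zero]

theorem QuaternionicMonogenicOn.hermitianDirac_hzd_eq_zero (hF : QuaternionicMonogenicOn F Ω)
    (hX : X ∈ Ω) : hermitianDirac hzd F X = 0 := by
  rw [hermitianDirac_hzd, hF.dirac_eq_zero X hX, hF.diracI_eq_zero X hX, smul_zero, smul_zero,
    add_zero]

theorem QuaternionicMonogenicOn.hermitianDirac_hzJ_eq_zero (hF : QuaternionicMonogenicOn F Ω)
    (hX : X ∈ Ω) : hermitianDirac hzJ F X = 0 := by
  rw [hermitianDirac_hzJ, hF.diracJ_eq_zero X hX, hF.diracK_eq_zero X hX, smul_zero, smul_zero,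
    add_zero]

theorem QuaternionicMonogenicOn.hermitianDirac_hzdJ_eq_zero (hF : QuaternionicMonogenicOn F Ω)
    (hX : X ∈ Ω) : hermitianDirac hzdJ F X = 0 := by
  rw [hermitianDirac_hzdJ, hF.diracJ_eq_zero X hX, hF.diracK_eq_zero X hX, smul_zero, smul_zero,
    add_zero]

end HermitianDirac

/-! ### The reproducing formulas -/

section Reproducing

variable {p : ℕ}

instance : FiniteDimensional ℂ (Cl p) := Module.Finite.equiv (coords p).symm

-- The norm makes `Cl p` a real vector space through `ℂ`; without this instance real scalars would
-- act through the `ℝ`-algebra structure of `CliffordAlgebra`, which unification cannot identify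
-- with the former.
instance (priority := high) : SMul ℝ (Cl p) :=
  (NormedSpace.complexToReal : NormedSpace ℝ (Cl p)).toModule.toSMul

instance : FiniteDimensional ℝ (Cl p) := FiniteDimensional.complexToReal (Cl p)

instance : CompleteSpace (Cl p) := FiniteDimensional.complete ℂ (Cl p)

/-- The hermitian vector variable `hz` as a real linear map. -/
def hzLin (p : ℕ) : V p →ₗ[ℝ] Cl p where
  toFun := hz
  map_add' v w := by simp only [hz, map_add, add_smul, Finset.sum_add_distrib]
  map_smul' r v := by simp only [hz, map_smul, smul_assoc, Finset.smul_sum, RingHom.id_apply]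

/-- The hermitian vector variable `hzd` as a real linear map. -/
def hzdLin (p : ℕ) : V p →ₗ[ℝ] Cl p where
  toFun := hzd
  map_add' v w := by simp only [hzd, map_add, add_smul, Finset.sum_add_distrib]
  map_smul' r v := by simp only [hzd, map_smul, smul_assoc, Finset.smul_sum, RingHom.id_apply]

/-- The hermitian vector variable `hzJ` as a real linear map. -/
def hzJLin (p : ℕ) : V p →ₗ[ℝ] Cl p where
  toFun := hzJ
  map_add' v w := by
    simp only [hzJ_eq_neg_sum, map_add, add_smul, Finset.sum_add_distrib, neg_add]
  map_smul' r v := by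
    simp only [hzJ_eq_neg_sum, map_smul, smul_assoc, ← Finset.smul_sum, RingHom.id_apply, smul_neg]

/-- The hermitian vector variable `hzdJ` as a real linear map. -/
def hzdJLin (p : ℕ) : V p →ₗ[ℝ] Cl p where
  toFun := hzdJ
  map_add' v w := by
    simp only [hzdJ_eq_neg_sum, map_add, add_smul, Finset.sum_add_distrib, neg_add]
  map_smul' r v := by
    simp only [hzdJ_eq_neg_sum, map_smul, smul_assoc, ← Finset.smul_sum, RingHom.id_apply, smul_neg]

/-- The bilinear maps `(v, w) ↦ (A₁(v) B₁(ε_α) + A₂(v) B₂(ε_α)) w`: the unnormalized kernel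
against the densities of two forms, contracted with the unit vector `ε_α`. -/
def hermitianKernel (A₁ B₁ A₂ B₂ : V p →ₗ[ℝ] Cl p) (α : Fin (4 * p)) :
    V p →L[ℝ] Cl p →L[ℝ] Cl p :=
  LinearMap.toContinuousBilinearMap <| LinearMap.mk₂ ℝ
    (fun v w => (A₁ v * B₁ (EuclideanSpace.single α 1) +
      A₂ v * B₂ (EuclideanSpace.single α 1)) * w)
    (fun v v' w => by simp only [map_add]; noncomm_ring)
    (fun r v w => by
      rw [A₁.map_smul, A₂.map_smul]
      simp only [smul_mul_assoc, ← smul_add])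
    (fun v w w' => mul_add _ _ _)
    (fun r v w => mul_smul_comm _ _ _)

variable {A₁ B₁ A₂ B₂ : V p →ₗ[ℝ] Cl p} {D Ω : Set (V p)} {g : V p → Cl p} {X : V p} {c : ℝ}
  {η₁ η₂ : TopForm p (Cl p)}

theorem hermitianKernel_apply (α : Fin (4 * p)) (v : V p) (w : Cl p) :
    hermitianKernel A₁ B₁ A₂ B₂ α v w = (A₁ v * B₁ (EuclideanSpace.single α 1) +
      A₂ v * B₂ (EuclideanSpace.single α 1)) * w := rfl

theorem contract_hermitianKernel (u v : V p) (w : Cl p) :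
    contract u (fun α => hermitianKernel A₁ B₁ A₂ B₂ α v w) = (A₁ v * B₁ u + A₂ v * B₂ u) * w := by
  simp only [contract, hermitianKernel_apply, ← sum_smul_map_single B₁ u,
    ← sum_smul_map_single B₂ u, Finset.mul_sum, ← Finset.sum_add_distrib, Finset.sum_mul,
    mul_smul_comm, ← smul_add, smul_mul_assoc]

theorem hasIsotropicFlux_hermitianKernel
    (hAB : ∀ v, A₁ v * B₁ v + A₂ v * B₂ v = c • ((‖v‖ ^ 2 : ℝ) : ℂ) • 1) :
    HasIsotropicFlux (hermitianKernel A₁ B₁ A₂ B₂) c := fun v w => by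
  rw [contract_hermitianKernel, hAB, Complex.coe_smul, smul_smul, smul_mul_assoc, one_mul]

theorem isSolutionOn_hermitianKernel (h₁ : ∀ Y ∈ Ω, hermitianDirac B₁ g Y = 0)
    (h₂ : ∀ Y ∈ Ω, hermitianDirac B₂ g Y = 0) :
    IsSolutionOn (hermitianKernel A₁ B₁ A₂ B₂) g Ω := fun Y hY v => by
  have hsum : ∑ α, hermitianKernel A₁ B₁ A₂ B₂ α v (pd α g Y) =
      A₁ v * hermitianDirac B₁ g Y + A₂ v * hermitianDirac B₂ g Y := by
    simp only [hermitianKernel_apply, hermitianDirac, add_mul, mul_assoc, Finset.sum_add_distrib,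
      Finset.mul_sum]
  exact hsum.trans (by rw [h₁ Y hY, h₂ Y hY, mul_zero, mul_zero, add_zero])

theorem area_eq (p : ℕ) : area p = μHE[4 * p - 1].real (Metric.sphere (0 : V p) 1) := rfl

theorem area_pos [NeZero p] : 0 < area p := measureReal_sphere_pos

theorem density_sandwich_add_sandwich (hη₁ : ∀ ν, density η₁ ν = ((-4 : ℂ) ^ p / 2) • B₁ ν)
    (hη₂ : ∀ ν, density η₂ ν = ((-4 : ℂ) ^ p / 2) • B₂ ν) (v ν : V p) (b : Cl p) :
    density (sandwich (kerFactor v • A₁ v) η₁ b + sandwich (kerFactor v • A₂ v) η₂ b) ν =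
      ((-4 : ℂ) ^ p / area p) • contract ν fun α =>
        (‖v‖ ^ (4 * p))⁻¹ • hermitianKernel A₁ B₁ A₂ B₂ α v b := by
  have hfactor : kerFactor v * ((-4 : ℂ) ^ p / 2) =
      (-4 : ℂ) ^ p / area p * ((‖v‖ ^ (4 * p))⁻¹ : ℝ) := by
    rw [kerFactor]
    push_cast
    ring
  rw [← Pi.smul_def, contract_smul_right, contract_hermitianKernel, density_add, density_sandwich,
    density_sandwich, hη₁, hη₂, smul_mul_smul_comm, smul_mul_smul_comm, ← add_mul, ← smul_add,
    smul_mul_assoc, hfactor, mul_smul, Complex.coe_smul]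

theorem boundaryIntegrable_sandwich (hD : IsOpen D) (hb : Bornology.IsBounded D)
    (hs : HasSmoothBoundary D) (hg : ContinuousOn g (frontier D)) (hX : X ∈ D)
    (hη₁ : ∀ ν, density η₁ ν = ((-4 : ℂ) ^ p / 2) • B₁ ν)
    (hη₂ : ∀ ν, density η₂ ν = ((-4 : ℂ) ^ p / 2) • B₂ ν) :
    BoundaryIntegrable D fun Y => sandwich (kerFactor (Y - X) • A₁ (Y - X)) η₁ (g Y) +
      sandwich (kerFactor (Y - X) • A₂ (Y - X)) η₂ (g Y) := by
  have hN := hs.isOutwardNormalField hD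
  simp only [BoundaryIntegrable, density_sandwich_add_sandwich hη₁ hη₂]
  exact (integrableOn_frontier hD hb hN (continuousOn_cauchyKernel hD hN hg hX)).smul
    ((-4 : ℂ) ^ p / area p)

theorem boundaryIntegral_sandwich [NeZero p] (hD : IsOpen D) (hb : Bornology.IsBounded D)
    (hs : HasSmoothBoundary D) (hΩ : IsOpen Ω) (hDΩ : closure D ⊆ Ω)
    (hg : DifferentiableOn ℝ g Ω) (hX : X ∈ D)
    (hAB : ∀ v, A₁ v * B₁ v + A₂ v * B₂ v = c • ((‖v‖ ^ 2 : ℝ) : ℂ) • 1)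
    (h₁ : ∀ Y ∈ Ω, hermitianDirac B₁ g Y = 0) (h₂ : ∀ Y ∈ Ω, hermitianDirac B₂ g Y = 0)
    (hη₁ : ∀ ν, density η₁ ν = ((-4 : ℂ) ^ p / 2) • B₁ ν)
    (hη₂ : ∀ ν, density η₂ ν = ((-4 : ℂ) ^ p / 2) • B₂ ν) :
    boundaryIntegral D (fun Y => sandwich (kerFactor (Y - X) • A₁ (Y - X)) η₁ (g Y) +
      sandwich (kerFactor (Y - X) • A₂ (Y - X)) η₂ (g Y)) = c • (-4 : ℂ) ^ p • g X := by
  have harea : (area p : ℂ) ≠ 0 := Complex.ofReal_ne_zero.2 area_pos.ne'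
  have hcauchy := integral_contract_cauchyKernel hD hb (hs.isOutwardNormalField hD) hΩ hDΩ
    (hasIsotropicFlux_hermitianKernel hAB) hg (isSolutionOn_hermitianKernel h₁ h₂) hX
  simp only [boundaryIntegral, density_sandwich_add_sandwich hη₁ hη₂]
  rw [integral_smul, hcauchy, ← area_eq, ← Complex.coe_smul, ← Complex.coe_smul, smul_smul,
    smul_smul]
  congr 1
  push_cast
  field_simp

theorem boundaryIntegrable_reproForm (hD : IsOpen D) (hb : Bornology.IsBounded D)
    (hs : HasSmoothBoundary D) (hg : ContinuousOn g (frontier D)) (hX : X ∈ D) :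
    BoundaryIntegrable D (reproForm g X) :=
  boundaryIntegrable_sandwich (A₁ := hzLin p) (B₁ := hzdLin p) (A₂ := hzdLin p) (B₂ := hzLin p)
    hD hb hs hg hX density_dσ density_dσd

theorem boundaryIntegrable_reproFormJ (hD : IsOpen D) (hb : Bornology.IsBounded D)
    (hs : HasSmoothBoundary D) (hg : ContinuousOn g (frontier D)) (hX : X ∈ D) :
    BoundaryIntegrable D (reproFormJ g X) :=
  boundaryIntegrable_sandwich (A₁ := hzJLin p) (B₁ := hzdJLin p) (A₂ := hzdJLin p)
    (B₂ := hzJLin p) hD hb hs hg hX density_dσJ density_dσdJ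

theorem boundaryIntegrable_crossForm (hD : IsOpen D) (hb : Bornology.IsBounded D)
    (hs : HasSmoothBoundary D) (hg : ContinuousOn g (frontier D)) (hX : X ∈ D) :
    BoundaryIntegrable D (crossForm g X) :=
  boundaryIntegrable_sandwich (A₁ := hzLin p) (B₁ := hzLin p) (A₂ := hzdLin p) (B₂ := hzdLin p)
    hD hb hs hg hX density_dσd density_dσ

theorem boundaryIntegrable_crossFormJ (hD : IsOpen D) (hb : Bornology.IsBounded D)
    (hs : HasSmoothBoundary D) (hg : ContinuousOn g (frontier D)) (hX : X ∈ D) :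
    BoundaryIntegrable D (crossFormJ g X) :=
  boundaryIntegrable_sandwich (A₁ := hzJLin p) (B₁ := hzJLin p) (A₂ := hzdJLin p)
    (B₂ := hzdJLin p) hD hb hs hg hX density_dσdJ density_dσJ

theorem boundaryIntegral_reproForm [NeZero p] (hD : IsOpen D) (hb : Bornology.IsBounded D)
    (hs : HasSmoothBoundary D) (hΩ : IsOpen Ω) (hDΩ : closure D ⊆ Ω)
    (hg : QuaternionicMonogenicOn g Ω) (hX : X ∈ D) :
    boundaryIntegral D (reproForm g X) = (-4 : ℂ) ^ p • g X := by
  have h := boundaryIntegral_sandwich (A₁ := hzLin p) (B₁ := hzdLin p) (A₂ := hzdLin p)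
    (B₂ := hzLin p) (c := 1) hD hb hs hΩ hDΩ hg.differentiableOn hX
    (fun v => by rw [one_smul]; exact hz_mul_hzd_add_swap v)
    (fun _ => hg.hermitianDirac_hzd_eq_zero) (fun _ => hg.hermitianDirac_hz_eq_zero)
    density_dσ density_dσd
  rwa [one_smul] at h

theorem boundaryIntegral_reproFormJ [NeZero p] (hD : IsOpen D) (hb : Bornology.IsBounded D)
    (hs : HasSmoothBoundary D) (hΩ : IsOpen Ω) (hDΩ : closure D ⊆ Ω)
    (hg : QuaternionicMonogenicOn g Ω) (hX : X ∈ D) :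
    boundaryIntegral D (reproFormJ g X) = (-4 : ℂ) ^ p • g X := by
  have h := boundaryIntegral_sandwich (A₁ := hzJLin p) (B₁ := hzdJLin p) (A₂ := hzdJLin p)
    (B₂ := hzJLin p) (c := 1) hD hb hs hΩ hDΩ hg.differentiableOn hX
    (fun v => by rw [one_smul]; exact hzJ_mul_hzdJ_add_swap v)
    (fun _ => hg.hermitianDirac_hzdJ_eq_zero) (fun _ => hg.hermitianDirac_hzJ_eq_zero)
    density_dσJ density_dσdJ
  rwa [one_smul] at h

theorem boundaryIntegral_crossForm [NeZero p] (hD : IsOpen D) (hb : Bornology.IsBounded D)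
    (hs : HasSmoothBoundary D) (hΩ : IsOpen Ω) (hDΩ : closure D ⊆ Ω)
    (hg : QuaternionicMonogenicOn g Ω) (hX : X ∈ D) :
    boundaryIntegral D (crossForm g X) = 0 := by
  have h := boundaryIntegral_sandwich (A₁ := hzLin p) (B₁ := hzLin p) (A₂ := hzdLin p)
    (B₂ := hzdLin p) (c := 0) hD hb hs hΩ hDΩ hg.differentiableOn hX
    (fun v => by rw [zero_smul]; exact hz_mul_self_add_hzd_mul_self v)
    (fun _ => hg.hermitianDirac_hz_eq_zero) (fun _ => hg.hermitianDirac_hzd_eq_zero)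
    density_dσd density_dσ
  rwa [zero_smul] at h

theorem boundaryIntegral_crossFormJ [NeZero p] (hD : IsOpen D) (hb : Bornology.IsBounded D)
    (hs : HasSmoothBoundary D) (hΩ : IsOpen Ω) (hDΩ : closure D ⊆ Ω)
    (hg : QuaternionicMonogenicOn g Ω) (hX : X ∈ D) :
    boundaryIntegral D (crossFormJ g X) = 0 := by
  have h := boundaryIntegral_sandwich (A₁ := hzJLin p) (B₁ := hzJLin p) (A₂ := hzdJLin p)
    (B₂ := hzdJLin p) (c := 0) hD hb hs hΩ hDΩ hg.differentiableOn hX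
    (fun v => by rw [zero_smul]; exact hzJ_mul_self_add_hzdJ_mul_self v)
    (fun _ => hg.hermitianDirac_hzJ_eq_zero) (fun _ => hg.hermitianDirac_hzdJ_eq_zero)
    density_dσdJ density_dσJ
  rwa [zero_smul] at h

end Reproducing

end QuatClifford

end

theorem mainTheorem2_general (p : ℕ) (hp : 1 ≤ p)
    (D : Set (QuatClifford.V p)) (hD_open : IsOpen D)
    (hD_bdd : Bornology.IsBounded D) (hD_smooth : QuatClifford.HasSmoothBoundary D)
    (Ω : Set (QuatClifford.V p)) (hΩ : IsOpen Ω) (hDΩ : closure D ⊆ Ω)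
    (g : QuatClifford.V p → QuatClifford.Cl p)
    (hg : QuatClifford.QuaternionicMonogenicOn g Ω)
    (X : QuatClifford.V p) (hX : X ∈ interior D) :
    (QuatClifford.BoundaryIntegrable D (QuatClifford.reproForm g X) ∧
      g X = (1 / (-4 : ℂ) ^ p) •
        QuatClifford.boundaryIntegral D (QuatClifford.reproForm g X)) ∧
    (QuatClifford.BoundaryIntegrable D (QuatClifford.reproFormJ g X) ∧
      g X = (1 / (-4 : ℂ) ^ p) •
        QuatClifford.boundaryIntegral D (QuatClifford.reproFormJ g X)) ∧
    (QuatClifford.BoundaryIntegrable D (QuatClifford.crossForm g X) ∧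
      QuatClifford.boundaryIntegral D (QuatClifford.crossForm g X) = 0) ∧
    (QuatClifford.BoundaryIntegrable D (QuatClifford.crossFormJ g X) ∧
      QuatClifford.boundaryIntegral D (QuatClifford.crossFormJ g X) = 0) := by
  have : NeZero p := ⟨by omega⟩
  have hXD : X ∈ D := interior_subset hX
  have hg_cont : ContinuousOn g (frontier D) :=
    hg.differentiableOn.continuousOn.mono (frontier_subset_closure.trans hDΩ)
  have h4 : (-4 : ℂ) ^ p ≠ 0 := pow_ne_zero p (by norm_num)
  refine ⟨⟨QuatClifford.boundaryIntegrable_reproForm hD_open hD_bdd hD_smooth hg_cont hXD, ?_⟩,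
    ⟨QuatClifford.boundaryIntegrable_reproFormJ hD_open hD_bdd hD_smooth hg_cont hXD, ?_⟩,
    ⟨QuatClifford.boundaryIntegrable_crossForm hD_open hD_bdd hD_smooth hg_cont hXD,
      QuatClifford.boundaryIntegral_crossForm hD_open hD_bdd hD_smooth hΩ hDΩ hg hXD⟩,
    ⟨QuatClifford.boundaryIntegrable_crossFormJ hD_open hD_bdd hD_smooth hg_cont hXD,
      QuatClifford.boundaryIntegral_crossFormJ hD_open hD_bdd hD_smooth hΩ hDΩ hg hXD⟩⟩
  · rw [QuatClifford.boundaryIntegral_reproForm hD_open hD_bdd hD_smooth hΩ hDΩ hg hXD, one_div,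
      inv_smul_smul₀ h4]
  · rw [QuatClifford.boundaryIntegral_reproFormJ hD_open hD_bdd hD_smooth hΩ hDΩ hg hXD, one_div,
      inv_smul_smul₀ h4]

theorem mainTheorem2 (p : ℕ) (hp : 1 ≤ p)
    (D : Set (QuatClifford.V p)) (hD_open : IsOpen D) (hD_conn : IsConnected D)
    (hD_bdd : Bornology.IsBounded D) (hD_smooth : QuatClifford.HasSmoothBoundary D)
    (Ω : Set (QuatClifford.V p)) (hΩ : IsOpen Ω) (hDΩ : closure D ⊆ Ω)
    (g : QuatClifford.V p → QuatClifford.Cl p)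
    (hg : QuatClifford.QuaternionicMonogenicOn g Ω)
    (X : QuatClifford.V p) (hX : X ∈ interior D) :
    (QuatClifford.BoundaryIntegrable D (QuatClifford.reproForm g X) ∧
      g X = (1 / (-4 : ℂ) ^ p) •
        QuatClifford.boundaryIntegral D (QuatClifford.reproForm g X)) ∧
    (QuatClifford.BoundaryIntegrable D (QuatClifford.reproFormJ g X) ∧
      g X = (1 / (-4 : ℂ) ^ p) •
        QuatClifford.boundaryIntegral D (QuatClifford.reproFormJ g X)) ∧
    (QuatClifford.BoundaryIntegrable D (QuatClifford.crossForm g X) ∧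
      QuatClifford.boundaryIntegral D (QuatClifford.crossForm g X) = 0) ∧
    (QuatClifford.BoundaryIntegrable D (QuatClifford.crossFormJ g X) ∧
      QuatClifford.boundaryIntegral D (QuatClifford.crossFormJ g X) = 0) :=
  mainTheorem2_general p hp D hD_open hD_bdd hD_smooth Ω hΩ hDΩ g hg X hX
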